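/- **Theorem 3.1.** Let $p>0$ and let $\bar F:C^0([0,1])\to C^0([0,1])$ be a continuous mapping with $\bar F(0)=0$ for which there is a non-decreasing function $L:[0,+\infty)\to(0,+\infty)$ such that $$\|\bar F(u)-\bar F(v)\|_\infty\le L\big(\max(\|u\|_\infty,\|v\|_\infty)\big)\,\|u-v\|_\infty\qquad\text{for all }u,v\in C^0([0,1]).$$ Let $\bar k\in C^2([0,1])$ with $\bar k(0)=0$. Write $\langle\cdot,\cdot\rangle$ and $\|\cdot\|_2$ for the inner product and norm of $L^2(0,1)$, $u[t]$ for the profile $x\mapsto u(t,x)$, and let $K,G:L^2(0,1)\to L^2(0,1)$ be the continuous linear operators $$(Ku)(x)=u(x)-\int_0^x\bar k(s)u(s)\,ds,\qquad (Gu)(x)=2\bar k'(x)u(x)-\int_0^x\bar k''(s)u(s)\,ds .$$ For $T\in(0,+\infty]$ and $u_0\in H^2(0,1)$, a *solution on $[0,T)$ with initial datum $u_0$* is a mapping $u\in C^0([0,T)\times[0,1])\cap C^1((0,T);L^2(0,1))$ with $u[0]=u_0$ and $u[t]\in H^2(0,1)$ for all $t\in[0,T)$, such that $$u_t[t]=p\,u_{xx}[t]+\bar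 F(u[t])\quad\text{in }L^2(0,1),\ \text{for }t\in(0,T),$$ $$u(t,0)=0,\qquad u(t,1)=\langle\bar k,u[t]\rangle,\quad\text{for }t\in[0,T).$$ Then for every $u_0\in H^2(0,1)$ with $u_0(0)=0$ and $u_0(1)=\langle\bar k,u_0\rangle$ there exist $t_{\max}=t_{\max}(u_0)\in(0,+\infty]$ and a solution $u$ on $[0,t_{\max})$ with initial datum $u_0$ such that: * (uniqueness and maximality) if $T\in(0,+\infty]$ and $v$ is a solution on $[0,T)$ with initial datum $u_0$, then $T\le t_{\max}$ and $v=u$ on $[0,T)\times[0,1]$; * the mapping $t\mapsto\|u_x[t]-\bar k u[t]\|_2^2$ is $C^1$ on $[0,t_{\max})$ and, for all $t\in[0,t_{\max})$ (with the one-sided derivative at $t=0$), $$\frac{d}{dt}\|u_x[t]-\bar k u[t]\|_2^2=-2p\,\|u_{xx}[t]-\bar k u_x[t]-\bar k'u[t]\|_2^2-2\big\langle K\bar F(u[t])+p\,Gu[t],\;u_{xx}[t]-\bar k u_x[t]-\bar k'u[t]\big\rangle;\tag{3.4}$$ * if $t_{\max}<+\infty$, then $\lim_{t\to t_{\max}^-}\|u[t]\|_\infty=+\infty$.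 -/

import Mathlib

open Set Filter Topology MeasureTheory

noncomputable section

namespace ReactionDiffusion

/-- Lebesgue measure on the open interval `(0,1)`. -/
abbrev μ01 : Measure ℝ := volume.restrict (Ioo (0 : ℝ) 1)

/-- The Hilbert space `L²(0,1)` of real functions. -/
abbrev L2 : Type := Lp ℝ 2 μ01

/-- The space `C⁰([0,1])` with the sup-norm. -/
abbrev C01 : Type := C(Icc (0 : ℝ) 1, ℝ)

/-- A function continuous on `[0,1]` is bounded almost everywhere on `(0,1)`. -/
theorem exists_ae_bound {a : ℝ → ℝ} (ha : ContinuousOn a (Icc 0 1)) :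
    ∃ C : ℝ, 0 ≤ C ∧ ∀ᵐ x ∂μ01, ‖a x‖ ≤ C := by
  obtain ⟨C, hC⟩ := isCompact_Icc.exists_bound_of_continuousOn ha
  refine ⟨max C 0, le_max_right _ _, ?_⟩
  filter_upwards [ae_restrict_mem measurableSet_Ioo] with x hx
  exact (hC x (Ioo_subset_Icc_self hx)).trans (le_max_left _ _)

theorem aestronglyMeasurable_of_continuousOn {a : ℝ → ℝ} (ha : ContinuousOn a (Icc 0 1)) :
    AEStronglyMeasurable a μ01 :=
  (ha.mono Ioo_subset_Icc_self).aestronglyMeasurable measurableSet_Ioo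

theorem memLp_of_continuousOn {a : ℝ → ℝ} (ha : ContinuousOn a (Icc 0 1)) :
    MemLp a 2 μ01 := by
  obtain ⟨C, -, hC⟩ := exists_ae_bound ha
  exact MemLp.of_bound (aestronglyMeasurable_of_continuousOn ha) C hC

/-- The function `x ↦ u x` on `[0,1]`, extended to `ℝ` by constants. -/
def toFun (u : C01) : ℝ → ℝ := IccExtend zero_le_one u

theorem continuous_toFun (u : C01) : Continuous (toFun u) := u.continuous.Icc_extend'

/-- The class in `L²(0,1)` of a function `u ∈ C⁰([0,1])`. -/
def toL2 (u : C01) : L2 := (memLp_of_continuousOn (continuous_toFun u).continuousOn).toLp (toFun u)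

theorem memLp_mul {a : ℝ → ℝ} (ha : ContinuousOn a (Icc 0 1)) (f : L2) :
    MemLp (fun x => a x * f x) 2 μ01 := by
  obtain ⟨C, -, hC⟩ := exists_ae_bound ha
  refine (Lp.memLp f).of_le_mul (c := C)
    ((aestronglyMeasurable_of_continuousOn ha).mul (Lp.memLp f).1) ?_
  filter_upwards [hC] with x hx
  rw [norm_mul]
  gcongr

/-- Multiplication `f ↦ a f` on `L²(0,1)` by a function `a` continuous on `[0,1]`. -/
def mulOp (a : ℝ → ℝ) (ha : ContinuousOn a (Icc 0 1)) : L2 →L[ℝ] L2 :=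
  LinearMap.mkContinuousOfExistsBound
    { toFun := fun f => (memLp_mul ha f).toLp _
      map_add' := fun f g => by
        rw [← MemLp.toLp_add]
        apply MemLp.toLp_congr
        filter_upwards [Lp.coeFn_add f g] with x hx
        simp only [hx, Pi.add_apply]
        ring
      map_smul' := fun c f => by
        rw [RingHom.id_apply, ← MemLp.toLp_const_smul]
        apply MemLp.toLp_congr
        filter_upwards [Lp.coeFn_smul c f] with x hx
        simp only [hx, Pi.smul_apply, smul_eq_mul]
        ring }
    (by
      obtain ⟨C, hC0, hC⟩ := exists_ae_bound ha
      refine ⟨C, fun f => Lp.norm_le_mul_norm_of_ae_le_mul ?_⟩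
      filter_upwards [hC, (memLp_mul ha f).coeFn_toLp] with x hx hx2
      refine (congrArg norm hx2).le.trans ?_
      rw [norm_mul]
      gcongr)

theorem mulOp_ae (a : ℝ → ℝ) (ha : ContinuousOn a (Icc 0 1)) (f : L2) :
    ∀ᵐ x ∂μ01, mulOp a ha f x = a x * f x :=
  (memLp_mul ha f).coeFn_toLp

theorem integrable_L2 (f : L2) : Integrable f μ01 :=
  (Lp.memLp f).integrable (by norm_num)

theorem integrableOn_L2 (f : L2) : IntegrableOn f (Icc (0 : ℝ) 1) volume := by
  rw [integrableOn_Icc_iff_integrableOn_Ioo]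
  exact integrable_L2 f

theorem intervalIntegrable_L2 (f : L2) {x : ℝ} (hx : x ∈ Icc (0 : ℝ) 1) :
    IntervalIntegrable f volume 0 x := by
  rw [intervalIntegrable_iff_integrableOn_Icc_of_le hx.1]
  exact (integrableOn_L2 f).mono_set (Icc_subset_Icc_right hx.2)

theorem continuousOn_primitive_L2 (f : L2) :
    ContinuousOn (fun x => ∫ s in (0 : ℝ)..x, f s) (Icc 0 1) := by
  have h := intervalIntegral.continuousOn_primitive_interval (μ := volume) (f := f)
    (a := (0 : ℝ)) (b := 1) (by rw [uIcc_of_le zero_le_one]; exact integrableOn_L2 f)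
  rwa [uIcc_of_le zero_le_one] at h

theorem norm_primitive_le (f : L2) {x : ℝ} (hx : x ∈ Ioo (0 : ℝ) 1) :
    ‖∫ s in (0 : ℝ)..x, f s‖ ≤ ‖f‖ := by
  have h1 : ‖∫ s in (0 : ℝ)..x, f s‖ ≤ ∫ s, ‖f s‖ ∂μ01 := by
    rw [intervalIntegral.integral_of_le hx.1.le]
    refine (norm_integral_le_integral_norm _).trans ?_
    rw [← integral_Ioc_eq_integral_Ioo]
    refine setIntegral_mono_set ?_ (Eventually.of_forall fun _ => norm_nonneg _)
      (Ioc_subset_Ioc_right hx.2.le).eventuallyLE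
    exact ((integrableOn_L2 f).mono_set Ioc_subset_Icc_self).norm
  have h2 : ∫ s, ‖f s‖ ∂μ01 = (eLpNorm f 1 μ01).toReal := by
    rw [eLpNorm_one_eq_lintegral_enorm,
      integral_norm_eq_lintegral_enorm (Lp.memLp f).1]
  have h3 : eLpNorm f 1 μ01 ≤ eLpNorm f 2 μ01 := by
    have : IsProbabilityMeasure μ01 := ⟨by simp⟩
    exact eLpNorm_le_eLpNorm_of_exponent_le (by norm_num) (Lp.memLp f).1
  rw [h2] at h1
  refine h1.trans ?_
  rw [Lp.norm_def]
  exact ENNReal.toReal_mono (Lp.memLp f).2.ne h3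

/-- The integration operator `(J f)(x) = ∫₀ˣ f(s) ds` on `L²(0,1)`. -/
def intOp : L2 →L[ℝ] L2 :=
  LinearMap.mkContinuous
    { toFun := fun f => (memLp_of_continuousOn (continuousOn_primitive_L2 f)).toLp _
      map_add' := fun f g => by
        rw [← MemLp.toLp_add]
        apply MemLp.toLp_congr
        filter_upwards [ae_restrict_mem measurableSet_Ioo] with x hx
        have hx' := Ioo_subset_Icc_self hx
        rw [Pi.add_apply, ← intervalIntegral.integral_add (intervalIntegrable_L2 f hx')
          (intervalIntegrable_L2 g hx')]
        rw [intervalIntegral.integral_of_le hx.1.le, intervalIntegral.integral_of_le hx.1.le,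
          integral_Ioc_eq_integral_Ioo, integral_Ioc_eq_integral_Ioo]
        exact integral_congr_ae
          (ae_restrict_of_ae_restrict_of_subset (Ioo_subset_Ioo_right hx.2.le)
            (Lp.coeFn_add f g))
      map_smul' := fun c f => by
        rw [RingHom.id_apply, ← MemLp.toLp_const_smul]
        apply MemLp.toLp_congr
        filter_upwards [ae_restrict_mem measurableSet_Ioo] with x hx
        rw [Pi.smul_apply, ← intervalIntegral.integral_smul]
        rw [intervalIntegral.integral_of_le hx.1.le, intervalIntegral.integral_of_le hx.1.le,
          integral_Ioc_eq_integral_Ioo, integral_Ioc_eq_integral_Ioo]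
        exact integral_congr_ae
          (ae_restrict_of_ae_restrict_of_subset (Ioo_subset_Ioo_right hx.2.le)
            (Lp.coeFn_smul c f)) }
    1 (fun f => by
      have : IsProbabilityMeasure μ01 := ⟨by simp⟩
      have h := Lp.norm_le_of_ae_bound (p := 2) (μ := μ01)
        (f := (memLp_of_continuousOn (continuousOn_primitive_L2 f)).toLp _) (norm_nonneg f) (by
        filter_upwards [ae_restrict_mem measurableSet_Ioo,
          (memLp_of_continuousOn (continuousOn_primitive_L2 f)).coeFn_toLp] with x hx hx2
        exact (congrArg norm hx2).le.trans (norm_primitive_le f hx))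
      have h1 : measureUnivNNReal μ01 = 1 := by
        rw [← ENNReal.coe_inj, coe_measureUnivNNReal]
        simp
      rw [h1] at h
      simpa using h)

theorem intOp_ae (f : L2) : ∀ᵐ x ∂μ01, intOp f x = ∫ s in (0 : ℝ)..x, f s :=
  (memLp_of_continuousOn (continuousOn_primitive_L2 f)).coeFn_toLp

/-- `g ∈ L²(0,1)` is the weak derivative of order `n` of `f ∈ L²(0,1)`:
`∫ f φ⁽ⁿ⁾ = (-1)ⁿ ∫ g φ` for all test functions `φ ∈ C_c^∞((0,1))`. -/
def HasWeakDeriv (n : ℕ) (f g : L2) : Prop :=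
  ∀ φ : ℝ → ℝ, ContDiff ℝ ((⊤ : ℕ∞) : WithTop ℕ∞) φ → HasCompactSupport φ →
    tsupport φ ⊆ Ioo (0 : ℝ) 1 →
      ∫ x, f x * iteratedDeriv n φ x ∂μ01 = (-1) ^ n * ∫ x, g x * φ x ∂μ01

/-- Weak derivatives are unique. -/
theorem HasWeakDeriv.unique {n : ℕ} {f g h : L2} (hg : HasWeakDeriv n f g)
    (hh : HasWeakDeriv n f h) : g = h := by
  have key : ∀ᵐ x ∂(volume : Measure ℝ), x ∈ Ioo (0 : ℝ) 1 → (g - h) x = 0 := by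
    refine isOpen_Ioo.ae_eq_zero_of_integral_contDiff_smul_eq_zero
      ((integrableOn_L2 (g - h)).mono_set Ioo_subset_Icc_self).locallyIntegrableOn ?_
    intro φ hφ hc hs
    have hb : ∀ e : L2, Integrable (fun x => e x * φ x) μ01 := fun e => by
      have := integrable_L2 (mulOp φ hφ.continuous.continuousOn e)
      refine this.congr ?_
      filter_upwards [mulOp_ae φ hφ.continuous.continuousOn e] with x hx
      rw [hx, mul_comm]
    have e1 := (hg φ hφ hc hs).symm.trans (hh φ hφ hc hs)
    have e2 := mul_left_cancel₀ (pow_ne_zero n (by norm_num : (-1 : ℝ) ≠ 0)) e1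
    have e3 : ∫ x, φ x • (g - h) x ∂(volume : Measure ℝ) = ∫ x, φ x • (g - h) x ∂μ01 := by
      refine (setIntegral_eq_integral_of_forall_compl_eq_zero fun x hx => ?_).symm
      rw [image_eq_zero_of_notMem_tsupport fun h' => hx (hs h'), zero_smul]
    rw [e3]
    have e4 : ∫ x, φ x • (g - h) x ∂μ01 = ∫ x, (g x * φ x - h x * φ x) ∂μ01 := by
      refine integral_congr_ae ?_
      filter_upwards [Lp.coeFn_sub g h] with x hx
      rw [hx, Pi.sub_apply, smul_eq_mul]
      ring
    rw [e4, integral_sub (hb g) (hb h), e2, sub_self]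
  have h0 : g - h = 0 := by
    rw [Lp.eq_zero_iff_ae_eq_zero]
    exact (ae_restrict_iff' measurableSet_Ioo).2 key
  exact sub_eq_zero.1 h0

/-- The weak derivative of order `n` of `f` (meaningful if it exists in `L²(0,1)`). -/
def weakDeriv (n : ℕ) (f : L2) : L2 := Classical.epsilon (HasWeakDeriv n f)

theorem HasWeakDeriv.weakDeriv_eq {n : ℕ} {f g : L2} (hg : HasWeakDeriv n f g) :
    weakDeriv n f = g :=
  (Classical.epsilon_spec (p := HasWeakDeriv n f) ⟨g, hg⟩).unique hg

/-- The Sobolev space `H^m(0,1)`: all weak derivatives up to order `m` are in `L²(0,1)`. -/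
def MemH (m : ℕ) (f : L2) : Prop := ∀ n ≤ m, ∃ g : L2, HasWeakDeriv n f g

/-- `⟨k, u⟩ = ∫₀¹ k(x) u(x) dx`. -/
def pairing (k : ℝ → ℝ) (u : C01) : ℝ := ∫ x in (0 : ℝ)..1, k x * toFun u x

/-- `k'` on `[0,1]` (one-sided at the end points). -/
def D1 (k : ℝ → ℝ) : ℝ → ℝ := derivWithin k (Icc 0 1)

/-- `k''` on `[0,1]` (one-sided at the end points). -/
def D2 (k : ℝ → ℝ) : ℝ → ℝ := derivWithin (D1 k) (Icc 0 1)

theorem continuousOn_D1 {k : ℝ → ℝ} (hk : ContDiffOn ℝ 2 k (Icc 0 1)) :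
    ContinuousOn (D1 k) (Icc 0 1) :=
  hk.continuousOn_derivWithin (uniqueDiffOn_Icc zero_lt_one) (by norm_num)

theorem continuousOn_D2 {k : ℝ → ℝ} (hk : ContDiffOn ℝ 2 k (Icc 0 1)) :
    ContinuousOn (D2 k) (Icc 0 1) :=
  (hk.derivWithin (m := 1) (uniqueDiffOn_Icc zero_lt_one) (by norm_num)).continuousOn_derivWithin
    (uniqueDiffOn_Icc zero_lt_one) le_rfl

/-- `(K u)(x) = u(x) - ∫₀ˣ k(s) u(s) ds` on `L²(0,1)`. -/
def opK (k : ℝ → ℝ) (hk : ContDiffOn ℝ 2 k (Icc 0 1)) : L2 →L[ℝ] L2 :=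
  ContinuousLinearMap.id ℝ L2 - intOp.comp (mulOp k hk.continuousOn)

/-- `(G u)(x) = 2 k'(x) u(x) - ∫₀ˣ k''(s) u(s) ds` on `L²(0,1)`. -/
def opG (k : ℝ → ℝ) (hk : ContDiffOn ℝ 2 k (Icc 0 1)) : L2 →L[ℝ] L2 :=
  (2 : ℝ) • mulOp (D1 k) (continuousOn_D1 hk) - intOp.comp (mulOp (D2 k) (continuousOn_D2 hk))

theorem intOp_mulOp_ae (a : ℝ → ℝ) (ha : ContinuousOn a (Icc 0 1)) (f : L2) :
    ∀ᵐ x ∂μ01, intOp (mulOp a ha f) x = ∫ s in (0 : ℝ)..x, a s * f s := by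
  filter_upwards [intOp_ae (mulOp a ha f), ae_restrict_mem measurableSet_Ioo] with x hx h01
  rw [hx, intervalIntegral.integral_of_le h01.1.le, intervalIntegral.integral_of_le h01.1.le,
    integral_Ioc_eq_integral_Ioo, integral_Ioc_eq_integral_Ioo]
  exact integral_congr_ae (ae_restrict_of_ae_restrict_of_subset
    (Ioo_subset_Ioo_right h01.2.le) (mulOp_ae a ha f))

theorem opK_ae (k : ℝ → ℝ) (hk : ContDiffOn ℝ 2 k (Icc 0 1)) (f : L2) :
    ∀ᵐ x ∂μ01, opK k hk f x = f x - ∫ s in (0 : ℝ)..x, k s * f s := by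
  filter_upwards [intOp_mulOp_ae k hk.continuousOn f,
    Lp.coeFn_sub f (intOp (mulOp k hk.continuousOn f))] with x h1 h2
  rw [← h1]
  exact h2

theorem opG_ae (k : ℝ → ℝ) (hk : ContDiffOn ℝ 2 k (Icc 0 1)) (f : L2) :
    ∀ᵐ x ∂μ01, opG k hk f x = 2 * D1 k x * f x - ∫ s in (0 : ℝ)..x, D2 k s * f s := by
  filter_upwards [intOp_mulOp_ae (D2 k) (continuousOn_D2 hk) f,
    mulOp_ae (D1 k) (continuousOn_D1 hk) f,
    Lp.coeFn_smul (2 : ℝ) (mulOp (D1 k) (continuousOn_D1 hk) f),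
    Lp.coeFn_sub ((2 : ℝ) • mulOp (D1 k) (continuousOn_D1 hk) f)
      (intOp (mulOp (D2 k) (continuousOn_D2 hk) f))] with x h1 h2 h3 h4
  refine h4.trans ?_
  rw [Pi.sub_apply, h3, Pi.smul_apply, h1, h2, smul_eq_mul, mul_assoc]

/-- The time interval `[0, T)`, where `T ∈ (0, +∞]`. -/
def timeIco (T : EReal) : Set ℝ := {t | 0 ≤ t ∧ (t : EReal) < T}

/-- The time interval `(0, T)`, where `T ∈ (0, +∞]`. -/
def timeIoo (T : EReal) : Set ℝ := {t | 0 < t ∧ (t : EReal) < T}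

/-- `u` (given by its profiles `u t = u[t]`) is a solution on `[0, T)` of `u_t = p u_xx + F(u)`,
`u(t,0) = 0`, `u(t,1) = ⟨k, u[t]⟩`, with `u[0] = u₀`, in the class
`C⁰([0,T) × [0,1]) ∩ C¹((0,T); L²(0,1))` and with `u[t] ∈ H²(0,1)` for all `t ∈ [0,T)`. -/
structure IsSolution (p : ℝ) (F : C01 → C01) (k : ℝ → ℝ) (u₀ : C01) (T : EReal)
    (u : ℝ → C01) : Prop where
  continuousOn : ContinuousOn (fun z : ℝ × Icc (0 : ℝ) 1 => u z.1 z.2) (timeIco T ×ˢ univ)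
  contDiffOn : ContDiffOn ℝ 1 (fun t => toL2 (u t)) (timeIoo T)
  initial : u 0 = u₀
  memH2 : ∀ t ∈ timeIco T, MemH 2 (toL2 (u t))
  pde : ∀ t ∈ timeIoo T,
    deriv (fun s => toL2 (u s)) t = p • weakDeriv 2 (toL2 (u t)) + toL2 (F (u t))
  left : ∀ t ∈ timeIco T, toFun (u t) 0 = 0
  right : ∀ t ∈ timeIco T, toFun (u t) 1 = pairing k (u t)

/-- `u_x - k u` in `L²(0,1)`. -/
def flux (k : ℝ → ℝ) (hk : ContDiffOn ℝ 2 k (Icc 0 1)) (u : C01) : L2 :=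
  weakDeriv 1 (toL2 u) - mulOp k hk.continuousOn (toL2 u)

/-- `u_xx - k u_x - k' u` in `L²(0,1)`. -/
def fluxDeriv (k : ℝ → ℝ) (hk : ContDiffOn ℝ 2 k (Icc 0 1)) (u : C01) : L2 :=
  weakDeriv 2 (toL2 u) - mulOp k hk.continuousOn (weakDeriv 1 (toL2 u))
    - mulOp (D1 k) (continuousOn_D1 hk) (toL2 u)

end ReactionDiffusion

end

open ReactionDiffusion

open Set Filter Topology MeasureTheory

noncomputable section

namespace ReactionDiffusion

/-! The Volterra operator `K` removes the nonlocal boundary condition. If `w = K u`, then `w(t,0) =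
u(t,0)` and `w(t,1) = u(t,1) - ⟨k, u[t]⟩`, so `w` satisfies homogeneous Dirichlet conditions, while
`w_x = u_x - k u` and `w_xx = u_xx - k u_x - k' u`. Two integrations by parts in `∫₀ˣ k u_xx`, with
`k 0 = 0` and `u(t,0) = 0`, give `K u_xx = w_xx + G u` (`IsH2.opK_eq`). Hence `w_t = p w_xx + N(w)`
with `N(w) = K F(K⁻¹ w) + p G K⁻¹ w`, which is Lipschitz on bounded sets from `C⁰` to `L²`. As `K`
has an explicit bounded inverse on both spaces, the two problems are equivalent.

The Dirichlet problem is solved in the sine basis, where the heat semigroup is multiplication by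
`exp (-p λₙ t)` and a mild solution is a family of scalar Duhamel formulas. Cauchy-Schwarz in time
gives `λₙ duhₙ(t)² ≤ (2p)⁻¹ ∫ fₙ²` (`lam_mul_sq_duh_le`). Summed over `n` this bounds the Duhamel
term in `H¹₀`, hence in `C⁰` (`norm_sq_le_of_sum_le`). Uniqueness then follows from Gronwall's
inequality, global existence for Lipschitz `N` from a contraction in an exponentially weighted norm,
and local existence and continuation from truncating `N`.

Since `w₀` lies in the domain of the Dirichlet Laplacian, `N(w(t))` is Hölder of order `1/2` in
time, and this makes the coefficients of `w_t` square summable with uniformly small tails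
(`IsMild.regularity_of_continuous`). So `w_xx` and `w_t` are continuous in `L²` up to `t = 0`. The
energy identity comes from `‖w_x‖² = -⟨w_xx, w⟩`: symmetry of the Laplacian allows this to be
differentiated without differentiating `w_xx`.

Boundedness near a finite time would allow continuation. That the norm has limit infinity, and is
not merely unbounded, uses that the heat semigroup is a contraction in the sup-norm: a solution
small at some time close to `tmax` stays bounded up to `tmax`. -/

/-! ### Primitives of square-integrable functions -/

instance : IsProbabilityMeasure μ01 := ⟨by simp⟩

theorem integral_μ01 (f : ℝ → ℝ) : ∫ x, f x ∂μ01 = ∫ x in (0 : ℝ)..1, f x := by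
  rw [intervalIntegral.integral_of_le zero_le_one, integral_Ioc_eq_integral_Ioo]

theorem ae_restrict_Icc_of_ae {P : ℝ → Prop} (h : ∀ᵐ x ∂μ01, P x) :
    ∀ᵐ x ∂(volume.restrict (Icc (0 : ℝ) 1)), P x := by
  rwa [← Measure.restrict_congr_set (Ioo_ae_eq_Icc (μ := volume) (a := (0 : ℝ)) (b := 1))]

theorem integrableOn_of_memLp {h : ℝ → ℝ} (hh : MemLp h 2 μ01) :
    IntegrableOn h (Icc (0 : ℝ) 1) volume := by
  rw [integrableOn_Icc_iff_integrableOn_Ioo]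
  exact hh.integrable (by norm_num)

theorem intervalIntegrable_of_memLp {h : ℝ → ℝ} (hh : MemLp h 2 μ01) {x y : ℝ}
    (hx : x ∈ Icc (0 : ℝ) 1) (hy : y ∈ Icc (0 : ℝ) 1) :
    IntervalIntegrable h volume x y := by
  rw [intervalIntegrable_iff]
  refine (integrableOn_of_memLp hh).mono_set (uIoc_subset_uIcc.trans ?_)
  exact (convex_Icc 0 1).ordConnected.uIcc_subset hx hy

theorem intervalIntegral_congr_ae_μ01 {f g : ℝ → ℝ} (h : ∀ᵐ x ∂μ01, f x = g x) {x y : ℝ}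
    (hx : x ∈ Icc (0 : ℝ) 1) (hy : y ∈ Icc (0 : ℝ) 1) :
    ∫ s in x..y, f s = ∫ s in x..y, g s := by
  refine intervalIntegral.integral_congr_ae ?_
  have h1 := ae_restrict_Icc_of_ae h
  rw [ae_restrict_iff' measurableSet_Icc] at h1
  filter_upwards [h1] with s hs hs'
  exact hs ((convex_Icc 0 1).ordConnected.uIcc_subset hx hy (uIoc_subset_uIcc hs'))

theorem zero_mem_I : (0 : ℝ) ∈ Icc (0 : ℝ) 1 := ⟨le_rfl, zero_le_one⟩

theorem one_mem_I : (1 : ℝ) ∈ Icc (0 : ℝ) 1 := ⟨zero_le_one, le_rfl⟩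

/-- On `[0,1]` the function `g` is a primitive of the square-integrable function `h`. -/
structure HasPrim (g h : ℝ → ℝ) : Prop where
  memLp : MemLp h 2 μ01
  eq : ∀ x ∈ Icc (0 : ℝ) 1, g x = g 0 + ∫ s in (0 : ℝ)..x, h s

namespace HasPrim

variable {g g₁ g₂ h h₁ h₂ : ℝ → ℝ}

theorem intervalIntegrable (H : HasPrim g h) : IntervalIntegrable h volume 0 1 :=
  intervalIntegrable_of_memLp H.memLp zero_mem_I one_mem_I

theorem continuousOn (H : HasPrim g h) : ContinuousOn g (Icc 0 1) := by
  have h1 := intervalIntegral.continuousOn_primitive_interval (μ := volume) (f := h)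
    (a := (0 : ℝ)) (b := 1) (by
      rw [uIcc_of_le zero_le_one]; exact integrableOn_of_memLp H.memLp)
  rw [uIcc_of_le zero_le_one] at h1
  exact (h1.const_add (g 0)).congr fun x hx => H.eq x hx

theorem congr (H : HasPrim g h) (hg : ∀ x ∈ Icc (0 : ℝ) 1, g₁ x = g x)
    (hh : ∀ᵐ x ∂μ01, h₁ x = h x) : HasPrim g₁ h₁ where
  memLp := H.memLp.ae_eq (hh.mono fun _ => Eq.symm)
  eq x hx := by
    rw [hg x hx, hg 0 zero_mem_I, H.eq x hx, intervalIntegral_congr_ae_μ01 hh zero_mem_I hx]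

theorem add (H₁ : HasPrim g₁ h₁) (H₂ : HasPrim g₂ h₂) :
    HasPrim (fun x => g₁ x + g₂ x) (fun x => h₁ x + h₂ x) where
  memLp := H₁.memLp.add H₂.memLp
  eq x hx := by
    rw [intervalIntegral.integral_add (intervalIntegrable_of_memLp H₁.memLp zero_mem_I hx)
      (intervalIntegrable_of_memLp H₂.memLp zero_mem_I hx), H₁.eq x hx, H₂.eq x hx]
    ring

theorem sub (H₁ : HasPrim g₁ h₁) (H₂ : HasPrim g₂ h₂) :
    HasPrim (fun x => g₁ x - g₂ x) (fun x => h₁ x - h₂ x) where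
  memLp := H₁.memLp.sub H₂.memLp
  eq x hx := by
    rw [intervalIntegral.integral_sub (intervalIntegrable_of_memLp H₁.memLp zero_mem_I hx)
      (intervalIntegrable_of_memLp H₂.memLp zero_mem_I hx), H₁.eq x hx, H₂.eq x hx]
    ring

theorem primitive (hh : MemLp h 2 μ01) (c : ℝ) :
    HasPrim (fun x => c + ∫ s in (0 : ℝ)..x, h s) h where
  memLp := hh
  eq x _ := by simp

theorem of_hasDerivWithinAt (hd : ∀ x ∈ Icc (0 : ℝ) 1, HasDerivWithinAt g (h x) (Icc 0 1) x)
    (hc : ContinuousOn h (Icc 0 1)) : HasPrim g h where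
  memLp := memLp_of_continuousOn hc
  eq x hx := by
    have hsub : Icc 0 x ⊆ Icc (0 : ℝ) 1 := Icc_subset_Icc_right hx.2
    rw [intervalIntegral.integral_eq_sub_of_hasDerivAt_of_le hx.1
      (fun y hy => ((hd y (hsub hy)).continuousWithinAt).mono hsub)
      (fun y hy => (hd y (hsub (Ioo_subset_Icc_self hy))).hasDerivAt
        (Icc_mem_nhds hy.1 (hy.2.trans_le hx.2)))
      (intervalIntegrable_of_memLp (memLp_of_continuousOn hc) zero_mem_I hx)]
    ring

theorem memLp_mul_continuousOn (hh : MemLp h 2 μ01) (hg : ContinuousOn g (Icc 0 1)) :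
    MemLp (fun x => h x * g x) 2 μ01 := by
  refine (memLp_mul hg hh.toLp).ae_eq ?_
  filter_upwards [hh.coeFn_toLp] with x hx
  rw [hx, mul_comm]

/-- This is the product rule for absolutely continuous functions. It is applied to `c + ∫₀ˣ h`
instead of `g`, because `g` is controlled only on `[0,1]`. -/
theorem mul (H₁ : HasPrim g₁ h₁) (H₂ : HasPrim g₂ h₂) :
    HasPrim (fun x => g₁ x * g₂ x) (fun x => h₁ x * g₂ x + g₁ x * h₂ x) where
  memLp := by
    refine (memLp_mul_continuousOn H₁.memLp H₂.continuousOn).add ?_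
    refine (memLp_mul_continuousOn H₂.memLp H₁.continuousOn).ae_eq (ae_of_all _ fun x => ?_)
    exact mul_comm _ _
  eq x hx := by
    have i₁ := intervalIntegrable_of_memLp H₁.memLp zero_mem_I hx
    have i₂ := intervalIntegrable_of_memLp H₂.memLp zero_mem_I hx
    have a₁ := (i₁.absolutelyContinuousOnInterval_intervalIntegral (c := 0) left_mem_uIcc)
    have a₂ := (i₂.absolutelyContinuousOnInterval_intervalIntegral (c := 0) left_mem_uIcc)
    have b : ∀ c : ℝ, AbsolutelyContinuousOnInterval (fun _ : ℝ => c) 0 x := fun c =>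
      (LipschitzWith.const c).lipschitzOnWith.absolutelyContinuousOnInterval
    have key := ((b (g₁ 0)).add a₁).integral_deriv_mul_eq_sub ((b (g₂ 0)).add a₂)
    simp only [Pi.add_apply, intervalIntegral.integral_same, add_zero] at key
    rw [← H₁.eq x hx, ← H₂.eq x hx] at key
    rw [eq_sub_iff_add_eq'.1 key.symm.symm |>.symm]
    congr 1
    refine intervalIntegral.integral_congr_ae ?_
    filter_upwards [i₁.ae_hasDerivAt_integral, i₂.ae_hasDerivAt_integral] with s h1 h2 hs
    have hs' := uIoc_subset_uIcc hs
    have hsI : s ∈ Icc (0 : ℝ) 1 :=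
      (convex_Icc 0 1).ordConnected.uIcc_subset zero_mem_I hx hs'
    have e1 := ((h1 hs' 0 left_mem_uIcc).const_add (g₁ 0)).deriv
    have e2 := ((h2 hs' 0 left_mem_uIcc).const_add (g₂ 0)).deriv
    have e1' : deriv ((fun _ => g₁ 0) + fun x => ∫ s in (0 : ℝ)..x, h₁ s) s = h₁ s := e1
    have e2' : deriv ((fun _ => g₂ 0) + fun x => ∫ s in (0 : ℝ)..x, h₂ s) s = h₂ s := e2
    rw [e1', e2', ← H₁.eq s hsI, ← H₂.eq s hsI]

/-- Integration by parts on `(0,1)`. -/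
theorem integral_mul (H₁ : HasPrim g₁ h₁) (H₂ : HasPrim g₂ h₂) :
    ∫ x, g₁ x * h₂ x ∂μ01 = g₁ 1 * g₂ 1 - g₁ 0 * g₂ 0 - ∫ x, h₁ x * g₂ x ∂μ01 := by
  have h := (H₁.mul H₂).eq 1 one_mem_I
  have i1 : Integrable (fun x => h₁ x * g₂ x) μ01 :=
    (memLp_mul_continuousOn H₁.memLp H₂.continuousOn).integrable (by norm_num)
  have i2 : Integrable (fun x => g₁ x * h₂ x) μ01 := by
    simpa only [mul_comm] using
      (memLp_mul_continuousOn H₂.memLp H₁.continuousOn).integrable (by norm_num)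
  rw [← integral_μ01, integral_add i1 i2] at h
  linarith

end HasPrim

/-! ### Weak derivatives and the du Bois-Reymond lemma -/

theorem hasDerivAt_hasPrim {φ φ' : ℝ → ℝ} (h : ∀ x, HasDerivAt φ (φ' x) x) (hc : Continuous φ') :
    HasPrim φ φ' :=
  HasPrim.of_hasDerivWithinAt (fun x _ => (h x).hasDerivWithinAt) hc.continuousOn

theorem contDiff_hasPrim {φ : ℝ → ℝ} (hφ : ContDiff ℝ ((⊤ : ℕ∞) : WithTop ℕ∞) φ) :
    HasPrim φ (deriv φ) :=
  hasDerivAt_hasPrim (fun x => (hφ.differentiable (by simp)).differentiableAt.hasDerivAt)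
    (hφ.continuous_deriv (by simp))

theorem eq_zero_of_tsupport_subset {φ : ℝ → ℝ} (hs : tsupport φ ⊆ Ioo (0 : ℝ) 1) {x : ℝ}
    (hx : x ∉ Ioo (0 : ℝ) 1) : φ x = 0 :=
  image_eq_zero_of_notMem_tsupport fun h' => hx (hs h')

theorem HasPrim.hasWeakDeriv {g h : ℝ → ℝ} (H : HasPrim g h) {f f' : L2}
    (hf : ∀ᵐ x ∂μ01, f x = g x) (hf' : ∀ᵐ x ∂μ01, f' x = h x) : HasWeakDeriv 1 f f' := by
  intro φ hφ _ hs
  have e1 : ∫ x, f x * iteratedDeriv 1 φ x ∂μ01 = ∫ x, g x * deriv φ x ∂μ01 := by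
    refine integral_congr_ae ?_
    filter_upwards [hf] with x hx
    rw [hx, iteratedDeriv_one]
  have e2 : ∫ x, f' x * φ x ∂μ01 = ∫ x, h x * φ x ∂μ01 := by
    refine integral_congr_ae ?_
    filter_upwards [hf'] with x hx
    rw [hx]
  rw [e1, e2, H.integral_mul (contDiff_hasPrim hφ),
    eq_zero_of_tsupport_subset hs (x := 0) (by simp),
    eq_zero_of_tsupport_subset hs (x := 1) (by simp)]
  ring

theorem integrable_mul_L2 {φ : ℝ → ℝ} (hφ : Continuous φ) (e : L2) :
    Integrable (fun x => e x * φ x) μ01 :=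
  (HasPrim.memLp_mul_continuousOn (Lp.memLp e) hφ.continuousOn).integrable (by norm_num)

/-- Such an `e` is a weak derivative of order zero of `0`, and weak derivatives are unique. -/
theorem ae_eq_zero_of_forall_testFunction (e : L2)
    (h : ∀ φ : ℝ → ℝ, ContDiff ℝ ((⊤ : ℕ∞) : WithTop ℕ∞) φ → HasCompactSupport φ →
      tsupport φ ⊆ Ioo (0 : ℝ) 1 → ∫ x, e x * φ x ∂μ01 = 0) : e = 0 := by
  refine HasWeakDeriv.unique (n := 0) (f := 0) (g := e) (h := 0) ?_ ?_
  · intro φ hφ hc hs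
    have e0 : ∫ x, (0 : L2) x * iteratedDeriv 0 φ x ∂μ01 = ∫ x, (0 : ℝ) ∂μ01 := by
      refine integral_congr_ae ?_
      filter_upwards [Lp.coeFn_zero ℝ 2 μ01] with x hx
      rw [hx]; simp
    rw [e0, h φ hφ hc hs]; simp
  · intro φ hφ hc hs
    simp

/-- A test function with mean zero is the derivative of a test function. -/
theorem exists_testFunction_primitive {η : ℝ → ℝ} (hη : ContDiff ℝ ((⊤ : ℕ∞) : WithTop ℕ∞) η)
    (hc : HasCompactSupport η) (hs : tsupport η ⊆ Ioo (0 : ℝ) 1)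
    (h0 : ∫ x in (0 : ℝ)..1, η x = 0) :
    ∃ θ : ℝ → ℝ, ContDiff ℝ ((⊤ : ℕ∞) : WithTop ℕ∞) θ ∧ HasCompactSupport θ ∧
      tsupport θ ⊆ Ioo (0 : ℝ) 1 ∧ deriv θ = η := by
  obtain ⟨a, b, ha, hb, hab⟩ : ∃ a b : ℝ, 0 < a ∧ b < 1 ∧ tsupport η ⊆ Icc a b := by
    rcases (tsupport η).eq_empty_or_nonempty with h | h
    · exact ⟨1 / 2, 1 / 2, by norm_num, by norm_num, by simp [h]⟩
    · have hcc : IsCompact (tsupport η) := hc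
      exact ⟨_, _, (hs (hcc.sInf_mem h)).1, (hs (hcc.sSup_mem h)).2,
        fun x hx => ⟨csInf_le hcc.bddBelow hx, le_csSup hcc.bddAbove hx⟩⟩
  have hz : ∀ x, x ∉ Icc a b → η x = 0 := fun x hx =>
    image_eq_zero_of_notMem_tsupport fun h' => hx (hab h')
  have hd : ∀ x, HasDerivAt (fun y => ∫ s in (0 : ℝ)..y, η s) (η x) x := fun x =>
    intervalIntegral.integral_hasDerivAt_right (hη.continuous.intervalIntegrable _ _)
      (hη.continuous.stronglyMeasurableAtFilter _ _) hη.continuous.continuousAt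
  have hderiv : deriv (fun y => ∫ s in (0 : ℝ)..y, η s) = η := funext fun x => (hd x).deriv
  -- To the left of `a` the integrand vanishes; to the right of `b` the primitive equals the full
  -- mean, which is zero.
  have hsup : Function.support (fun y => ∫ s in (0 : ℝ)..y, η s) ⊆ Icc a b := by
    intro x hx
    by_contra hx'
    refine hx ?_
    rcases lt_or_ge x a with h | h
    · refine intervalIntegral.integral_zero_ae (ae_of_all _ fun s hs => hz s fun h' => ?_)
      have := (uIoc_subset_uIcc hs).2
      exact absurd (h'.1.trans this) (not_le.2 (max_lt ha h))
    · have hbx : b < x := not_le.1 fun h2 => hx' ⟨h, h2⟩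
      change ∫ s in (0 : ℝ)..x, η s = 0
      rw [← intervalIntegral.integral_add_adjacent_intervals
        (hη.continuous.intervalIntegrable 0 1) (hη.continuous.intervalIntegrable 1 x), h0, zero_add]
      refine intervalIntegral.integral_zero_ae (ae_of_all _ fun s hs => hz s fun h' => ?_)
      have := (uIoc_subset_uIcc hs).1
      exact absurd (this.trans h'.2) (not_le.2 (lt_min hb hbx))
  have hts : tsupport (fun y => ∫ s in (0 : ℝ)..y, η s) ⊆ Icc a b :=
    closure_minimal hsup isClosed_Icc
  refine ⟨_, ?_, HasCompactSupport.of_support_subset_isCompact isCompact_Icc hsup,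
    hts.trans (Icc_subset_Ioo ha hb), hderiv⟩
  rw [contDiff_infty_iff_deriv, hderiv]
  exact ⟨fun x => (hd x).differentiableAt, hη⟩

/-- Du Bois-Reymond: a function with zero weak derivative is constant. -/
theorem HasWeakDeriv.ae_const {e : L2} (h : HasWeakDeriv 1 e 0) :
    ∃ c : ℝ, ∀ᵐ x ∂μ01, e x = c := by
  -- `ψ` is a test function of integral one supported in `[1/4, 3/4]`; the constant will be `∫ e ψ`.
  let B : ContDiffBump (1 / 2 : ℝ) := ⟨1 / 8, 1 / 4, by norm_num, by norm_num⟩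
  set ψ : ℝ → ℝ := B.normed volume with hψ
  have hψd : ContDiff ℝ ((⊤ : ℕ∞) : WithTop ℕ∞) ψ := B.contDiff_normed
  have hψc : HasCompactSupport ψ := B.hasCompactSupport_normed
  have hψs : tsupport ψ ⊆ Ioo (0 : ℝ) 1 := by
    rw [hψ, B.tsupport_normed_eq, Real.closedBall_eq_Icc]
    exact Icc_subset_Ioo (by norm_num [B]) (by norm_num [B])
  have hψ1 : ∫ x in (0 : ℝ)..1, ψ x = 1 := by
    rw [← integral_μ01, ← B.integral_normed (μ := volume)]
    exact setIntegral_eq_integral_of_forall_compl_eq_zero fun x hx =>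
      eq_zero_of_tsupport_subset hψs hx
  set c : ℝ := ∫ x, e x * ψ x ∂μ01 with hcdef
  have hconst : MemLp (fun _ : ℝ => c) 2 μ01 := memLp_const c
  have key : e - hconst.toLp = 0 := by
    refine ae_eq_zero_of_forall_testFunction _ fun φ hφ hφc hφs => ?_
    set m : ℝ := ∫ x in (0 : ℝ)..1, φ x with hm
    -- Subtracting `m ψ` makes the mean of `φ` zero, so `φ - m ψ` is the derivative of a test
    -- function and is orthogonal to `e`.
    obtain ⟨θ, hθ, hθc, hθs, hθd⟩ := exists_testFunction_primitive
      (η := fun x => φ x - m * ψ x) (hφ.sub (contDiff_const.mul hψd))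
      (hφc.sub (hψc.mul_left (f := fun _ => m)))
      ((tsupport_sub _ _).trans (union_subset hφs
        ((closure_mono (Function.support_mul_subset_right (fun _ => m) ψ)).trans hψs)))
      (by
        rw [intervalIntegral.integral_sub (hφ.continuous.intervalIntegrable _ _)
          ((hψd.continuous.const_mul m).intervalIntegrable _ _),
          intervalIntegral.integral_const_mul, hψ1, ← hm]
        ring)
    have h1 := h θ hθ hθc hθs
    rw [iteratedDeriv_one, hθd] at h1
    have h2 : ∫ x, (0 : L2) x * θ x ∂μ01 = ∫ x, (0 : ℝ) ∂μ01 := by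
      refine integral_congr_ae ?_
      filter_upwards [Lp.coeFn_zero ℝ 2 μ01] with x hx
      rw [hx]; simp
    rw [h2, integral_zero, mul_zero] at h1
    have h3 : ∫ x, e x * (φ x - m * ψ x) ∂μ01 = (∫ x, e x * φ x ∂μ01) - m * c := by
      rw [hcdef, ← integral_const_mul, ← integral_sub (integrable_mul_L2 hφ.continuous e)
        ((integrable_mul_L2 hψd.continuous e).const_mul m)]
      exact integral_congr_ae (ae_of_all _ fun x => by ring)
    have h4 : ∫ x, (e - hconst.toLp) x * φ x ∂μ01 = (∫ x, e x * φ x ∂μ01) - m * c := by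
      have : c * m = ∫ x, c * φ x ∂μ01 := by rw [integral_const_mul, hm, integral_μ01]
      rw [mul_comm m, this, ← integral_sub (integrable_mul_L2 hφ.continuous e)]
      · refine integral_congr_ae ?_
        filter_upwards [Lp.coeFn_sub e hconst.toLp, hconst.coeFn_toLp] with x h5 h6
        rw [h5, Pi.sub_apply, h6]; ring
      · exact ((memLp_of_continuousOn hφ.continuous.continuousOn).integrable
          (by norm_num)).const_mul c
    rw [h4, ← h3, h1]
  refine ⟨c, ?_⟩
  rw [sub_eq_zero.1 key]
  exact hconst.coeFn_toLp

theorem HasWeakDeriv.sub {n : ℕ} {f f' g g' : L2} (hf : HasWeakDeriv n f f')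
    (hg : HasWeakDeriv n g g') : HasWeakDeriv n (f - g) (f' - g') := by
  intro φ hφ hc hs
  have e : ∀ (a b : L2) (χ : ℝ → ℝ), Continuous χ → ∫ x, (a - b) x * χ x ∂μ01 =
      (∫ x, a x * χ x ∂μ01) - ∫ x, b x * χ x ∂μ01 := by
    intro a b χ hχ
    rw [← integral_sub (integrable_mul_L2 hχ a) (integrable_mul_L2 hχ b)]
    refine integral_congr_ae ?_
    filter_upwards [Lp.coeFn_sub a b] with x hx
    rw [hx, Pi.sub_apply]; ring
  rw [e _ _ _ (hφ.continuous_iteratedDeriv n (by exact_mod_cast le_top)), e _ _ _ hφ.continuous,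
    hf φ hφ hc hs, hg φ hφ hc hs]
  ring

/-- The difference of `f` and the primitive of `g` has zero weak derivative, hence is constant. -/
theorem HasWeakDeriv.exists_hasPrim {f g : L2} (h : HasWeakDeriv 1 f g) :
    ∃ G : ℝ → ℝ, HasPrim G g ∧ ∀ᵐ x ∂μ01, f x = G x := by
  have h1 : HasWeakDeriv 1 (intOp g) g :=
    (HasPrim.primitive (Lp.memLp g) 0).hasWeakDeriv
      ((intOp_ae g).mono fun x hx => by rw [hx, zero_add]) (ae_of_all _ fun _ => rfl)
  have h2 := h.sub h1
  rw [sub_self] at h2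
  obtain ⟨c, hc⟩ := h2.ae_const
  refine ⟨_, HasPrim.primitive (Lp.memLp g) c, ?_⟩
  filter_upwards [hc, Lp.coeFn_sub f (intOp g), intOp_ae g] with x h3 h4 h5
  rw [h3, Pi.sub_apply, h5] at h4
  linarith

/-! ### Continuous representatives and functions of class `H²` -/

theorem toL2_ae (u : C01) : ∀ᵐ x ∂μ01, toL2 u x = toFun u x :=
  (memLp_of_continuousOn (continuous_toFun u).continuousOn).coeFn_toLp

/-- Functions continuous on `[0,1]` that agree almost everywhere agree on `[0,1]`. -/
theorem eqOn_of_ae_eq {f g : ℝ → ℝ} (hf : ContinuousOn f (Icc 0 1)) (hg : ContinuousOn g (Icc 0 1))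
    (h : ∀ᵐ x ∂μ01, f x = g x) : EqOn f g (Icc 0 1) := by
  refine Measure.eqOn_Icc_of_ae_eq (μ := volume) zero_ne_one ?_ hf hg
  exact ae_restrict_Icc_of_ae h

theorem toFun_coe (u : C01) (x : Icc (0 : ℝ) 1) : toFun u x = u x := IccExtend_val _ _ _

theorem toFun_of_mem (u : C01) {x : ℝ} (hx : x ∈ Icc (0 : ℝ) 1) : toFun u x = u ⟨x, hx⟩ :=
  IccExtend_of_mem _ _ hx

theorem ext_toFun {u v : C01} (h : ∀ x ∈ Icc (0 : ℝ) 1, toFun u x = toFun v x) : u = v := by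
  ext x
  rw [← toFun_coe, ← toFun_coe]
  exact h x x.2

/-- Used to reduce identities in `C⁰([0,1])` to identities in `L²`, and from there to sine
coefficients. -/
theorem toL2_injective : Function.Injective toL2 := by
  intro u v h
  refine ext_toFun (eqOn_of_ae_eq (continuous_toFun u).continuousOn
    (continuous_toFun v).continuousOn ?_)
  have h2 := toL2_ae v
  rw [← h] at h2
  filter_upwards [toL2_ae u, h2] with x h3 h4
  rw [← h3, h4]

/-- `u` has the continuous derivative `u₁`, which is the primitive of `u₂ ∈ L²(0,1)`. -/
structure IsH2 (u : C01) (u₁ : ℝ → ℝ) (u₂ : L2) : Prop where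
  fst : HasPrim (toFun u) u₁
  snd : HasPrim u₁ u₂

theorem HasWeakDeriv.succ {f g h : L2} (hfg : HasWeakDeriv 1 f g) (hgh : HasWeakDeriv 1 g h) :
    HasWeakDeriv 2 f h := by
  intro φ hφ hc hs
  have hd : ContDiff ℝ ((⊤ : ℕ∞) : WithTop ℕ∞) (deriv φ) := (contDiff_infty_iff_deriv.1 hφ).2
  have h1 := hfg (deriv φ) hd hc.deriv (tsupport_deriv_subset.trans hs)
  have h2 := hgh φ hφ hc hs
  rw [iteratedDeriv_one] at h1 h2
  rw [iteratedDeriv_succ', iteratedDeriv_one, h1, h2]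
  ring

namespace IsH2

variable {u : C01} {u₁ : ℝ → ℝ} {u₂ : L2}

theorem memLp (h : IsH2 u u₁ u₂) : MemLp u₁ 2 μ01 := h.fst.memLp

theorem hasWeakDeriv_one (h : IsH2 u u₁ u₂) : HasWeakDeriv 1 (toL2 u) h.memLp.toLp :=
  h.fst.hasWeakDeriv (toL2_ae u) h.memLp.coeFn_toLp

theorem hasWeakDeriv_two (h : IsH2 u u₁ u₂) : HasWeakDeriv 2 (toL2 u) u₂ :=
  h.hasWeakDeriv_one.succ (h.snd.hasWeakDeriv h.memLp.coeFn_toLp (ae_of_all _ fun _ => rfl))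

theorem weakDeriv_one (h : IsH2 u u₁ u₂) : weakDeriv 1 (toL2 u) = h.memLp.toLp :=
  h.hasWeakDeriv_one.weakDeriv_eq

theorem weakDeriv_one_ae (h : IsH2 u u₁ u₂) : ∀ᵐ x ∂μ01, weakDeriv 1 (toL2 u) x = u₁ x := by
  rw [h.weakDeriv_one]
  exact h.memLp.coeFn_toLp

theorem weakDeriv_two (h : IsH2 u u₁ u₂) : weakDeriv 2 (toL2 u) = u₂ :=
  h.hasWeakDeriv_two.weakDeriv_eq

theorem memH (h : IsH2 u u₁ u₂) : MemH 2 (toL2 u) := by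
  intro n hn
  interval_cases n
  · exact ⟨toL2 u, fun φ _ _ _ => by simp⟩
  · exact ⟨_, h.hasWeakDeriv_one⟩
  · exact ⟨_, h.hasWeakDeriv_two⟩

end IsH2

/-- `MemH` provides both derivatives relative to `u`. Testing the first one against `φ'` shows that
`g₂` is the weak derivative of `g₁`; taking primitives twice then gives the continuous
representatives. -/
theorem MemH.exists_isH2 {u : C01} (h : MemH 2 (toL2 u)) :
    ∃ (u₁ : ℝ → ℝ) (u₂ : L2), IsH2 u u₁ u₂ := by
  obtain ⟨g₁, h₁⟩ := h 1 one_le_two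
  obtain ⟨g₂, h₂⟩ := h 2 le_rfl
  have h₁₂ : HasWeakDeriv 1 g₁ g₂ := by
    intro φ hφ hc hs
    have hd : ContDiff ℝ ((⊤ : ℕ∞) : WithTop ℕ∞) (deriv φ) := (contDiff_infty_iff_deriv.1 hφ).2
    have e1 := h₁ (deriv φ) hd hc.deriv (tsupport_deriv_subset.trans hs)
    have e2 := h₂ φ hφ hc hs
    rw [iteratedDeriv_succ', e1] at e2
    rw [iteratedDeriv_one]
    linarith
  obtain ⟨G, hG, hGu⟩ := h₁.exists_hasPrim
  obtain ⟨u₁, hu₁, hg₁⟩ := h₁₂.exists_hasPrim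
  have hGu' := eqOn_of_ae_eq (continuous_toFun u).continuousOn hG.continuousOn (by
    filter_upwards [hGu, toL2_ae u] with x h3 h4
    rw [← h3, h4])
  exact ⟨u₁, g₂, hG.congr hGu' (hg₁.mono fun _ => Eq.symm), hu₁⟩

theorem inner_L2_eq (f g : L2) {a b : ℝ → ℝ} (hf : ∀ᵐ x ∂μ01, f x = a x)
    (hg : ∀ᵐ x ∂μ01, g x = b x) : inner ℝ f g = ∫ x, a x * b x ∂μ01 := by
  rw [L2.inner_def]
  refine integral_congr_ae ?_
  filter_upwards [hf, hg] with x h1 h2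
  rw [h1, h2, real_inner_comm]
  rfl

/-- The restriction to `[0,1]` of a function continuous there. -/
def toC (g : ℝ → ℝ) (hg : ContinuousOn g (Icc 0 1)) : C01 := ⟨(Icc 0 1).domRestrict g, hg.domRestrict⟩

theorem toFun_toC {g : ℝ → ℝ} (hg : ContinuousOn g (Icc 0 1)) {x : ℝ} (hx : x ∈ Icc (0 : ℝ) 1) :
    toFun (toC g hg) x = g x := by
  rw [toFun_of_mem _ hx]; rfl

theorem ae_of_forall_mem_I {P : ℝ → Prop} (h : ∀ x ∈ Icc (0 : ℝ) 1, P x) : ∀ᵐ x ∂μ01, P x := by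
  filter_upwards [ae_restrict_mem measurableSet_Ioo] with x hx
  exact h x (Ioo_subset_Icc_self hx)

theorem toL2_toC_ae {g : ℝ → ℝ} (hg : ContinuousOn g (Icc 0 1)) :
    ∀ᵐ x ∂μ01, toL2 (toC g hg) x = g x := by
  filter_upwards [toL2_ae (toC g hg), ae_of_forall_mem_I fun x hx => toFun_toC hg hx] with x h1 h2
  rw [h1, h2]

theorem abs_toFun_le (u : C01) (x : ℝ) : |toFun u x| ≤ ‖u‖ :=
  u.norm_coe_le_norm _

/-- The embedding of `C⁰([0,1])` in `L²(0,1)`. -/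
def toL2CLM : C01 →L[ℝ] L2 :=
  LinearMap.mkContinuous
    { toFun := toL2
      map_add' := fun u v => by
        rw [toL2, toL2, toL2, ← MemLp.toLp_add]
        rfl
      map_smul' := fun c u => by
        rw [RingHom.id_apply, toL2, toL2, ← MemLp.toLp_const_smul]
        rfl }
    1 (fun u => by
      have h1 : measureUnivNNReal μ01 = 1 := by
        rw [← ENNReal.coe_inj, coe_measureUnivNNReal]
        simp
      have h := Lp.norm_le_of_ae_bound (p := 2) (f := toL2 u) (norm_nonneg u)
        ((toL2_ae u).mono fun x hx => by rw [hx]; exact abs_toFun_le u x)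
      rw [h1] at h
      simpa using h)

theorem toL2CLM_apply (u : C01) : toL2CLM u = toL2 u := rfl

theorem norm_toL2_le (u : C01) : ‖toL2 u‖ ≤ ‖u‖ := by
  have h := toL2CLM.le_of_opNorm_le (LinearMap.mkContinuous_norm_le _ zero_le_one _) u
  rwa [one_mul] at h

theorem toL2_sub (u v : C01) : toL2 (u - v) = toL2 u - toL2 v := toL2CLM.map_sub u v

theorem toL2_add (u v : C01) : toL2 (u + v) = toL2 u + toL2 v := toL2CLM.map_add u v

theorem continuous_toL2 : Continuous toL2 := toL2CLM.continuous

/-! ### Eigenfunctions of the Dirichlet Laplacian -/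

/-- The frequencies `(n + 1) π` of the Dirichlet problem on `(0,1)`. -/
def freq (n : ℕ) : ℝ := (n + 1) * Real.pi

/-- The eigenvalues `((n + 1) π)²` of the Dirichlet problem on `(0,1)`. -/
def lam (n : ℕ) : ℝ := freq n ^ 2

theorem freq_pos (n : ℕ) : 0 < freq n := by unfold freq; positivity

theorem lam_pos (n : ℕ) : 0 < lam n := pow_pos (freq_pos n) 2

theorem freq_mono : Monotone freq := fun m n h => by
  unfold freq
  have : (m : ℝ) ≤ n := by exact_mod_cast h
  gcongr

theorem lam_mono : Monotone lam := fun _ _ h =>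
  pow_le_pow_left₀ (freq_pos _).le (freq_mono h) 2

theorem sin_freq (n : ℕ) : Real.sin (freq n) = 0 := by
  have := Real.sin_nat_mul_pi (n + 1)
  push_cast at this
  exact this

/-- The normalized eigenfunction `√2 sin ((n + 1) π x)`. -/
def sinFun (n : ℕ) (x : ℝ) : ℝ := √2 * Real.sin (freq n * x)

/-- The derivative of `sinFun n`. -/
def cosFun (n : ℕ) (x : ℝ) : ℝ := √2 * (freq n * Real.cos (freq n * x))

theorem continuous_sinFun (n : ℕ) : Continuous (sinFun n) := by unfold sinFun; fun_prop

theorem continuous_cosFun (n : ℕ) : Continuous (cosFun n) := by unfold cosFun; fun_prop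

theorem hasDerivAt_sinFun (n : ℕ) (x : ℝ) : HasDerivAt (sinFun n) (cosFun n x) x := by
  have h := (((hasDerivAt_id x).const_mul (freq n)).sin).const_mul √2
  refine h.congr_deriv ?_
  rw [cosFun, id, mul_one]
  ring

theorem hasDerivAt_cosFun (n : ℕ) (x : ℝ) : HasDerivAt (cosFun n) (-lam n * sinFun n x) x := by
  have h := ((((hasDerivAt_id x).const_mul (freq n)).cos).const_mul (freq n)).const_mul √2
  refine h.congr_deriv ?_
  rw [sinFun, id, mul_one, lam]
  ring

theorem sinFun_zero (n : ℕ) : sinFun n 0 = 0 := by simp [sinFun]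

theorem sinFun_one (n : ℕ) : sinFun n 1 = 0 := by simp [sinFun, sin_freq]

theorem abs_sinFun_le (n : ℕ) (x : ℝ) : |sinFun n x| ≤ √2 := by
  rw [sinFun, abs_mul, abs_of_nonneg (Real.sqrt_nonneg 2)]
  exact mul_le_of_le_one_right (Real.sqrt_nonneg 2) (Real.abs_sin_le_one _)

/-- The eigenfunction `√2 sin ((n + 1) π x)` in `C⁰([0,1])`. -/
def sinC (n : ℕ) : C01 := toC (sinFun n) (continuous_sinFun n).continuousOn

/-- The eigenfunction `√2 sin ((n + 1) π x)` in `L²(0,1)`. -/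
def sinL (n : ℕ) : L2 := toL2 (sinC n)

theorem toFun_sinC (n : ℕ) {x : ℝ} (hx : x ∈ Icc (0 : ℝ) 1) : toFun (sinC n) x = sinFun n x :=
  toFun_toC _ hx

theorem sinL_ae (n : ℕ) : ∀ᵐ x ∂μ01, sinL n x = sinFun n x := toL2_toC_ae _

theorem norm_sinC_le (n : ℕ) : ‖sinC n‖ ≤ √2 :=
  (ContinuousMap.norm_le _ (Real.sqrt_nonneg 2)).2 fun x => abs_sinFun_le n x

theorem hasPrim_sinC (n : ℕ) : HasPrim (toFun (sinC n)) (cosFun n) :=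
  (hasDerivAt_hasPrim (hasDerivAt_sinFun n) (continuous_cosFun n)).congr
    (fun _ hx => toFun_sinC n hx) (ae_of_all _ fun _ => rfl)

theorem isH2_sinC (n : ℕ) : IsH2 (sinC n) (cosFun n) (-lam n • sinL n) where
  fst := hasPrim_sinC n
  snd := by
    refine (hasDerivAt_hasPrim (hasDerivAt_cosFun n)
      ((continuous_sinFun n).const_mul _)).congr (fun _ _ => rfl) ?_
    filter_upwards [Lp.coeFn_smul (-lam n) (sinL n), sinL_ae n] with x h1 h2
    rw [h1, Pi.smul_apply, h2, smul_eq_mul]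

/-- Green's formula. -/
theorem IsH2.inner_eq {u v : C01} {u₁ v₁ : ℝ → ℝ} {u₂ : L2} (hu : IsH2 u u₁ u₂)
    (hv : HasPrim (toFun v) v₁) (h0 : toFun v 0 = 0) (h1 : toFun v 1 = 0) :
    inner ℝ u₂ (toL2 v) = -∫ x, u₁ x * v₁ x ∂μ01 := by
  rw [real_inner_comm, inner_L2_eq _ _ (toL2_ae v) (ae_of_all _ fun _ => rfl),
    hv.integral_mul hu.snd, h0, h1]
  simp [mul_comm]

theorem IsH2.inner_symm {u v : C01} {u₁ v₁ : ℝ → ℝ} {u₂ v₂ : L2} (hu : IsH2 u u₁ u₂)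
    (hv : IsH2 v v₁ v₂) (hu0 : toFun u 0 = 0) (hu1 : toFun u 1 = 0)
    (hv0 : toFun v 0 = 0) (hv1 : toFun v 1 = 0) :
    inner ℝ u₂ (toL2 v) = inner ℝ (toL2 u) v₂ := by
  rw [hu.inner_eq hv.fst hv0 hv1, real_inner_comm, hv.inner_eq hu.fst hu0 hu1]
  simp [mul_comm]

theorem toFun_sinC_zero (n : ℕ) : toFun (sinC n) 0 = 0 := by
  rw [toFun_sinC n zero_mem_I, sinFun_zero]

theorem toFun_sinC_one (n : ℕ) : toFun (sinC n) 1 = 0 := by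
  rw [toFun_sinC n one_mem_I, sinFun_one]

theorem orthonormal_sinL : Orthonormal ℝ sinL := by
  refine ⟨fun n => ?_, fun m n hmn => ?_⟩
  · have h1 := (isH2_sinC n).inner_eq (hasPrim_sinC n) (toFun_sinC_zero n) (toFun_sinC_one n)
    have h2 : inner ℝ (sinL n) (sinL n) = ∫ x, sinFun n x * sinFun n x ∂μ01 :=
      inner_L2_eq _ _ (sinL_ae n) (sinL_ae n)
    rw [inner_smul_left] at h1
    have hi : ∀ f : ℝ → ℝ, Continuous f → Integrable f μ01 := fun f hf =>
      (memLp_of_continuousOn hf.continuousOn).integrable (by norm_num)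
    -- The norm is found without computing an integral: pointwise `λ s² + c² = 2 λ`, and by Green's
    -- formula `∫ c² = λ ∫ s²`.
    have h3 : lam n * (∫ x, sinFun n x * sinFun n x ∂μ01) + ∫ x, cosFun n x * cosFun n x ∂μ01
        = 2 * lam n := by
      have i1 : Integrable (fun x => lam n * (sinFun n x * sinFun n x)) μ01 :=
        hi _ (((continuous_sinFun n).mul (continuous_sinFun n)).const_mul _)
      have i2 : Integrable (fun x => cosFun n x * cosFun n x) μ01 :=
        hi _ ((continuous_cosFun n).mul (continuous_cosFun n))
      rw [← integral_const_mul, ← integral_add i1 i2]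
      have : ∀ x, lam n * (sinFun n x * sinFun n x) + cosFun n x * cosFun n x = 2 * lam n := by
        intro x
        have e1 := Real.sin_sq_add_cos_sq (freq n * x)
        have e2 := Real.mul_self_sqrt (zero_le_two (α := ℝ))
        simp only [sinFun, cosFun, lam]
        linear_combination (2 * freq n ^ 2) * e1 + (freq n ^ 2 *
          (Real.sin (freq n * x) ^ 2 + Real.cos (freq n * x) ^ 2)) * e2
      simp [this]
    have h4 : inner ℝ (sinL n) (sinL n) = 1 := by
      have h5 : lam n * inner ℝ (sinL n) (sinL n) = lam n * 1 := by
        change (starRingEnd ℝ) (-lam n) * inner ℝ (sinL n) (sinL n) = _ at h1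
        rw [conj_trivial] at h1
        rw [← h2] at h3
        linarith
      exact mul_left_cancel₀ (lam_pos n).ne' h5
    rw [real_inner_self_eq_norm_sq] at h4
    exact (pow_eq_one_iff_of_nonneg (norm_nonneg _) two_ne_zero).1 h4
  -- Eigenfunctions of a symmetric operator with distinct eigenvalues are orthogonal.
  · have h := (isH2_sinC m).inner_symm (isH2_sinC n) (toFun_sinC_zero m) (toFun_sinC_one m)
      (toFun_sinC_zero n) (toFun_sinC_one n)
    rw [inner_smul_left, inner_smul_right, conj_trivial] at h
    change -lam m * inner ℝ (sinL m) (sinL n) = -lam n * inner ℝ (sinL m) (sinL n) at h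
    have h2 : (lam m - lam n) * inner ℝ (sinL m) (sinL n) = 0 := by linarith
    refine (mul_eq_zero.1 h2).resolve_left fun h3 => hmn ?_
    have h4 : freq m = freq n :=
      (pow_left_inj₀ (freq_pos m).le (freq_pos n).le two_ne_zero).1 (sub_eq_zero.1 h3)
    have h5 := mul_right_cancel₀ Real.pi_pos.ne' h4
    exact_mod_cast add_right_cancel h5

/-! ### Completeness of the sine system -/

theorem memLp_L2_mul (f : L2) {g : ℝ → ℝ} (hg : Continuous g) : MemLp (fun x => f x * g x) 2 μ01 :=
  HasPrim.memLp_mul_continuousOn (Lp.memLp f) hg.continuousOn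

/-- Each factor `cos θ` is absorbed by `2 sin (n θ) cos θ = sin ((n+1) θ) + sin ((n-1) θ)`; for `n =
0` the integrand vanishes. -/
theorem integral_mul_sin_mul_cos_pow {f : L2} (hf : ∀ n, inner ℝ (sinL n) f = 0) (j n : ℕ) :
    ∫ x, f x * (Real.sin (n * (Real.pi * x)) * Real.cos (Real.pi * x) ^ j) ∂μ01 = 0 := by
  induction j generalizing n with
  | zero =>
    rcases n with _ | n
    · simp
    have h := hf n
    rw [inner_L2_eq _ _ (sinL_ae n) (ae_of_all _ fun _ => rfl)] at h
    have e : ∀ x, f x * (Real.sin ((n + 1 : ℕ) * (Real.pi * x)) * Real.cos (Real.pi * x) ^ 0) =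
        (√2)⁻¹ * (sinFun n x * f x) := by
      intro x
      have : √2 ≠ 0 := by positivity
      simp only [sinFun, freq]
      push_cast
      field_simp
    simp_rw [e]
    rw [integral_const_mul, h, mul_zero]
  | succ j ih =>
    rcases n with _ | n
    · simp
    have e : ∀ x, f x * (Real.sin ((n + 1 : ℕ) * (Real.pi * x)) * Real.cos (Real.pi * x) ^ (j + 1))
        = 2⁻¹ * (f x * (Real.sin ((n + 2 : ℕ) * (Real.pi * x)) * Real.cos (Real.pi * x) ^ j)) +
          2⁻¹ * (f x * (Real.sin (n * (Real.pi * x)) * Real.cos (Real.pi * x) ^ j)) := by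
      intro x
      have h1 : ((n + 2 : ℕ) : ℝ) * (Real.pi * x) =
          (n + 1 : ℕ) * (Real.pi * x) + Real.pi * x := by push_cast; ring
      have h2 : (n : ℝ) * (Real.pi * x) =
          (n + 1 : ℕ) * (Real.pi * x) - Real.pi * x := by push_cast; ring
      rw [h1, h2, Real.sin_add, Real.sin_sub]
      ring
    simp_rw [e]
    have hi : ∀ m : ℕ, Integrable (fun x => (2⁻¹ : ℝ) * (f x *
        (Real.sin (m * (Real.pi * x)) * Real.cos (Real.pi * x) ^ j))) μ01 := fun m =>
      ((memLp_L2_mul f (by fun_prop)).integrable (by norm_num)).const_mul _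
    rw [integral_add (hi _) (hi _), integral_const_mul, integral_const_mul, ih, ih]
    simp

/-- The function `x ↦ cos (π x)` on `[0,1]`. -/
def cosC : C01 := toC (fun x => Real.cos (Real.pi * x)) (by fun_prop)

/-- By Stone-Weierstrass: `cos (π x)` alone separates points, being injective on `[0,1]`. -/
theorem dense_adjoin_cosC : (Algebra.adjoin ℝ {cosC}).topologicalClosure = ⊤ := by
  refine ContinuousMap.subalgebra_topologicalClosure_eq_top_of_separatesPoints _ fun x y hxy => ?_
  refine ⟨_, ⟨cosC, Algebra.self_mem_adjoin_singleton ℝ cosC, rfl⟩, fun h => hxy ?_⟩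
  have h1 : Real.cos (Real.pi * x) = Real.cos (Real.pi * y) := h
  have hm : ∀ z : Icc (0 : ℝ) 1, Real.pi * z ∈ Icc 0 Real.pi := fun z =>
    ⟨mul_nonneg Real.pi_pos.le z.2.1, mul_le_of_le_one_right Real.pi_pos.le z.2.2⟩
  exact Subtype.ext (mul_left_cancel₀ Real.pi_pos.ne' (Real.injOn_cos (hm x) (hm y) h1))

/-- The function `sin (π x) f` is orthogonal to all polynomials in `cos (π x)`, hence by density to
all continuous functions, hence zero; and `sin (π x)` has no zero in `(0,1)`. -/
theorem eq_zero_of_forall_inner_sinL {f : L2} (hf : ∀ n, inner ℝ (sinL n) f = 0) : f = 0 := by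
  have hsc : Continuous fun x : ℝ => Real.sin (Real.pi * x) := by fun_prop
  set g : L2 := mulOp (fun x => Real.sin (Real.pi * x)) hsc.continuousOn f with hg
  have hgae := mulOp_ae (fun x => Real.sin (Real.pi * x)) hsc.continuousOn f
  have hpoly : ∀ P : Polynomial ℝ, inner ℝ g (toL2CLM (Polynomial.aeval cosC P)) = 0 := by
    intro P
    induction P using Polynomial.induction_on' with
    | add p q hp hq => rw [map_add, map_add, inner_add_right, hp, hq, add_zero]
    | monomial n a =>
      have : Polynomial.aeval cosC (Polynomial.monomial n a) = a • cosC ^ n := by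
        rw [Polynomial.aeval_monomial, Algebra.algebraMap_eq_smul_one, smul_mul_assoc, one_mul]
      rw [this, map_smul, inner_smul_right]
      have h1 : ∀ᵐ x ∂μ01, toL2CLM (cosC ^ n) x = Real.cos (Real.pi * x) ^ n := by
        filter_upwards [toL2_ae (cosC ^ n), ae_restrict_mem measurableSet_Ioo] with x h2 h3
        rw [toL2CLM_apply, h2, toFun_of_mem _ (Ioo_subset_Icc_self h3)]
        rfl
      rw [inner_L2_eq _ _ hgae h1]
      have := integral_mul_sin_mul_cos_pow hf n 1
      have e : ∀ x, Real.sin (Real.pi * x) * f x * Real.cos (Real.pi * x) ^ n =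
          f x * (Real.sin ((1 : ℕ) * (Real.pi * x)) * Real.cos (Real.pi * x) ^ n) := by
        intro x; push_cast; rw [one_mul]; ring
      simp_rw [e]
      rw [this, mul_zero]
  have hall : ∀ φ : C01, inner ℝ g (toL2CLM φ) = 0 := by
    have hcl : IsClosed {φ : C01 | inner ℝ g (toL2CLM φ) = 0} :=
      isClosed_eq (by fun_prop) continuous_const
    have hsub : ((Algebra.adjoin ℝ {cosC} : Subalgebra ℝ C01) : Set C01) ⊆
        {φ : C01 | inner ℝ g (toL2CLM φ) = 0} := by
      intro φ hφ
      rw [SetLike.mem_coe, Algebra.adjoin_singleton_eq_range_aeval] at hφ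
      obtain ⟨P, rfl⟩ := hφ
      exact hpoly P
    intro φ
    have h1 := closure_minimal hsub hcl
    rw [← Subalgebra.topologicalClosure_coe, dense_adjoin_cosC] at h1
    exact h1 (Algebra.mem_top (R := ℝ))
  have hg0 : g = 0 := by
    refine ae_eq_zero_of_forall_testFunction g fun φ hφ _ _ => ?_
    have h1 := hall (toC φ hφ.continuous.continuousOn)
    rwa [toL2CLM_apply, inner_L2_eq _ _ (ae_of_all _ fun _ => rfl) (toL2_toC_ae _)] at h1
  rw [Lp.eq_zero_iff_ae_eq_zero]
  rw [← hg, hg0] at hgae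
  filter_upwards [hgae, Lp.coeFn_zero ℝ 2 μ01, ae_restrict_mem measurableSet_Ioo] with x h1 h2 h3
  rw [h2] at h1
  refine (mul_eq_zero.1 h1.symm).resolve_left (Real.sin_pos_of_pos_of_lt_pi ?_ ?_).ne'
  · exact mul_pos Real.pi_pos h3.1
  · exact mul_lt_of_lt_one_right Real.pi_pos h3.2

/-- The Hilbert basis of `L²(0,1)` of the Dirichlet eigenfunctions. -/
def sinB : HilbertBasis ℕ ℝ L2 :=
  HilbertBasis.mkOfOrthogonalEqBot orthonormal_sinL (by
    rw [Submodule.eq_bot_iff]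
    intro f hf
    refine eq_zero_of_forall_inner_sinL fun n => ?_
    exact (Submodule.mem_orthogonal _ f).1 hf _ (Submodule.subset_span ⟨n, rfl⟩))

/-! ### Sine coefficients -/

/-- The sine coefficients of `f ∈ L²(0,1)`. -/
def coef (n : ℕ) : L2 →L[ℝ] ℝ := innerSL ℝ (sinL n)

theorem coef_apply (n : ℕ) (f : L2) : coef n f = inner ℝ (sinL n) f := rfl

theorem sinB_apply (n : ℕ) : sinB n = sinL n := by
  rw [sinB, HilbertBasis.coe_mkOfOrthogonalEqBot]

theorem sinB_repr (f : L2) (n : ℕ) : sinB.repr f n = coef n f := by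
  rw [HilbertBasis.repr_apply_apply, sinB_apply, coef_apply]

theorem ext_coef {f g : L2} (h : ∀ n, coef n f = coef n g) : f = g := by
  refine sub_eq_zero.1 (eq_zero_of_forall_inner_sinL fun n => ?_)
  rw [← coef_apply, map_sub, h n, sub_self]

theorem sum_sq_coef_le (f : L2) (s : Finset ℕ) : ∑ n ∈ s, coef n f ^ 2 ≤ ‖f‖ ^ 2 := by
  have h := orthonormal_sinL.sum_inner_products_le f (s := s)
  simpa [coef_apply, sq_abs] using h

theorem summable_sq_coef (f : L2) : Summable fun n => coef n f ^ 2 :=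
  summable_of_sum_le (fun _ => sq_nonneg _) (sum_sq_coef_le f)

theorem hasSum_sq_coef (f : L2) : HasSum (fun n => coef n f ^ 2) (‖f‖ ^ 2) := by
  have h := sinB.hasSum_inner_mul_inner f f
  rw [real_inner_self_eq_norm_sq] at h
  refine h.congr_fun fun n => ?_
  rw [sinB_apply, coef_apply, real_inner_comm, sq]

theorem exists_coef_eq {a : ℕ → ℝ} (ha : Summable fun n => a n ^ 2) :
    ∃ f : L2, ∀ n, coef n f = a n := by
  have hm : Memℓp a 2 := by
    rw [memℓp_gen_iff (by norm_num)]
    simpa using ha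
  refine ⟨sinB.repr.symm ⟨a, hm⟩, fun n => ?_⟩
  rw [← sinB_repr, LinearIsometryEquiv.apply_symm_apply]

theorem coef_sinL (m n : ℕ) : coef m (sinL n) = if m = n then 1 else 0 := by
  rw [coef_apply, orthonormal_iff_ite.1 orthonormal_sinL]

theorem IsH2.coef_eq {w : C01} {w₁ : ℝ → ℝ} {w₂ : L2} (h : IsH2 w w₁ w₂) (h0 : toFun w 0 = 0)
    (h1 : toFun w 1 = 0) (n : ℕ) : coef n w₂ = -lam n * coef n (toL2 w) := by
  have := (isH2_sinC n).inner_symm h (toFun_sinC_zero n) (toFun_sinC_one n) h0 h1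
  rw [inner_smul_left, conj_trivial] at this
  rw [coef_apply, coef_apply]
  exact this.symm

/-- A function with the sine coefficients of an element of `H²` vanishing at the end points. -/
theorem isH2_of_coef {w : C01} {q : L2} (h : ∀ n, coef n q = -lam n * coef n (toL2 w)) :
    toFun w 0 = 0 ∧ toFun w 1 = 0 ∧ ∃ w₁, IsH2 w w₁ q := by
  have P1 := HasPrim.primitive (Lp.memLp q) 0
  have P2 := HasPrim.primitive (memLp_of_continuousOn P1.continuousOn) 0
  -- The slope at `0` is chosen as `-c` so that the second primitive of `q`, which vanishes at `0`,
  -- also vanishes at `1`.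
  set c : ℝ := 0 + ∫ s in (0 : ℝ)..1, (0 + ∫ r in (0 : ℝ)..s, q r) with hc
  have Q1 := HasPrim.primitive (Lp.memLp q) (-c)
  have Q2 := HasPrim.primitive (memLp_of_continuousOn Q1.continuousOn) 0
  set W := toC _ Q2.continuousOn with hW
  have hWH : IsH2 W _ q :=
    ⟨Q2.congr (fun x hx => toFun_toC _ hx) (ae_of_all _ fun _ => rfl), Q1⟩
  have hW0 : toFun W 0 = 0 := by rw [toFun_toC _ zero_mem_I]; simp
  have hW1 : toFun W 1 = 0 := by
    rw [toFun_toC _ one_mem_I]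
    have : ∀ s, (-c + ∫ r in (0 : ℝ)..s, q r) = (0 + ∫ r in (0 : ℝ)..s, q r) - c := fun s => by ring
    simp_rw [this]
    rw [intervalIntegral.integral_sub P2.intervalIntegrable (by simp)]
    simp [hc]
  -- Both functions have the coefficients `-λₙ⁻¹ coef n q`.
  have hww : w = W := by
    refine toL2_injective (ext_coef fun n => ?_)
    have h1 := hWH.coef_eq hW0 hW1 n
    rw [h n] at h1
    exact mul_left_cancel₀ (neg_ne_zero.2 (lam_pos n).ne') h1
  rw [hww]
  exact ⟨hW0, hW1, _, hWH⟩

/-! ### The embedding of `H¹₀` in `C⁰` -/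

theorem summable_inv_lam : Summable fun n => (lam n)⁻¹ := by
  have h : Summable fun n : ℕ => (((n + 1 : ℕ) : ℝ) ^ 2)⁻¹ :=
    (summable_nat_add_iff 1).2 (Real.summable_nat_pow_inv.2 one_lt_two)
  refine (h.mul_left (Real.pi ^ 2)⁻¹).congr fun n => ?_
  rw [lam, freq, mul_pow, mul_inv, mul_comm]
  push_cast
  rfl

/-- The constant of the embedding of `H¹₀(0,1)` in `C⁰([0,1])`. -/
def embConst : ℝ := 2 * ∑' n, (lam n)⁻¹

theorem embConst_nonneg : 0 ≤ embConst :=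
  mul_nonneg zero_le_two (tsum_nonneg fun n => (inv_pos.2 (lam_pos n)).le)

/-- Cauchy-Schwarz for the factors `(freq n)⁻¹` and `freq n * |a n|`; this is where `∑ (lam n)⁻¹ <
∞`, special to dimension one, is used. -/
theorem sum_abs_sq_le {a : ℕ → ℝ} {B : ℝ} {s : Finset ℕ} (h : ∑ n ∈ s, lam n * a n ^ 2 ≤ B) :
    (∑ n ∈ s, |a n|) ^ 2 ≤ (∑' n, (lam n)⁻¹) * B := by
  have e : ∑ n ∈ s, |a n| = ∑ n ∈ s, (freq n)⁻¹ * (freq n * |a n|) :=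
    Finset.sum_congr rfl fun n _ => by rw [inv_mul_cancel_left₀ (freq_pos n).ne']
  rw [e]
  refine (Finset.sum_mul_sq_le_sq_mul_sq s _ _).trans ?_
  refine mul_le_mul ?_ ?_ (Finset.sum_nonneg fun _ _ => sq_nonneg _)
    (tsum_nonneg fun n => (inv_pos.2 (lam_pos n)).le)
  · simp_rw [inv_pow]
    exact summable_inv_lam.sum_le_tsum s fun n _ => (inv_pos.2 (lam_pos n)).le
  · simp_rw [mul_pow, sq_abs]
    exact h

theorem summable_abs_of_sum_le {a : ℕ → ℝ} {B : ℝ}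
    (h : ∀ s : Finset ℕ, ∑ n ∈ s, lam n * a n ^ 2 ≤ B) : Summable fun n => |a n| :=
  summable_of_sum_le (fun _ => abs_nonneg _) fun s => Real.le_sqrt_of_sq_le (sum_abs_sq_le (h s))

theorem summable_smul_sinC {a : ℕ → ℝ} (h : Summable fun n => |a n|) :
    Summable fun n => a n • sinC n := by
  refine Summable.of_norm_bounded (h.mul_right √2) fun n => ?_
  rw [norm_smul, Real.norm_eq_abs]
  exact mul_le_mul_of_nonneg_left (norm_sinC_le n) (abs_nonneg _)

theorem coef_tsum_smul_sinC {a : ℕ → ℝ} (h : Summable fun n => |a n|) (m : ℕ) :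
    coef m (toL2 (∑' n, a n • sinC n)) = a m := by
  have h1 := (summable_smul_sinC h).hasSum.mapL (coef m ∘L toL2CLM)
  refine h1.unique ?_
  have h2 : ∀ n, (coef m ∘L toL2CLM) (a n • sinC n) = if n = m then a m else 0 := by
    intro n
    rw [map_smul, ContinuousLinearMap.comp_apply, toL2CLM_apply, ← sinL, coef_sinL, smul_eq_mul]
    rcases eq_or_ne n m with rfl | h3
    · simp
    · simp [h3, h3.symm]
  simp_rw [h2]
  exact hasSum_ite_eq m (a m)

theorem hasSum_coef_smul_sinC {w : C01} (h : Summable fun n => |coef n (toL2 w)|) :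
    HasSum (fun n => coef n (toL2 w) • sinC n) w := by
  have h1 := (summable_smul_sinC h).hasSum
  have h2 : ∑' n, coef n (toL2 w) • sinC n = w :=
    toL2_injective (ext_coef fun m => coef_tsum_smul_sinC h m)
  rwa [h2] at h1

/-- The bridge from coefficients to the sup-norm: the sine series of `w` converges in `C⁰`, and
every term is at most `√2 |coef n w|`. The factor `2` in `embConst` is the square of this `√2`. -/
theorem norm_sq_le_of_sum_le {w : C01} {B : ℝ}
    (h : ∀ s : Finset ℕ, ∑ n ∈ s, lam n * coef n (toL2 w) ^ 2 ≤ B) : ‖w‖ ^ 2 ≤ embConst * B := by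
  have hs := summable_abs_of_sum_le h
  have h1 := hasSum_coef_smul_sinC hs
  refine le_of_tendsto ((continuous_norm.tendsto w).comp h1 |>.pow 2) (Eventually.of_forall ?_)
  intro s
  have h2 : ‖∑ n ∈ s, coef n (toL2 w) • sinC n‖ ≤ √2 * ∑ n ∈ s, |coef n (toL2 w)| := by
    refine (norm_sum_le _ _).trans ?_
    rw [Finset.mul_sum]
    refine Finset.sum_le_sum fun n _ => ?_
    rw [norm_smul, Real.norm_eq_abs, mul_comm]
    exact mul_le_mul_of_nonneg_right (norm_sinC_le n) (abs_nonneg _)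
  refine (pow_le_pow_left₀ (norm_nonneg _) h2 2).trans ?_
  rw [mul_pow, Real.sq_sqrt zero_le_two, embConst, mul_assoc]
  exact mul_le_mul_of_nonneg_left (sum_abs_sq_le (h s)) zero_le_two

/-! ### Two integral inequalities -/

/-- The Cauchy-Schwarz inequality on an interval. -/
theorem sq_intervalIntegral_mul_le {f g : ℝ → ℝ} {a b : ℝ} (hab : a ≤ b)
    (hf : ContinuousOn f (Icc a b)) (hg : ContinuousOn g (Icc a b)) :
    (∫ s in a..b, f s * g s) ^ 2 ≤ (∫ s in a..b, f s ^ 2) * ∫ s in a..b, g s ^ 2 := by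
  have hi : ∀ {φ : ℝ → ℝ}, ContinuousOn φ (Icc a b) → IntervalIntegrable φ volume a b := fun h =>
    h.intervalIntegrable_of_Icc hab
  -- The quadratic polynomial `x ↦ ∫ (x f + g)²` is nonnegative, so its discriminant is not
  -- positive.
  have key : ∀ x : ℝ, 0 ≤ (∫ s in a..b, f s ^ 2) * (x * x) + (2 * ∫ s in a..b, f s * g s) * x +
      ∫ s in a..b, g s ^ 2 := by
    intro x
    have h1 : ∫ s in a..b, (x * f s + g s) ^ 2 = (∫ s in a..b, f s ^ 2) * (x * x) +
        (2 * ∫ s in a..b, f s * g s) * x + ∫ s in a..b, g s ^ 2 := by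
      have e : ∀ s, (x * f s + g s) ^ 2 = (x * x * f s ^ 2 + 2 * x * (f s * g s)) + g s ^ 2 :=
        fun s => by ring
      simp_rw [e]
      have i1 : ContinuousOn (fun s => x * x * f s ^ 2) (Icc a b) := (hf.pow 2).const_mul _
      have i2 : ContinuousOn (fun s => 2 * x * (f s * g s)) (Icc a b) := (hf.mul hg).const_mul _
      have i3 : ContinuousOn (fun s => g s ^ 2) (Icc a b) := hg.pow 2
      rw [intervalIntegral.integral_add ((hi i1).add (hi i2)) (hi i3),
        intervalIntegral.integral_add (hi i1) (hi i2),
        intervalIntegral.integral_const_mul, intervalIntegral.integral_const_mul]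
      ring
    rw [← h1]
    exact intervalIntegral.integral_nonneg hab fun s _ => sq_nonneg _
  have := discrim_le_zero key
  rw [discrim] at this
  linarith

/-- The function `(A + C ∫₀ʳ φ) exp (-C r)` is nonincreasing. Replacing `φ` by its extension by
constants makes the integral differentiable at the end points too. -/
theorem gronwall_integral {φ : ℝ → ℝ} {A C T : ℝ} (hφ : ContinuousOn φ (Icc 0 T)) (hC : 0 ≤ C)
    (h : ∀ t ∈ Icc 0 T, φ t ≤ A + C * ∫ s in (0 : ℝ)..t, φ s) :
    ∀ t ∈ Icc 0 T, φ t ≤ A * Real.exp (C * t) := by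
  intro t ht
  have hT : 0 ≤ T := ht.1.trans ht.2
  set ψ : ℝ → ℝ := IccExtend hT ((Icc 0 T).domRestrict φ) with hψ
  have hψc : Continuous ψ := hφ.domRestrict.Icc_extend'
  have hψe : ∀ s ∈ Icc 0 T, ψ s = φ s := fun s hs => IccExtend_of_mem _ _ hs
  have hint : ∀ r ∈ Icc 0 T, ∫ s in (0 : ℝ)..r, ψ s = ∫ s in (0 : ℝ)..r, φ s := fun r hr =>
    intervalIntegral.integral_congr fun s hs => by
      rw [uIcc_of_le hr.1] at hs
      exact hψe s ⟨hs.1, hs.2.trans hr.2⟩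
  have hd : ∀ r, HasDerivAt (fun r => (A + C * ∫ s in (0 : ℝ)..r, ψ s) * Real.exp (-C * r))
      (C * ψ r * Real.exp (-C * r) +
        (A + C * ∫ s in (0 : ℝ)..r, ψ s) * (Real.exp (-C * r) * (-C))) r := by
    intro r
    have h1 := (((hψc.integral_hasStrictDerivAt 0 r).hasDerivAt.const_mul C).const_add A)
    have h2 := ((hasDerivAt_id r).const_mul (-C)).exp
    simp only [id, mul_one] at h2
    exact h1.mul h2
  have hanti : AntitoneOn (fun r => (A + C * ∫ s in (0 : ℝ)..r, ψ s) * Real.exp (-C * r))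
      (Icc 0 T) := by
    refine antitoneOn_of_deriv_nonpos (convex_Icc 0 T)
      (fun r _ => (hd r).continuousAt.continuousWithinAt)
      (fun r _ => (hd r).differentiableAt.differentiableWithinAt) fun r hr => ?_
    have hr' := interior_subset hr
    have h1 := h r hr'
    rw [(hd r).deriv, hint r hr', hψe r hr']
    have : C * φ r * Real.exp (-C * r) + (A + C * ∫ s in (0 : ℝ)..r, φ s) *
        (Real.exp (-C * r) * (-C)) =
        -(C * Real.exp (-C * r) * ((A + C * ∫ s in (0 : ℝ)..r, φ s) - φ r)) := by ring
    rw [this]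
    have := Real.exp_pos (-C * r)
    exact neg_nonpos.2 (mul_nonneg (by positivity) (by linarith))
  have h1 := hanti ⟨le_rfl, hT⟩ ht ht.1
  simp only [intervalIntegral.integral_same, mul_zero, add_zero, Real.exp_zero, mul_one] at h1
  rw [hint t ht] at h1
  calc φ t ≤ A + C * ∫ s in (0 : ℝ)..t, φ s := h t ht
    _ = (A + C * ∫ s in (0 : ℝ)..t, φ s) * Real.exp (-C * t) * Real.exp (C * t) := by
      rw [mul_assoc, ← Real.exp_add]; simp
    _ ≤ A * Real.exp (C * t) := by gcongr

/-! ### Duhamel integrals -/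

/-- The sine coefficients of `∫₀ᵗ S(t-s) f(s) ds`, where `S` is the semigroup of `p ∂ₓ²` with
Dirichlet boundary conditions. -/
def duh (p : ℝ) (f : ℝ → L2) (n : ℕ) (t : ℝ) : ℝ :=
  ∫ s in (0 : ℝ)..t, Real.exp (-(p * lam n) * (t - s)) * coef n (f s)

section Duhamel

variable {p : ℝ} {f g : ℝ → L2} {n : ℕ} {t : ℝ}

theorem continuousOn_coef {S : Set ℝ} (hf : ContinuousOn f S) :
    ContinuousOn (fun s => coef n (f s)) S :=
  (coef n).continuous.comp_continuousOn hf

theorem continuousOn_duh_integrand {S : Set ℝ} (hf : ContinuousOn f S) :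
    ContinuousOn (fun s => Real.exp (-(p * lam n) * (t - s)) * coef n (f s)) S :=
  (Continuous.continuousOn (by fun_prop)).mul (continuousOn_coef hf)

theorem duh_congr (ht : 0 ≤ t) (h : ∀ s ∈ Icc 0 t, f s = g s) : duh p f n t = duh p g n t :=
  intervalIntegral.integral_congr fun s hs => by
    rw [uIcc_of_le ht] at hs
    simp only [h s hs]

theorem duh_sub (ht : 0 ≤ t) (hf : ContinuousOn f (Icc 0 t)) (hg : ContinuousOn g (Icc 0 t)) :
    duh p (fun s => f s - g s) n t = duh p f n t - duh p g n t := by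
  rw [duh, duh, duh, ← intervalIntegral.integral_sub
    ((continuousOn_duh_integrand hf).intervalIntegrable_of_Icc ht)
    ((continuousOn_duh_integrand hg).intervalIntegrable_of_Icc ht)]
  refine intervalIntegral.integral_congr fun s _ => ?_
  simp only [map_sub]
  ring

theorem duh_eq : duh p f n t = Real.exp (-(p * lam n) * t) *
    ∫ s in (0 : ℝ)..t, Real.exp (p * lam n * s) * coef n (f s) := by
  rw [duh, ← intervalIntegral.integral_const_mul]
  refine intervalIntegral.integral_congr fun s _ => ?_
  rw [← mul_assoc, ← Real.exp_add]
  congr 2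
  ring

theorem hasDerivAt_duh (hf : Continuous f) :
    HasDerivAt (duh p f n) (-(p * lam n) * duh p f n t + coef n (f t)) t := by
  have hc : Continuous fun s => Real.exp (p * lam n * s) * coef n (f s) :=
    (by fun_prop : Continuous fun s => Real.exp (p * lam n * s)).mul ((coef n).continuous.comp hf)
  have h1 := (hc.integral_hasStrictDerivAt 0 t).hasDerivAt
  have h2 := ((hasDerivAt_id t).const_mul (-(p * lam n))).exp
  have h3 := h2.mul h1
  have e : duh p f n = fun t => Real.exp (-(p * lam n) * t) *
      ∫ s in (0 : ℝ)..t, Real.exp (p * lam n * s) * coef n (f s) := funext fun t => duh_eq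
  rw [e]
  refine h3.congr_deriv ?_
  simp only [id, mul_one]
  rw [← mul_assoc (Real.exp _) (Real.exp _), ← Real.exp_add]
  have : -(p * lam n) * t + p * lam n * t = 0 := by ring
  rw [this, Real.exp_zero]
  ring

theorem continuous_duh (hf : Continuous f) : Continuous (duh p f n) :=
  continuous_iff_continuousAt.2 fun _ => (hasDerivAt_duh hf).continuousAt

/-- Splitting the integral at `τ` separates the past, damped by the semigroup, from a Duhamel
integral with shifted source. -/
theorem duh_add {τ : ℝ} (hf : Continuous f) :
    duh p f n (t + τ) =
      Real.exp (-(p * lam n) * t) * duh p f n τ + duh p (fun s => f (s + τ)) n t := by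
  have hc : Continuous fun s => Real.exp (-(p * lam n) * (t + τ - s)) * coef n (f s) :=
    (by fun_prop : Continuous fun s => Real.exp (-(p * lam n) * (t + τ - s))).mul
      ((coef n).continuous.comp hf)
  rw [duh, ← intervalIntegral.integral_add_adjacent_intervals (hc.intervalIntegrable 0 τ)
    (hc.intervalIntegrable τ (t + τ))]
  congr 1
  · rw [duh, ← intervalIntegral.integral_const_mul]
    refine intervalIntegral.integral_congr fun s _ => ?_
    rw [← mul_assoc, ← Real.exp_add]
    congr 2
    ring
  · have := intervalIntegral.integral_comp_add_right (a := 0) (b := t)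
      (fun s => Real.exp (-(p * lam n) * (t + τ - s)) * coef n (f s)) τ
    rw [zero_add] at this
    rw [← this, duh]
    refine intervalIntegral.integral_congr fun s _ => ?_
    congr 2
    ring

theorem integral_exp_le {μ : ℝ} (hμ : 0 < μ) (t : ℝ) :
    ∫ s in (0 : ℝ)..t, Real.exp (-μ * (t - s)) ≤ μ⁻¹ := by
  have hd : ∀ s ∈ uIcc 0 t, HasDerivAt (fun s => μ⁻¹ * Real.exp (-μ * (t - s)))
      (Real.exp (-μ * (t - s))) s := by
    intro s _
    have h := ((((hasDerivAt_id s).const_sub t).const_mul (-μ)).exp).const_mul μ⁻¹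
    refine h.congr_deriv ?_
    simp only [id]
    field_simp
  rw [intervalIntegral.integral_eq_sub_of_hasDerivAt hd
    (Continuous.intervalIntegrable (by fun_prop) _ _)]
  have := Real.exp_pos (-μ * (t - 0))
  have := inv_pos.2 hμ
  simp only [sub_self, mul_zero, Real.exp_zero, mul_one]
  nlinarith

/-- By Cauchy-Schwarz the kernel contributes `∫ exp (-2 p λ (t - s)) ≤ (2 p λ)⁻¹`, which cancels the
factor `λ` exactly. A source in `L²` is thus smoothed into `H¹₀`. -/
theorem lam_mul_sq_duh_le (hp : 0 < p) (ht : 0 ≤ t) (hf : ContinuousOn f (Icc 0 t)) :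
    lam n * duh p f n t ^ 2 ≤ (2 * p)⁻¹ * ∫ s in (0 : ℝ)..t, coef n (f s) ^ 2 := by
  have h1 := sq_intervalIntegral_mul_le (f := fun s => Real.exp (-(p * lam n) * (t - s)))
    (g := fun s => coef n (f s)) ht (Continuous.continuousOn (by fun_prop)) (continuousOn_coef hf)
  have hl := lam_pos n
  have h2 : ∫ s in (0 : ℝ)..t, Real.exp (-(p * lam n) * (t - s)) ^ 2 ≤ (2 * (p * lam n))⁻¹ := by
    refine le_trans (le_of_eq ?_) (integral_exp_le (μ := 2 * (p * lam n)) (by positivity) t)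
    refine intervalIntegral.integral_congr fun s _ => ?_
    rw [← Real.exp_nat_mul]
    congr 1
    push_cast
    ring
  have h3 : 0 ≤ ∫ s in (0 : ℝ)..t, coef n (f s) ^ 2 :=
    intervalIntegral.integral_nonneg ht fun s _ => sq_nonneg _
  calc lam n * duh p f n t ^ 2 ≤ lam n * ((2 * (p * lam n))⁻¹ *
        ∫ s in (0 : ℝ)..t, coef n (f s) ^ 2) := by
        refine mul_le_mul_of_nonneg_left (h1.trans ?_) hl.le
        exact mul_le_mul_of_nonneg_right h2 h3
    _ = _ := by field_simp

theorem sum_integral_sq_coef_le (ht : 0 ≤ t) (hf : ContinuousOn f (Icc 0 t)) (s : Finset ℕ) :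
    ∑ n ∈ s, ∫ r in (0 : ℝ)..t, coef n (f r) ^ 2 ≤ ∫ r in (0 : ℝ)..t, ‖f r‖ ^ 2 := by
  have hc : ∀ n, ContinuousOn (fun r => coef n (f r) ^ 2) (Icc 0 t) := fun n =>
    (continuousOn_coef hf).pow 2
  rw [← intervalIntegral.integral_finsetSum fun n _ => (hc n).intervalIntegrable_of_Icc ht]
  refine intervalIntegral.integral_mono_on ht ?_ ((hf.norm.pow 2).intervalIntegrable_of_Icc ht)
    fun r _ => sum_sq_coef_le (f r) s
  exact ContinuousOn.intervalIntegrable_of_Icc ht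
    (continuousOn_finsetSum _ fun n _ => hc n)

theorem sum_lam_mul_sq_duh_le (hp : 0 < p) (ht : 0 ≤ t) (hf : ContinuousOn f (Icc 0 t))
    (s : Finset ℕ) :
    ∑ n ∈ s, lam n * duh p f n t ^ 2 ≤ (2 * p)⁻¹ * ∫ r in (0 : ℝ)..t, ‖f r‖ ^ 2 := by
  refine (Finset.sum_le_sum fun n _ => lam_mul_sq_duh_le hp ht hf).trans ?_
  rw [← Finset.mul_sum]
  exact mul_le_mul_of_nonneg_left (sum_integral_sq_coef_le ht hf s) (by positivity)

/-- A bound for `duh p f n` on `[0,T]` that is summable in `n`. -/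
theorem exists_summable_abs_duh_le (hp : 0 < p) {T : ℝ} (hT : 0 ≤ T)
    (hf : ContinuousOn f (Icc 0 T)) :
    ∃ m : ℕ → ℝ, Summable m ∧ ∀ n, ∀ t ∈ Icc 0 T, |duh p f n t| ≤ m n := by
  -- The majorant comes from `|d| ≤ λ⁻¹ + λ d²`, whose second term is controlled by
  -- `lam_mul_sq_duh_le`, uniformly in `t`.
  refine ⟨fun n => (lam n)⁻¹ + (2 * p)⁻¹ * ∫ s in (0 : ℝ)..T, coef n (f s) ^ 2,
    summable_inv_lam.add (Summable.mul_left _ (summable_of_sum_le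
      (fun n => intervalIntegral.integral_nonneg hT fun s _ => sq_nonneg _)
      (sum_integral_sq_coef_le hT hf))), fun n t ht => ?_⟩
  have hft : ContinuousOn f (Icc 0 t) := hf.mono (Icc_subset_Icc_right ht.2)
  have h1 := lam_mul_sq_duh_le (n := n) hp ht.1 hft
  have h2 : ∫ s in (0 : ℝ)..t, coef n (f s) ^ 2 ≤ ∫ s in (0 : ℝ)..T, coef n (f s) ^ 2 :=
    intervalIntegral.integral_mono_interval le_rfl ht.1 ht.2 (ae_of_all _ fun s => sq_nonneg _)
      (((continuousOn_coef hf).pow 2).intervalIntegrable_of_Icc hT)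
  have h3 : (2 * p)⁻¹ * ∫ s in (0 : ℝ)..t, coef n (f s) ^ 2 ≤
      (2 * p)⁻¹ * ∫ s in (0 : ℝ)..T, coef n (f s) ^ 2 := by gcongr
  refine le_trans ?_ (add_le_add_right (h1.trans h3) _)
  have hl := lam_pos n
  have h4 : lam n * (lam n)⁻¹ = 1 := mul_inv_cancel₀ hl.ne'
  have h5 : (lam n)⁻¹ + lam n * duh p f n t ^ 2 =
      lam n * (((lam n)⁻¹ - |duh p f n t|) ^ 2) + 2 * |duh p f n t| * (lam n * (lam n)⁻¹)
      + (lam n)⁻¹ * (1 - lam n * (lam n)⁻¹) := by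
    rw [← sq_abs (duh p f n t)]; ring
  rw [h5, h4]
  have := mul_nonneg hl.le (sq_nonneg ((lam n)⁻¹ - |duh p f n t|))
  have := abs_nonneg (duh p f n t)
  linarith

end Duhamel

/-! ### Mild solutions and their uniqueness -/

/-- `w` is a mild solution on `[0,T]` of `w_t = p w_xx + N(w)`, `w[0] = w₀`, with Dirichlet
boundary conditions. -/
structure IsMild (p : ℝ) (N : C01 → L2) (w₀ : C01) (T : ℝ) (w : ℝ → C01) : Prop where
  continuousOn : ContinuousOn w (Icc 0 T)
  coef_eq : ∀ t ∈ Icc 0 T, ∀ n, coef n (toL2 (w t)) =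
    Real.exp (-(p * lam n) * t) * coef n (toL2 w₀) + duh p (fun s => N (w s)) n t

/-- `N` is Lipschitz continuous on bounded sets. -/
def LipOnBounded (N : C01 → L2) : Prop :=
  ∀ R : ℝ, ∃ M : ℝ, 0 ≤ M ∧ ∀ u v : C01, ‖u‖ ≤ R → ‖v‖ ≤ R → ‖N u - N v‖ ≤ M * ‖u - v‖

theorem LipOnBounded.continuous {N : C01 → L2} (hN : LipOnBounded N) : Continuous N := by
  rw [continuous_iff_continuousAt]
  intro u
  obtain ⟨M, hM, h⟩ := hN (‖u‖ + 1)
  have h1 : LipschitzOnWith ⟨M, hM⟩ N (Metric.closedBall u 1) := by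
    refine LipschitzOnWith.of_dist_le_mul fun v hv w hw => ?_
    rw [dist_eq_norm, dist_eq_norm]
    have hb : ∀ v ∈ Metric.closedBall u 1, ‖v‖ ≤ ‖u‖ + 1 := fun v hv => by
      rw [Metric.mem_closedBall, dist_eq_norm] at hv
      have := norm_le_norm_add_norm_sub' v u
      linarith
    exact h v w (hb v hv) (hb w hw)
  exact h1.continuousOn.continuousAt (Metric.closedBall_mem_nhds u one_pos)

theorem exists_norm_le_of_continuousOn {E : Type*} [NormedAddCommGroup E] {w : ℝ → E} {T : ℝ}
    (hw : ContinuousOn w (Icc 0 T)) : ∃ R, ∀ t ∈ Icc 0 T, ‖w t‖ ≤ R :=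
  isCompact_Icc.exists_bound_of_continuousOn hw

theorem IsMild.mono {p : ℝ} {N : C01 → L2} {w₀ : C01} {T T' : ℝ} {w : ℝ → C01}
    (h : IsMild p N w₀ T w) (hT : T' ≤ T) : IsMild p N w₀ T' w :=
  ⟨h.continuousOn.mono (Icc_subset_Icc_right hT),
    fun t ht => h.coef_eq t ⟨ht.1, ht.2.trans hT⟩⟩

theorem IsMild.congr {p : ℝ} {N N' : C01 → L2} {w₀ : C01} {T : ℝ} {w w' : ℝ → C01}
    (h : IsMild p N w₀ T w) (hw : ∀ t ∈ Icc 0 T, w' t = w t)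
    (hN : ∀ t ∈ Icc 0 T, N' (w t) = N (w t)) : IsMild p N' w₀ T w' where
  continuousOn := h.continuousOn.congr hw
  coef_eq t ht n := by
    rw [hw t ht, h.coef_eq t ht n]
    congr 1
    refine duh_congr ht.1 fun s hs => ?_
    have hs' : s ∈ Icc 0 T := ⟨hs.1, hs.2.trans ht.2⟩
    simp only [hw s hs', hN s hs']

/-- The initial terms cancel in the difference; the smoothing estimate and the embedding then give a
Gronwall inequality for `‖w - v‖²` with zero initial value. -/
theorem IsMild.eq {p : ℝ} (hp : 0 < p) {N : C01 → L2} (hN : LipOnBounded N) {w₀ : C01} {T : ℝ}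
    {w v : ℝ → C01} (hw : IsMild p N w₀ T w) (hv : IsMild p N w₀ T v) :
    ∀ t ∈ Icc 0 T, w t = v t := by
  intro t ht
  obtain ⟨R₁, hR₁⟩ := exists_norm_le_of_continuousOn hw.continuousOn
  obtain ⟨R₂, hR₂⟩ := exists_norm_le_of_continuousOn hv.continuousOn
  obtain ⟨M, hM, hMN⟩ := hN (max R₁ R₂)
  have hNw : ContinuousOn (fun s => N (w s)) (Icc 0 T) :=
    hN.continuous.comp_continuousOn hw.continuousOn
  have hNv : ContinuousOn (fun s => N (v s)) (Icc 0 T) :=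
    hN.continuous.comp_continuousOn hv.continuousOn
  have hNwv : ContinuousOn (fun s => N (w s) - N (v s)) (Icc 0 T) := hNw.sub hNv
  have hφ : ContinuousOn (fun t => ‖w t - v t‖ ^ 2) (Icc 0 T) :=
    (hw.continuousOn.sub hv.continuousOn).norm.pow 2
  have key : ∀ t ∈ Icc 0 T, ‖w t - v t‖ ^ 2 ≤ 0 + (embConst * ((2 * p)⁻¹ * M ^ 2)) *
      ∫ s in (0 : ℝ)..t, ‖w s - v s‖ ^ 2 := by
    intro t ht
    have hsub : Icc 0 t ⊆ Icc 0 T := Icc_subset_Icc_right ht.2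
    have hcoef : ∀ n, coef n (toL2 (w t - v t)) =
        duh p (fun s => N (w s) - N (v s)) n t := by
      intro n
      rw [duh_sub ht.1 (hNw.mono hsub) (hNv.mono hsub), toL2_sub, map_sub, hw.coef_eq t ht,
        hv.coef_eq t ht]
      ring
    have h1 := norm_sq_le_of_sum_le (w := w t - v t) (fun s => by
      simp_rw [hcoef]
      exact sum_lam_mul_sq_duh_le hp ht.1 (hNwv.mono hsub) s)
    have h2 : ∫ r in (0 : ℝ)..t, ‖N (w r) - N (v r)‖ ^ 2 ≤
        M ^ 2 * ∫ r in (0 : ℝ)..t, ‖w r - v r‖ ^ 2 := by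
      rw [← intervalIntegral.integral_const_mul]
      refine intervalIntegral.integral_mono_on ht.1
        (((hNwv.mono hsub).norm.pow 2).intervalIntegrable_of_Icc ht.1)
        (((hφ.mono hsub).const_mul _).intervalIntegrable_of_Icc ht.1) fun r hr => ?_
      rw [← mul_pow]
      exact pow_le_pow_left₀ (norm_nonneg _) (hMN _ _ ((hR₁ r (hsub hr)).trans (le_max_left _ _))
        ((hR₂ r (hsub hr)).trans (le_max_right _ _))) 2
    rw [zero_add, mul_assoc, mul_assoc]
    have := embConst_nonneg
    exact h1.trans (by gcongr)
  have h := gronwall_integral hφ (by have := embConst_nonneg; positivity) key t ht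
  rw [zero_mul] at h
  exact sub_eq_zero.1 (norm_eq_zero.1 (pow_eq_zero_iff two_ne_zero |>.1 (le_antisymm h (sq_nonneg _))))

/-! ### Existence for globally Lipschitz nonlinearities -/

theorem one_le_lam (n : ℕ) : 1 ≤ lam n := by
  have h : (1 : ℝ) ≤ freq n := by
    have h1 : (1 : ℝ) ≤ (n : ℝ) + 1 := by linarith [n.cast_nonneg (α := ℝ)]
    have h2 : (1 : ℝ) ≤ Real.pi := by linarith [Real.pi_gt_three]
    exact one_le_mul_of_one_le_of_one_le h1 h2
  exact one_le_pow₀ h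

/-- `q` is the image of `w` under the Dirichlet Laplacian. -/
def IsLap (w : C01) (q : L2) : Prop := ∀ n, coef n q = -lam n * coef n (toL2 w)

theorem IsLap.sum_le {w : C01} {q : L2} (h : IsLap w q) (s : Finset ℕ) :
    ∑ n ∈ s, lam n * coef n (toL2 w) ^ 2 ≤ ‖q‖ ^ 2 := by
  refine le_trans (Finset.sum_le_sum fun n _ => ?_) (sum_sq_coef_le q s)
  rw [h n, mul_pow, neg_sq]
  exact mul_le_mul_of_nonneg_right (le_self_pow₀ (one_le_lam n) two_ne_zero) (sq_nonneg _)

theorem IsLap.summable {w : C01} {q : L2} (h : IsLap w q) :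
    Summable fun n => |coef n (toL2 w)| :=
  summable_abs_of_sum_le h.sum_le

/-- Weierstrass' test for the sine series in `C⁰`. Time is projected onto `[0,T]` so that the bound
holds on all of `ℝ`. -/
theorem exists_continuous_of_coef {c : ℕ → ℝ → ℝ} (hc : ∀ n, Continuous (c n)) {m : ℕ → ℝ}
    (hm : Summable m) {T : ℝ} (hT : 0 ≤ T) (hcm : ∀ n, ∀ t ∈ Icc 0 T, |c n t| ≤ m n) :
    ∃ W : ℝ → C01, Continuous W ∧ ∀ t ∈ Icc 0 T, ∀ n, coef n (toL2 (W t)) = c n t := by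
  have hpr : ∀ t, ((projIcc 0 T hT t : Icc 0 T) : ℝ) ∈ Icc 0 T := fun t => (projIcc 0 T hT t).2
  have hprc : Continuous fun t => ((projIcc 0 T hT t : Icc 0 T) : ℝ) :=
    continuous_subtype_val.comp continuous_projIcc
  refine ⟨fun t => ∑' n, c n (projIcc 0 T hT t) • sinC n, ?_, fun t ht n => ?_⟩
  · refine continuous_tsum (u := fun n => m n * √2)
      (fun n => ((hc n).comp hprc).smul continuous_const) (hm.mul_right _) fun n t => ?_
    rw [norm_smul, Real.norm_eq_abs]
    have h1 := hcm n _ (hpr t)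
    exact mul_le_mul h1 (norm_sinC_le n) (norm_nonneg _) ((abs_nonneg _).trans h1)
  · simp only [projIcc_of_mem hT ht]
    exact coef_tsum_smul_sinC (hm.of_nonneg_of_le (fun _ => abs_nonneg _) fun n => hcm n t ht) n

/-- The equation with a globally Lipschitz nonlinearity has a mild solution on `[0,T]`. -/
theorem exists_isMild_of_lipschitz {p : ℝ} (hp : 0 < p) {N : C01 → L2} {M : ℝ} (hM : 0 ≤ M)
    (hN : ∀ u v : C01, ‖N u - N v‖ ≤ M * ‖u - v‖) {w₀ : C01} {q₀ : L2} (h₀ : IsLap w₀ q₀)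
    {T : ℝ} (hT : 0 ≤ T) : ∃ w : ℝ → C01, Continuous w ∧ IsMild p N w₀ T w := by
  have hNc : Continuous N :=
    (LipschitzWith.of_dist_le_mul (K := ⟨M, hM⟩) fun u v => by
      rw [dist_eq_norm, dist_eq_norm]; exact hN u v).continuous
  set D : ℝ := embConst * ((2 * p)⁻¹ * M ^ 2) with hD
  have hD0 : 0 ≤ D := by have := embConst_nonneg; positivity
  -- With this weight `D / (2 μ) ≤ 1/4`, the square of the contraction constant `1/2`.
  set μ : ℝ := 2 * D + 1 with hμ
  have hμ0 : 0 < μ := by positivity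
  -- The unknown of the fixed point problem is `ψ t = exp (-μ t) w t`, measured in the unweighted
  -- sup-norm.
  let f : C(Icc 0 T, C01) → ℝ → L2 := fun ψ s => N (Real.exp (μ * s) • IccExtend hT ψ s)
  have hext : ∀ ψ : C(Icc 0 T, C01), Continuous fun s => Real.exp (μ * s) • IccExtend hT ψ s :=
    fun ψ => (by fun_prop : Continuous fun s => Real.exp (μ * s)).smul ψ.continuous.Icc_extend'
  have hf : ∀ ψ, Continuous (f ψ) := fun ψ => hNc.comp (hext ψ)
  have hex : ∀ ψ, ∃ W : ℝ → C01, Continuous W ∧ ∀ t ∈ Icc 0 T, ∀ n, coef n (toL2 (W t)) =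
      Real.exp (-(p * lam n) * t) * coef n (toL2 w₀) + duh p (f ψ) n t := by
    intro ψ
    obtain ⟨m, hm, hmb⟩ := exists_summable_abs_duh_le hp hT (hf ψ).continuousOn
    refine exists_continuous_of_coef (m := fun n => |coef n (toL2 w₀)| + m n)
      (fun n => ?_) (h₀.summable.add hm) hT fun n t ht => ?_
    · exact (by fun_prop : Continuous fun t =>
        Real.exp (-(p * lam n) * t) * coef n (toL2 w₀)).add (continuous_duh (hf ψ))
    · refine (abs_add_le _ _).trans (add_le_add ?_ (hmb n t ht))
      rw [abs_mul, Real.abs_exp]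
      refine mul_le_of_le_one_left (abs_nonneg _) (Real.exp_le_one_iff.2 ?_)
      have := mul_nonneg (mul_pos hp (lam_pos n)).le ht.1
      linarith
  choose W hWc hW using hex
  have hΨc : ∀ ψ, Continuous fun t : Icc 0 T => Real.exp (-μ * t) • W ψ t := fun ψ =>
    (by fun_prop : Continuous fun t : Icc 0 T => Real.exp (-μ * t)).smul
      ((hWc ψ).comp continuous_subtype_val)
  let Ψ : C(Icc 0 T, C01) → C(Icc 0 T, C01) := fun ψ => ⟨_, hΨc ψ⟩
  have hcontr : ContractingWith (1 / 2) Ψ := by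
    suffices key : ∀ ψ φ, ‖Ψ ψ - Ψ φ‖ ≤ 1 / 2 * ‖ψ - φ‖ by
      refine ⟨by rw [← NNReal.coe_lt_coe]; norm_num, LipschitzWith.of_dist_le_mul fun ψ φ => ?_⟩
      have e : ((1 / 2 : NNReal) : ℝ) * dist ψ φ = 1 / 2 * ‖ψ - φ‖ := by
        rw [NNReal.coe_div, NNReal.coe_one, NNReal.coe_ofNat]
        exact congrArg _ (dist_eq_norm ψ φ)
      exact (dist_eq_norm (Ψ ψ) (Ψ φ)).le.trans ((key ψ φ).trans_eq e.symm)
    intro ψ φ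
    refine (ContinuousMap.norm_le _ (by positivity)).2 fun t => ?_
    have ht := t.2
    have hcoef : ∀ n, coef n (toL2 (W ψ t - W φ t)) = duh p (fun s => f ψ s - f φ s) n t := by
      intro n
      rw [duh_sub ht.1 (hf ψ).continuousOn (hf φ).continuousOn, toL2_sub, map_sub, hW ψ t ht,
        hW φ t ht]
      ring
    have hfc : Continuous fun s => f ψ s - f φ s := (hf ψ).sub (hf φ)
    have h1 := norm_sq_le_of_sum_le (w := W ψ t - W φ t) (fun s => by
      simp_rw [hcoef]
      exact sum_lam_mul_sq_duh_le hp ht.1 hfc.continuousOn s)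
    -- The weight is written relative to time `t`, so that its integral costs only `(2 μ)⁻¹`.
    have hfn : ∀ s ∈ Icc 0 (t : ℝ), ‖f ψ s - f φ s‖ ^ 2 ≤
        M ^ 2 * ‖ψ - φ‖ ^ 2 * (Real.exp (2 * μ * t) * Real.exp (-(2 * μ) * (t - s))) := by
      intro s hs
      have h2 : ‖f ψ s - f φ s‖ ≤ M * (Real.exp (μ * s) * ‖ψ - φ‖) := by
        refine (hN _ _).trans (mul_le_mul_of_nonneg_left ?_ hM)
        rw [← smul_sub, norm_smul, Real.norm_eq_abs, Real.abs_exp]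
        exact mul_le_mul_of_nonneg_left ((ψ - φ).norm_coe_le_norm _) (Real.exp_pos _).le
      refine (pow_le_pow_left₀ (norm_nonneg _) h2 2).trans (le_of_eq ?_)
      rw [← Real.exp_add, mul_pow, mul_pow, ← Real.exp_nat_mul]
      have : ((2 : ℕ) : ℝ) * (μ * s) = 2 * μ * t + -(2 * μ) * (t - s) := by push_cast; ring
      rw [this]
      ring
    have h3 : ∫ s in (0 : ℝ)..t, ‖f ψ s - f φ s‖ ^ 2 ≤
        M ^ 2 * ‖ψ - φ‖ ^ 2 * (Real.exp (2 * μ * t) * (2 * μ)⁻¹) := by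
      refine (intervalIntegral.integral_mono_on ht.1 ((hfc.norm.pow 2).intervalIntegrable _ _)
        (Continuous.intervalIntegrable (by fun_prop) _ _) hfn).trans ?_
      rw [intervalIntegral.integral_const_mul, intervalIntegral.integral_const_mul]
      have := integral_exp_le (μ := 2 * μ) (by positivity) (t : ℝ)
      gcongr
    have h4 : ‖W ψ t - W φ t‖ ^ 2 ≤ (Real.exp (μ * t) * (1 / 2 * ‖ψ - φ‖)) ^ 2 := by
      calc ‖W ψ t - W φ t‖ ^ 2 ≤ embConst * ((2 * p)⁻¹ *
            (M ^ 2 * ‖ψ - φ‖ ^ 2 * (Real.exp (2 * μ * t) * (2 * μ)⁻¹))) := by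
            have := embConst_nonneg
            exact h1.trans (by gcongr)
        _ = D * (2 * μ)⁻¹ * (Real.exp (2 * μ * t) * ‖ψ - φ‖ ^ 2) := by rw [hD]; ring
        _ ≤ 1 / 4 * (Real.exp (2 * μ * t) * ‖ψ - φ‖ ^ 2) := by
            refine mul_le_mul_of_nonneg_right ?_ (by positivity)
            rw [mul_inv_le_iff₀ (by positivity), hμ]
            linarith
        _ = _ := by
            have : 2 * μ * (t : ℝ) = ((2 : ℕ) : ℝ) * (μ * t) := by push_cast; ring
            rw [this, Real.exp_nat_mul]
            ring
    have h5 := (pow_le_pow_iff_left₀ (norm_nonneg _) (by positivity) two_ne_zero).1 h4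
    change ‖Real.exp (-μ * t) • W ψ t - Real.exp (-μ * t) • W φ t‖ ≤ _
    rw [← smul_sub, norm_smul, Real.norm_eq_abs, Real.abs_exp]
    refine (mul_le_mul_of_nonneg_left h5 (Real.exp_pos _).le).trans (le_of_eq ?_)
    rw [← mul_assoc, ← Real.exp_add]
    simp
  set ψ := hcontr.fixedPoint Ψ with hψ
  have hfix : Ψ ψ = ψ := hcontr.fixedPoint_isFixedPt
  have hw : ∀ t ∈ Icc 0 T, Real.exp (μ * t) • IccExtend hT ψ t = W ψ t := by
    intro t ht
    rw [IccExtend_of_mem _ _ ht]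
    conv_lhs => rw [← hfix]
    change Real.exp (μ * t) • Real.exp (-μ * t) • W ψ t = W ψ t
    rw [smul_smul, ← Real.exp_add]
    simp
  refine ⟨_, hext ψ, (hext ψ).continuousOn, fun t ht n => ?_⟩
  rw [hw t ht, hW ψ t ht n]

/-! ### Truncation, local existence and continuation -/

/-- Pointwise truncation at the levels `-R` and `R`. -/
def clampC (R : ℝ) (u : C01) : C01 := ⟨fun x => max (-R) (min R (u x)), by fun_prop⟩

theorem norm_clampC_sub_le (R : ℝ) (u v : C01) : ‖clampC R u - clampC R v‖ ≤ ‖u - v‖ := by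
  refine (ContinuousMap.norm_le _ (norm_nonneg _)).2 fun x => ?_
  have h := (u - v).norm_coe_le_norm x
  rw [ContinuousMap.sub_apply, Real.norm_eq_abs] at h
  refine le_trans ?_ h
  change |max (-R) (min R (u x)) - max (-R) (min R (v x))| ≤ |u x - v x|
  refine (abs_max_sub_max_le_max _ _ _ _).trans (max_le (by simp) ?_)
  exact (abs_min_sub_min_le_max _ _ _ _).trans (max_le (by simp) le_rfl)

theorem norm_clampC_le {R : ℝ} (hR : 0 ≤ R) (u : C01) : ‖clampC R u‖ ≤ R := by
  refine (ContinuousMap.norm_le _ hR).2 fun x => abs_le.2 ⟨le_max_left _ _, ?_⟩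
  exact max_le (by linarith) (min_le_left _ _)

theorem clampC_of_norm_le {R : ℝ} {u : C01} (hu : ‖u‖ ≤ R) : clampC R u = u := by
  ext x
  have h := abs_le.1 ((u.norm_coe_le_norm x).trans hu)
  change max (-R) (min R (u x)) = u x
  rw [min_eq_right h.2, max_eq_right h.1]

/-- Truncating the argument makes `N` globally Lipschitz, so the solution is global; it solves the
original equation for as long as it stays in the ball of radius `R`. -/
theorem exists_isMild_truncated {p : ℝ} (hp : 0 < p) {N : C01 → L2} (hN : LipOnBounded N)
    {w₀ : C01} {q₀ : L2} (h₀ : IsLap w₀ q₀) {R : ℝ} (hR : 0 ≤ R) {T : ℝ} (hT : 0 ≤ T) :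
    ∃ w : ℝ → C01, Continuous w ∧ IsMild p (fun u => N (clampC R u)) w₀ T w := by
  obtain ⟨M, hM, h⟩ := hN R
  refine exists_isMild_of_lipschitz hp hM (fun u v => ?_) h₀ hT
  refine (h _ _ (norm_clampC_le hR u) (norm_clampC_le hR v)).trans ?_
  exact mul_le_mul_of_nonneg_left (norm_clampC_sub_le R u v) hM

theorem lipOnBounded_truncated {N : C01 → L2} (hN : LipOnBounded N) {R : ℝ} (hR : 0 ≤ R) :
    LipOnBounded fun u => N (clampC R u) := by
  obtain ⟨M, hM, h⟩ := hN R
  refine fun _ => ⟨M, hM, fun u v _ _ => ?_⟩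
  refine (h _ _ (norm_clampC_le hR u) (norm_clampC_le hR v)).trans ?_
  exact mul_le_mul_of_nonneg_left (norm_clampC_sub_le R u v) hM

theorem IsMild.initial {p : ℝ} {N : C01 → L2} {w₀ : C01} {T : ℝ} {w : ℝ → C01}
    (h : IsMild p N w₀ T w) (hT : 0 ≤ T) : w 0 = w₀ := by
  refine toL2_injective (ext_coef fun n => ?_)
  rw [h.coef_eq 0 ⟨le_rfl, hT⟩ n]
  simp [duh]

/-- Local existence of mild solutions. -/
theorem exists_isMild {p : ℝ} (hp : 0 < p) {N : C01 → L2} (hN : LipOnBounded N)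
    {w₀ : C01} {q₀ : L2} (h₀ : IsLap w₀ q₀) :
    ∃ T : ℝ, 0 < T ∧ ∃ w : ℝ → C01, IsMild p N w₀ T w := by
  obtain ⟨w, hwc, hw⟩ := exists_isMild_truncated hp hN h₀ (R := ‖w₀‖ + 1) (by positivity)
    zero_le_one
  have h1 : ∀ᶠ t in 𝓝 (0 : ℝ), ‖w t‖ < ‖w₀‖ + 1 := by
    refine (hwc.norm.tendsto 0).eventually_lt_const ?_
    rw [hw.initial zero_le_one]
    linarith
  obtain ⟨ε, hε, hball⟩ := Metric.eventually_nhds_iff.1 h1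
  refine ⟨min (ε / 2) 1, by positivity, w, (hw.mono (min_le_right _ _)).congr (fun _ _ => rfl)
    fun t ht => ?_⟩
  have h2 : ‖w t‖ < ‖w₀‖ + 1 := hball (by
    rw [Real.dist_eq, sub_zero, abs_of_nonneg ht.1]
    have := ht.2.trans (min_le_left _ _)
    linarith)
  rw [clampC_of_norm_le h2.le]

/-- A bounded mild solution on `[0,T)` extends beyond `T`. -/
theorem exists_isMild_extension {p : ℝ} (hp : 0 < p) {N : C01 → L2} (hN : LipOnBounded N)
    {w₀ : C01} {q₀ : L2} (h₀ : IsLap w₀ q₀) {T : ℝ} (hT : 0 < T) {w : ℝ → C01}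
    (hw : ∀ T' < T, IsMild p N w₀ T' w) {R : ℝ} (hR : ∀ t, 0 ≤ t → t < T → ‖w t‖ ≤ R) :
    ∃ T₁ > T, ∃ v : ℝ → C01, IsMild p N w₀ T₁ v := by
  have hR0 : 0 ≤ R := (norm_nonneg _).trans (hR 0 le_rfl hT)
  have hR1 : 0 ≤ R + 1 := by positivity
  -- Truncation at `R + 1` leaves room: `v` agrees with `w` before `T`, so `‖v T‖ ≤ R`, and the
  -- truncation is still inactive shortly after `T`.
  obtain ⟨v, hvc, hv⟩ := exists_isMild_truncated hp hN h₀ hR1 (T := T + 1) (by positivity)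
  have heq : ∀ t, 0 ≤ t → t < T → w t = v t := by
    intro t ht0 htT
    have hw' : IsMild p (fun u => N (clampC (R + 1) u)) w₀ t w :=
      (hw t htT).congr (fun _ _ => rfl) fun s hs => by
        rw [clampC_of_norm_le ((hR s hs.1 (hs.2.trans_lt htT)).trans (by linarith))]
    exact hw'.eq hp (lipOnBounded_truncated hN hR1) (hv.mono (by linarith)) t ⟨ht0, le_rfl⟩
  have hvT : ‖v T‖ ≤ R := by
    have h1 : Tendsto (fun t => ‖v t‖) (𝓝[<] T) (𝓝 ‖v T‖) :=
      (hvc.norm.tendsto T).mono_left nhdsWithin_le_nhds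
    refine le_of_tendsto h1 ?_
    filter_upwards [Ioo_mem_nhdsLT hT] with t ht
    rw [← heq t ht.1.le ht.2]
    exact hR t ht.1.le ht.2
  have h1 : ∀ᶠ t in 𝓝 T, ‖v t‖ < R + 1 :=
    (hvc.norm.tendsto T).eventually_lt_const (by linarith)
  obtain ⟨ε, hε, hball⟩ := Metric.eventually_nhds_iff.1 h1
  have hm : 0 < min (ε / 2) 1 := by positivity
  refine ⟨T + min (ε / 2) 1, by linarith, v,
    (hv.mono (by linarith [min_le_right (ε / 2) 1])).congr (fun _ _ => rfl) fun t ht => ?_⟩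
  rw [clampC_of_norm_le]
  rcases lt_or_ge t T with h | h
  · rw [← heq t ht.1 h]
    linarith [hR t ht.1 h]
  · refine (hball ?_).le
    rw [Real.dist_eq, abs_of_nonneg (by linarith)]
    linarith [ht.2, min_le_left (ε / 2) 1]

/-! ### Regularity in time -/

theorem sq_add_three_le (x y z : ℝ) : (x + y + z) ^ 2 ≤ 3 * (x ^ 2 + y ^ 2 + z ^ 2) := by
  nlinarith [sq_nonneg (x - y), sq_nonneg (y - z), sq_nonneg (x - z)]

theorem sq_one_sub_exp_neg_le {x : ℝ} (hx : 0 ≤ x) : (Real.exp (-x) - 1) ^ 2 ≤ x := by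
  have h1 : Real.exp (-x) ≤ 1 := Real.exp_le_one_iff.2 (by linarith)
  have h2 := Real.exp_pos (-x)
  have h3 := Real.add_one_le_exp (-x)
  nlinarith

theorem mul_exp_neg_le_one (x : ℝ) : x * Real.exp (-x) ≤ 1 := by
  have h1 := Real.add_one_le_exp x
  have h2 := Real.exp_pos (-x)
  calc x * Real.exp (-x) ≤ Real.exp x * Real.exp (-x) := by gcongr; linarith
    _ = 1 := by rw [← Real.exp_add]; simp

/-- The nonlinear term along a mild solution is Hölder continuous of order `1/2` in time. -/
theorem IsMild.exists_norm_sq_sub_le {p : ℝ} (hp : 0 < p) {N : C01 → L2} (hN : LipOnBounded N)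
    {w₀ : C01} {q₀ : L2} (h₀ : IsLap w₀ q₀) {T : ℝ} {w : ℝ → C01} (hwc : Continuous w)
    (hw : IsMild p N w₀ T w) :
    ∃ C : ℝ, 0 ≤ C ∧ ∀ s ∈ Icc 0 T, ∀ t ∈ Icc s T, ‖N (w t) - N (w s)‖ ^ 2 ≤ C * (t - s) := by
  obtain ⟨R, hR⟩ := exists_norm_le_of_continuousOn hw.continuousOn
  obtain ⟨M, hM, hMN⟩ := hN R
  have hfc : Continuous fun s => N (w s) := hN.continuous.comp hwc
  obtain ⟨B, hB⟩ := exists_norm_le_of_continuousOn (T := T) hfc.continuousOn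
  have hE := embConst_nonneg
  set K : ℝ := embConst * (3 * ((2 * p)⁻¹ * M ^ 2)) with hK
  set A : ℝ := embConst * (3 * (p * ‖q₀‖ ^ 2 + (2 * p)⁻¹ * B ^ 2)) with hA
  have hK0 : 0 ≤ K := by positivity
  have hA0 : 0 ≤ A := by positivity
  refine ⟨M ^ 2 * (A * Real.exp (K * T)), by positivity, fun s hs t ht => ?_⟩
  set h : ℝ := t - s with hh
  have hh0 : 0 ≤ h := sub_nonneg.2 ht.1
  have hsT : s ∈ Icc 0 (T - h) := ⟨hs.1, by linarith [ht.2]⟩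
  have hφc : Continuous fun r => ‖w (r + h) - w r‖ ^ 2 := by fun_prop
  have hdc : Continuous fun r => N (w (r + h)) - N (w r) :=
    (hfc.comp (continuous_add_const h)).sub hfc
  have key : ∀ r ∈ Icc 0 (T - h), ‖w (r + h) - w r‖ ^ 2 ≤
      A * h + K * ∫ x in (0 : ℝ)..r, ‖w (x + h) - w x‖ ^ 2 := by
    intro r hr
    have hrh : r + h ∈ Icc 0 T := ⟨by linarith [hr.1], by linarith [hr.2]⟩
    have hrT : r ∈ Icc 0 T := ⟨hr.1, by linarith [hr.2]⟩
    have hhT : h ≤ T := by linarith [hr.1, hr.2]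
    -- By the semigroup law, with `S` the semigroup, `w(r+h) - w(r)` is `S(r)(w(h) - w₀)` plus the
    -- Duhamel integral of the increment of `N(w)`. The former is of size `√h`; the latter is left
    -- to Gronwall.
    have hcoef : ∀ n, coef n (toL2 (w (r + h) - w r)) = Real.exp (-(p * lam n) * r) *
        (((Real.exp (-(p * lam n * h)) - 1) * coef n (toL2 w₀)) + duh p (fun s => N (w s)) n h) +
        duh p (fun x => N (w (x + h)) - N (w x)) n r := by
      intro n
      have e : Real.exp (-(p * lam n) * (r + h)) =
          Real.exp (-(p * lam n) * r) * Real.exp (-(p * lam n * h)) := by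
        rw [← Real.exp_add]; congr 1; ring
      rw [duh_sub (f := fun x => N (w (x + h))) hr.1
        (hfc.comp (continuous_add_const h)).continuousOn hfc.continuousOn, toL2_sub, map_sub,
        hw.coef_eq _ hrh, hw.coef_eq _ hrT, duh_add hfc, e]
      ring
    have hint : ∫ x in (0 : ℝ)..r, ‖N (w (x + h)) - N (w x)‖ ^ 2 ≤
        M ^ 2 * ∫ x in (0 : ℝ)..r, ‖w (x + h) - w x‖ ^ 2 := by
      rw [← intervalIntegral.integral_const_mul]
      refine intervalIntegral.integral_mono_on hr.1 ((hdc.norm.pow 2).intervalIntegrable _ _)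
        ((hφc.const_mul _).intervalIntegrable _ _) fun x hx => ?_
      rw [← mul_pow]
      refine pow_le_pow_left₀ (norm_nonneg _) (hMN _ _ (hR _ ⟨?_, ?_⟩) (hR _ ⟨hx.1, ?_⟩)) 2
      · linarith [hx.1]
      · linarith [hx.2, hr.2]
      · linarith [hx.2, hr.2]
    have hint2 : ∫ x in (0 : ℝ)..h, ‖N (w x)‖ ^ 2 ≤ B ^ 2 * h := by
      refine (intervalIntegral.integral_mono_on hh0 ((hfc.norm.pow 2).intervalIntegrable _ _)
        (g := fun _ => B ^ 2) (by simp) fun x hx => ?_).trans (by simp [mul_comm])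
      exact pow_le_pow_left₀ (norm_nonneg _) (hB x ⟨hx.1, hx.2.trans hhT⟩) 2
    have hmain := norm_sq_le_of_sum_le (w := w (r + h) - w r)
      (B := 3 * (p * h * ‖q₀‖ ^ 2 + (2 * p)⁻¹ * (B ^ 2 * h) +
        (2 * p)⁻¹ * (M ^ 2 * ∫ x in (0 : ℝ)..r, ‖w (x + h) - w x‖ ^ 2))) (fun S => by
      -- Here `w₀` must lie in the domain of the Laplacian: `(exp (-x) - 1)² ≤ x` produces a second
      -- factor `λ`, and `λ² coef(w₀)² = coef(q₀)²`.
      have h1 : ∑ n ∈ S, lam n * ((Real.exp (-(p * lam n * h)) - 1) * coef n (toL2 w₀)) ^ 2 ≤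
          p * h * ‖q₀‖ ^ 2 := by
        refine le_trans ?_ (mul_le_mul_of_nonneg_left (sum_sq_coef_le q₀ S) (by positivity))
        rw [Finset.mul_sum]
        refine Finset.sum_le_sum fun n _ => ?_
        have hl := lam_pos n
        have := sq_one_sub_exp_neg_le (x := p * lam n * h) (by positivity)
        rw [h₀ n, mul_pow, mul_pow, neg_sq]
        calc lam n * ((Real.exp (-(p * lam n * h)) - 1) ^ 2 * coef n (toL2 w₀) ^ 2) ≤
              lam n * (p * lam n * h * coef n (toL2 w₀) ^ 2) := by gcongr
          _ = _ := by ring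
      have h2 := (sum_lam_mul_sq_duh_le hp hh0 hfc.continuousOn S).trans
        (mul_le_mul_of_nonneg_left hint2 (by positivity))
      have h3 := (sum_lam_mul_sq_duh_le hp hr.1 hdc.continuousOn S).trans
        (mul_le_mul_of_nonneg_left hint (by positivity))
      refine le_trans ?_ (mul_le_mul_of_nonneg_left (add_le_add (add_le_add h1 h2) h3)
        zero_le_three)
      rw [← Finset.sum_add_distrib, ← Finset.sum_add_distrib, Finset.mul_sum]
      refine Finset.sum_le_sum fun n _ => ?_
      rw [hcoef, ← mul_add, ← mul_add, mul_left_comm]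
      refine mul_le_mul_of_nonneg_left ?_ (lam_pos n).le
      have e1 : Real.exp (-(p * lam n) * r) ^ 2 ≤ 1 := by
        refine pow_le_one₀ (Real.exp_pos _).le (Real.exp_le_one_iff.2 ?_)
        have := mul_nonneg (mul_pos hp (lam_pos n)).le hr.1
        linarith
      generalize Real.exp (-(p * lam n) * r) = E at e1 ⊢
      rw [mul_add]
      refine (sq_add_three_le _ _ _).trans ?_
      rw [mul_pow E, mul_pow E]
      gcongr
      · exact mul_le_of_le_one_left (sq_nonneg _) e1
      · exact mul_le_of_le_one_left (sq_nonneg _) e1)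
    refine hmain.trans (le_of_eq ?_)
    rw [hA, hK]
    ring
  have h1 := gronwall_integral hφc.continuousOn hK0 key s hsT
  have h2 : s + h = t := by rw [hh]; ring
  rw [h2] at h1
  have h3 : ‖N (w t) - N (w s)‖ ^ 2 ≤ M ^ 2 * ‖w t - w s‖ ^ 2 := by
    rw [← mul_pow]
    exact pow_le_pow_left₀ (norm_nonneg _) (hMN _ _ (hR _ ⟨hs.1.trans ht.1, ht.2⟩) (hR _ hs)) 2
  refine h3.trans ?_
  rw [mul_assoc]
  refine mul_le_mul_of_nonneg_left (h1.trans ?_) (sq_nonneg M)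
  have : Real.exp (K * s) ≤ Real.exp (K * T) :=
    Real.exp_le_exp.2 (mul_le_mul_of_nonneg_left hs.2 hK0)
  calc A * h * Real.exp (K * s) ≤ A * h * Real.exp (K * T) := by gcongr
    _ = _ := by ring

/-- A curve in `L²(0,1)` is continuous if its sine coefficients are continuous and square summable
with uniformly small tails. -/
theorem exists_continuousOn_of_tail {z : ℕ → ℝ → ℝ} {S : Set ℝ} (hz : ∀ n, ContinuousOn (z n) S)
    {ε : ℕ → ℝ} (hε : Tendsto ε atTop (𝓝 0))
    (h : ∀ t ∈ S, ∀ m, ∀ s : Finset ℕ, (∀ n ∈ s, m ≤ n) → ∑ n ∈ s, z n t ^ 2 ≤ ε m) :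
    ∃ Z : ℝ → L2, ContinuousOn Z S ∧ ∀ t ∈ S, ∀ n, coef n (Z t) = z n t := by
  have hex : ∀ t, ∃ f : L2, t ∈ S → ∀ n, coef n f = z n t := by
    intro t
    by_cases ht : t ∈ S
    · obtain ⟨f, hf⟩ := exists_coef_eq (a := fun n => z n t)
        (summable_of_sum_le (fun _ => sq_nonneg _) fun s => h t ht 0 s fun _ _ => Nat.zero_le _)
      exact ⟨f, fun _ => hf⟩
    · exact ⟨0, fun h' => absurd h' ht⟩
  choose Z hZ using hex
  refine ⟨Z, ?_, hZ⟩
  -- The tail bound is uniform in `t`, so the partial sums, which are continuous, converge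
  -- uniformly.
  have hd : ∀ m, ∀ t ∈ S, ‖Z t - ∑ n ∈ Finset.range m, z n t • sinL n‖ ^ 2 ≤ ε m := by
    intro m t ht
    have hc : ∀ n, coef n (Z t - ∑ i ∈ Finset.range m, z i t • sinL i) =
        if m ≤ n then z n t else 0 := by
      intro n
      rw [map_sub, hZ t ht, map_sum]
      simp_rw [map_smul, coef_sinL, smul_eq_mul, mul_ite, mul_one, mul_zero]
      rw [Finset.sum_ite_eq]
      simp only [Finset.mem_range]
      split_ifs with h1 h2 h2
      · omega
      · ring
      · ring
      · omega
    refine hasSum_le_of_sum_le (hasSum_sq_coef _) fun s => ?_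
    simp_rw [hc]
    have : ∑ n ∈ s, (if m ≤ n then z n t else 0) ^ 2 = ∑ n ∈ s with m ≤ n, z n t ^ 2 := by
      rw [Finset.sum_filter]
      refine Finset.sum_congr rfl fun n _ => ?_
      split_ifs <;> simp
    rw [this]
    exact h t ht m _ fun n hn => (Finset.mem_filter.1 hn).2
  have hu : TendstoUniformlyOn (fun m t => ∑ n ∈ Finset.range m, z n t • sinL n) Z atTop S := by
    rw [Metric.tendstoUniformlyOn_iff]
    intro δ hδ
    filter_upwards [hε.eventually_lt_const (pow_pos hδ 2)] with m hm t ht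
    rw [dist_eq_norm]
    exact lt_of_pow_lt_pow_left₀ 2 hδ.le ((hd m t ht).trans_lt hm)
  exact hu.continuousOn (Frequently.of_forall fun m =>
    continuousOn_finsetSum _ fun n _ => (hz n).smul continuousOn_const)

/-- The kernel `p λₙ exp (-p λₙ (t - s))` is not integrable uniformly in `n` with the supremum
inside. Half of its exponent yields the factor `2 / (t - s)`, compensated by the Hölder bound `‖d
s‖² ≤ C (t - s)`. The other half is at most `exp (-p λₘ (t - s) / 2)`, whose integral gives the
decay in `m`. -/
theorem sum_sq_lam_mul_duh_le {p : ℝ} (hp : 0 < p) {d : ℝ → L2} (hd : Continuous d) {C t : ℝ}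
    (hC : 0 ≤ C) (ht : 0 ≤ t) (hdC : ∀ s ∈ Icc 0 t, ‖d s‖ ^ 2 ≤ C * (t - s)) {m : ℕ}
    {S : Finset ℕ} (hS : ∀ n ∈ S, m ≤ n) :
    ∑ n ∈ S, (p * lam n * duh p d n t) ^ 2 ≤ 4 * C / p * (lam m)⁻¹ := by
  have hdn : ∀ n, Continuous fun s => coef n (d s) := fun n => (coef n).continuous.comp hd
  have hi : ∀ n, Continuous fun s => p * lam n * (Real.exp (-(p * lam n) * (t - s)) *
      coef n (d s) ^ 2) := fun n => by have := hdn n; fun_prop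
  have h1 : ∀ n, (p * lam n * duh p d n t) ^ 2 ≤
      ∫ s in (0 : ℝ)..t, p * lam n * (Real.exp (-(p * lam n) * (t - s)) * coef n (d s) ^ 2) := by
    intro n
    have hl := lam_pos n
    have hpl : 0 < p * lam n := by positivity
    -- The kernel is shared equally between the two factors, so one exponential still accompanies
    -- `coef n (d s) ^ 2`.
    have hCS := sq_intervalIntegral_mul_le (a := 0) (b := t)
      (f := fun s => Real.exp (-(p * lam n) * (t - s) / 2))
      (g := fun s => Real.exp (-(p * lam n) * (t - s) / 2) * coef n (d s)) ht
      (by fun_prop) (by have := hdn n; fun_prop)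
    have e1 : ∀ s, Real.exp (-(p * lam n) * (t - s) / 2) ^ 2 =
        Real.exp (-(p * lam n) * (t - s)) := fun s => by
      rw [← Real.exp_nat_mul]; congr 1; push_cast; ring
    have e2 : ∀ s, Real.exp (-(p * lam n) * (t - s) / 2) *
        (Real.exp (-(p * lam n) * (t - s) / 2) * coef n (d s)) =
        Real.exp (-(p * lam n) * (t - s)) * coef n (d s) := fun s => by
      rw [← e1]; ring
    simp_rw [mul_pow, e1, e2] at hCS
    rw [intervalIntegral.integral_const_mul, mul_pow]
    calc (p * lam n) ^ 2 * duh p d n t ^ 2 ≤ (p * lam n) ^ 2 * ((p * lam n)⁻¹ *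
          ∫ s in (0 : ℝ)..t, Real.exp (-(p * lam n) * (t - s)) * coef n (d s) ^ 2) := by
          refine mul_le_mul_of_nonneg_left (hCS.trans ?_) (sq_nonneg _)
          refine mul_le_mul_of_nonneg_right (integral_exp_le hpl t) ?_
          exact intervalIntegral.integral_nonneg ht fun s _ => by positivity
      _ = _ := by field_simp
  refine (Finset.sum_le_sum fun n _ => h1 n).trans ?_
  rw [← intervalIntegral.integral_finsetSum fun n _ => (hi n).intervalIntegrable _ _]
  have hlm := lam_pos m
  have h2 : ∀ s ∈ Icc 0 t, ∑ n ∈ S, p * lam n * (Real.exp (-(p * lam n) * (t - s)) *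
      coef n (d s) ^ 2) ≤ 2 * C * Real.exp (-(p * lam m / 2) * (t - s)) := by
    intro s hs
    have hτ : 0 ≤ t - s := by linarith [hs.2]
    -- At `s = t` the factor `2 / (t - s)` is meaningless, but there `d` vanishes.
    rcases hτ.eq_or_lt with h0 | hpos
    · have h3 := hdC s hs
      rw [← h0, mul_zero] at h3
      have h4 : d s = 0 := by
        have := (pow_eq_zero_iff two_ne_zero).1 (le_antisymm h3 (sq_nonneg _))
        exact norm_eq_zero.1 this
      simp only [h4, map_zero, ne_eq, OfNat.ofNat_ne_zero, not_false_eq_true, zero_pow, mul_zero,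
        Finset.sum_const_zero]
      positivity
    · have h3 : ∀ n ∈ S, p * lam n * (Real.exp (-(p * lam n) * (t - s)) * coef n (d s) ^ 2) ≤
          2 / (t - s) * Real.exp (-(p * lam m / 2) * (t - s)) * coef n (d s) ^ 2 := by
        intro n hn
        have hle : lam m ≤ lam n := lam_mono (hS n hn)
        rw [← mul_assoc]
        refine mul_le_mul_of_nonneg_right ?_ (sq_nonneg _)
        have e1 : Real.exp (-(p * lam n) * (t - s)) = Real.exp (-(p * lam n * (t - s) / 2)) *
            Real.exp (-(p * lam n / 2) * (t - s)) := by
          rw [← Real.exp_add]; congr 1; ring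
        have e2 : Real.exp (-(p * lam n / 2) * (t - s)) ≤
            Real.exp (-(p * lam m / 2) * (t - s)) := by
          refine Real.exp_le_exp.2 (mul_le_mul_of_nonneg_right ?_ hτ)
          have := mul_le_mul_of_nonneg_left hle hp.le
          linarith
        have e3 := mul_exp_neg_le_one (p * lam n * (t - s) / 2)
        have e4 : p * lam n * Real.exp (-(p * lam n * (t - s) / 2)) ≤ 2 / (t - s) := by
          rw [le_div_iff₀ hpos]
          linarith
        rw [e1, ← mul_assoc]
        exact mul_le_mul e4 e2 (Real.exp_pos _).le (by positivity)
      refine (Finset.sum_le_sum h3).trans ?_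
      rw [← Finset.mul_sum]
      calc 2 / (t - s) * Real.exp (-(p * lam m / 2) * (t - s)) * ∑ n ∈ S, coef n (d s) ^ 2 ≤
            2 / (t - s) * Real.exp (-(p * lam m / 2) * (t - s)) * (C * (t - s)) := by
            gcongr
            exact (sum_sq_coef_le _ _).trans (hdC s hs)
        _ = _ := by field_simp
  refine (intervalIntegral.integral_mono_on ht
    ((continuous_finsetSum _ fun n _ => hi n).intervalIntegrable _ _)
    (Continuous.intervalIntegrable (by fun_prop) _ _) h2).trans ?_
  rw [intervalIntegral.integral_const_mul]
  calc 2 * C * ∫ s in (0 : ℝ)..t, Real.exp (-(p * lam m / 2) * (t - s)) ≤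
        2 * C * (p * lam m / 2)⁻¹ := by
        gcongr
        exact integral_exp_le (by positivity) t
    _ = _ := by field_simp; ring

theorem duh_const (p : ℝ) (e : L2) (n : ℕ) (t : ℝ) :
    p * lam n * duh p (fun _ => e) n t = (1 - Real.exp (-(p * lam n) * t)) * coef n e := by
  have hd : ∀ s ∈ uIcc 0 t, HasDerivAt (fun s => Real.exp (-(p * lam n) * (t - s)) * coef n e)
      (p * lam n * (Real.exp (-(p * lam n) * (t - s)) * coef n e)) s := by
    intro s _
    have h := ((((hasDerivAt_id s).const_sub t).const_mul (-(p * lam n))).exp).mul_const (coef n e)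
    refine h.congr_deriv ?_
    simp only [id]
    ring
  rw [duh, ← intervalIntegral.integral_const_mul, intervalIntegral.integral_eq_sub_of_hasDerivAt hd
    (Continuous.intervalIntegrable (by fun_prop) _ _)]
  simp
  ring

theorem tendsto_inv_lam : Tendsto (fun n => (lam n)⁻¹) atTop (𝓝 0) :=
  summable_inv_lam.tendsto_atTop_zero

/-- The derivatives `z n` of the coefficients of `w` are the coefficients of a continuous curve in
`L²`, by the uniform tail criterion. The Laplacian of `w` is then read off from the equation. -/
theorem IsMild.regularity_of_continuous {p : ℝ} (hp : 0 < p) {N : C01 → L2} (hN : LipOnBounded N)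
    {w₀ : C01} {q₀ : L2} (h₀ : IsLap w₀ q₀) {T : ℝ} (hT : 0 ≤ T) {w : ℝ → C01}
    (hwc : Continuous w) (hw : IsMild p N w₀ T w) :
    ∃ q : ℝ → L2, ContinuousOn q (Icc 0 T) ∧ (∀ t ∈ Icc 0 T, IsLap (w t) (q t)) ∧
      ∀ t ∈ Icc 0 T, HasDerivWithinAt (fun s => toL2 (w s)) (p • q t + N (w t)) (Icc 0 T) t := by
  obtain ⟨C, hC, hHol⟩ := hw.exists_norm_sq_sub_le hp hN h₀ hwc
  have hfc : Continuous fun s => N (w s) := hN.continuous.comp hwc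
  have h0T : (0 : ℝ) ∈ Icc 0 T := ⟨le_rfl, hT⟩
  set z : ℕ → ℝ → ℝ := fun n t => -(p * lam n) * (Real.exp (-(p * lam n) * t) * coef n (toL2 w₀) +
    duh p (fun s => N (w s)) n t) + coef n (N (w t)) with hz
  have hzc : ∀ n, Continuous (z n) := fun n => by
    have h1 := continuous_duh (p := p) (n := n) hfc
    have h2 : Continuous fun t => coef n (N (w t)) := (coef n).continuous.comp hfc
    rw [hz]
    fun_prop
  have hzd : ∀ n t, HasDerivAt (fun t => Real.exp (-(p * lam n) * t) * coef n (toL2 w₀) +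
      duh p (fun s => N (w s)) n t) (z n t) t := by
    intro n t
    have h1 := (((hasDerivAt_id t).const_mul (-(p * lam n))).exp).mul_const (coef n (toL2 w₀))
    refine (h1.add (hasDerivAt_duh hfc)).congr_deriv ?_
    rw [hz]
    simp only [id]
    ring
  set g : L2 := p • q₀ + N (w 0) with hg
  -- The source is frozen at its value at time `t`. Its constant part is integrated explicitly and
  -- cancels against `N(w t)`, leaving the initial velocity `g`, the increment since time `0`, and a
  -- Duhamel integral whose source vanishes at `s = t`.
  have hzeq : ∀ t ∈ Icc 0 T, ∀ n, z n t = Real.exp (-(p * lam n) * t) * coef n g +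
      Real.exp (-(p * lam n) * t) * coef n (N (w t) - N (w 0)) +
      -(p * lam n * duh p (fun s => N (w s) - N (w t)) n t) := by
    intro t ht n
    have h1 := duh_const p (N (w t)) n t
    rw [duh_sub ht.1 hfc.continuousOn continuousOn_const, mul_sub, h1, hg, map_add, map_smul,
      map_sub, h₀ n, hz, smul_eq_mul]
    ring
  set G : ℕ → ℝ := fun m => ∑' n, coef (n + m) g ^ 2 with hG
  have hG0 : Tendsto G atTop (𝓝 0) := tendsto_sum_nat_add fun n => coef n g ^ 2
  have hGle : ∀ m (S : Finset ℕ), (∀ n ∈ S, m ≤ n) → ∑ n ∈ S, coef n g ^ 2 ≤ G m := by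
    intro m S hS
    have h1 : Summable fun n => coef (n + m) g ^ 2 :=
      (summable_nat_add_iff m).2 (summable_sq_coef g)
    have h2 := h1.sum_le_tsum (S.image fun n => n - m) fun _ _ => sq_nonneg _
    rw [Finset.sum_image fun a ha b hb hab => by
      have := hS a ha; have := hS b hb; omega] at h2
    refine le_trans (le_of_eq (Finset.sum_congr rfl fun n hn => ?_)) h2
    rw [Nat.sub_add_cancel (hS n hn)]
  obtain ⟨Z, hZc, hZ⟩ := exists_continuousOn_of_tail (z := z) (S := Icc 0 T)
    (fun n => (hzc n).continuousOn)
    (ε := fun m => 3 * (G m + C / (2 * p) * (lam m)⁻¹ + 4 * C / p * (lam m)⁻¹))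
    (by
      have := ((hG0.add (tendsto_inv_lam.const_mul (C / (2 * p)))).add
        (tendsto_inv_lam.const_mul (4 * C / p))).const_mul 3
      simpa using this)
    (fun t ht m S hS => by
      have hexp : ∀ n, Real.exp (-(p * lam n) * t) ^ 2 ≤ 1 := fun n => by
        refine pow_le_one₀ (Real.exp_pos _).le (Real.exp_le_one_iff.2 ?_)
        have := mul_nonneg (mul_pos hp (lam_pos n)).le ht.1
        linarith
      have h1 : ∑ n ∈ S, (Real.exp (-(p * lam n) * t) * coef n g) ^ 2 ≤ G m := by
        refine le_trans (Finset.sum_le_sum fun n _ => ?_) (hGle m S hS)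
        rw [mul_pow]
        exact mul_le_of_le_one_left (sq_nonneg _) (hexp n)
      -- The Hölder bound supplies a factor `t`, and `t exp (-2 p λₘ t) ≤ (2 p λₘ)⁻¹`: the tail is
      -- small uniformly down to `t = 0`.
      have h2 : ∑ n ∈ S, (Real.exp (-(p * lam n) * t) * coef n (N (w t) - N (w 0))) ^ 2 ≤
          C / (2 * p) * (lam m)⁻¹ := by
        have hlm := lam_pos m
        have e1 : ∀ n ∈ S, (Real.exp (-(p * lam n) * t) * coef n (N (w t) - N (w 0))) ^ 2 ≤
            Real.exp (-(2 * p * lam m * t)) * coef n (N (w t) - N (w 0)) ^ 2 := by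
          intro n hn
          rw [mul_pow, ← Real.exp_nat_mul]
          refine mul_le_mul_of_nonneg_right (Real.exp_le_exp.2 ?_) (sq_nonneg _)
          have := mul_le_mul_of_nonneg_right
            (mul_le_mul_of_nonneg_left (lam_mono (hS n hn)) hp.le) ht.1
          push_cast
          linarith
        refine (Finset.sum_le_sum e1).trans ?_
        rw [← Finset.mul_sum]
        have e2 := (sum_sq_coef_le (N (w t) - N (w 0)) S).trans (hHol 0 h0T t ht)
        rw [sub_zero] at e2
        have e3 := mul_exp_neg_le_one (2 * p * lam m * t)
        calc Real.exp (-(2 * p * lam m * t)) * ∑ n ∈ S, coef n (N (w t) - N (w 0)) ^ 2 ≤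
              Real.exp (-(2 * p * lam m * t)) * (C * t) := by gcongr
          _ = C / (2 * p) * (lam m)⁻¹ *
              (2 * p * lam m * t * Real.exp (-(2 * p * lam m * t))) := by field_simp
          _ ≤ C / (2 * p) * (lam m)⁻¹ * 1 := by gcongr
          _ = _ := mul_one _
      have h3 := sum_sq_lam_mul_duh_le hp (d := fun s => N (w s) - N (w t))
        (hfc.sub continuous_const) hC ht.1 (fun s hs => by
          rw [norm_sub_rev]
          exact hHol s ⟨hs.1, hs.2.trans ht.2⟩ t ⟨hs.2, ht.2⟩) hS
      refine le_trans ?_ (mul_le_mul_of_nonneg_left (add_le_add (add_le_add h1 h2) h3)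
        zero_le_three)
      rw [← Finset.sum_add_distrib, ← Finset.sum_add_distrib, Finset.mul_sum]
      refine Finset.sum_le_sum fun n _ => ?_
      rw [hzeq t ht n, ← neg_sq (p * lam n * _)]
      exact sq_add_three_le _ _ _)
  have hqc : ContinuousOn (fun t => p⁻¹ • (Z t - N (w t))) (Icc 0 T) :=
    (hZc.sub hfc.continuousOn).const_smul p⁻¹
  refine ⟨_, hqc, fun t ht n => ?_, fun t ht => ?_⟩
  · rw [map_smul, map_sub, hZ t ht, hw.coef_eq t ht, hz, smul_eq_mul]
    field_simp
    ring
  · rw [smul_inv_smul₀ hp.ne', sub_add_cancel]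
    set Y : ℝ → L2 := IccExtend hT ((Icc 0 T).domRestrict Z) with hY
    have hYc : Continuous Y := hZc.domRestrict.Icc_extend'
    have hYe : ∀ s ∈ Icc 0 T, Y s = Z s := fun s hs => IccExtend_of_mem _ _ hs
    have h1 : HasDerivAt (fun s => toL2 w₀ + ∫ r in (0 : ℝ)..s, Y r) (Z t) t := by
      rw [← hYe t ht]
      exact (hYc.integral_hasStrictDerivAt 0 t).hasDerivAt.const_add _
    -- Differentiability in `L²` follows from an integral representation with continuous integrand,
    -- which may be checked on each coefficient.
    have h2 : ∀ s ∈ Icc 0 T, toL2 (w s) = toL2 w₀ + ∫ r in (0 : ℝ)..s, Y r := by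
      intro s hs
      refine ext_coef fun n => ?_
      rw [map_add, ← ContinuousLinearMap.intervalIntegral_comp_comm _
        (hYc.intervalIntegrable _ _)]
      have h3 : ∫ r in (0 : ℝ)..s, coef n (Y r) = ∫ r in (0 : ℝ)..s, z n r :=
        intervalIntegral.integral_congr fun r hr => by
          rw [uIcc_of_le hs.1] at hr
          have hr' : r ∈ Icc 0 T := ⟨hr.1, hr.2.trans hs.2⟩
          simp only [hYe r hr', hZ r hr']
      rw [h3, intervalIntegral.integral_eq_sub_of_hasDerivAt (fun r _ => hzd n r)
        ((hzc n).intervalIntegrable _ _), hw.coef_eq s hs]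
      simp [duh]
    exact h1.hasDerivWithinAt.congr h2 (h2 t ht)

/-- A mild solution starting in the domain of the Dirichlet Laplacian is a strict solution. -/
theorem IsMild.regularity {p : ℝ} (hp : 0 < p) {N : C01 → L2} (hN : LipOnBounded N)
    {w₀ : C01} {q₀ : L2} (h₀ : IsLap w₀ q₀) {T : ℝ} (hT : 0 ≤ T) {w : ℝ → C01}
    (hw : IsMild p N w₀ T w) :
    ∃ q : ℝ → L2, ContinuousOn q (Icc 0 T) ∧ (∀ t ∈ Icc 0 T, IsLap (w t) (q t)) ∧
      ∀ t ∈ Icc 0 T, HasDerivWithinAt (fun s => toL2 (w s)) (p • q t + N (w t)) (Icc 0 T) t := by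
  set v : ℝ → C01 := IccExtend hT ((Icc 0 T).domRestrict w) with hv
  have hvc : Continuous v := hw.continuousOn.domRestrict.Icc_extend'
  have hve : ∀ s ∈ Icc 0 T, v s = w s := fun s hs => IccExtend_of_mem _ _ hs
  obtain ⟨q, hqc, hq, hd⟩ := (hw.congr hve fun _ _ => rfl).regularity_of_continuous hp hN h₀ hT hvc
  refine ⟨q, hqc, fun t ht => hve t ht ▸ hq t ht, fun t ht => ?_⟩
  have h1 := hd t ht
  rw [hve t ht] at h1
  exact h1.congr (fun s hs => by rw [hve s hs]) (by rw [hve t ht])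

/-! ### Contractivity of the heat semigroup in the sup-norm -/

theorem sinFun_neg (n : ℕ) (x : ℝ) : sinFun n (-x) = -sinFun n x := by
  simp [sinFun]

theorem sinFun_add_two_mul (n : ℕ) (x : ℝ) (k : ℤ) : sinFun n (x + 2 * k) = sinFun n x := by
  have : freq n * (x + 2 * k) = freq n * x + (((n + 1 : ℕ) * k : ℤ) : ℝ) * (2 * Real.pi) := by
    rw [freq]; push_cast; ring
  rw [sinFun, sinFun, this, Real.sin_add_int_mul_two_pi]

theorem sinFun_add_add_sinFun_sub (n : ℕ) (x h : ℝ) :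
    sinFun n (x + h) + sinFun n (x - h) = 2 * (Real.cos (freq n * h) * sinFun n x) := by
  rw [sinFun, sinFun, sinFun, mul_add, mul_sub, Real.sin_add, Real.sin_sub]
  ring

/-- Sine sums are odd and `2`-periodic, so a bound on `[0,1]` spreads to the whole line. -/
theorem abs_sum_sinFun_le {c : ℕ → ℝ} {S : Finset ℕ} {R : ℝ}
    (h : ∀ x ∈ Icc (0 : ℝ) 1, |∑ n ∈ S, c n * sinFun n x| ≤ R) (x : ℝ) :
    |∑ n ∈ S, c n * sinFun n x| ≤ R := by
  have h1 : ∀ y ∈ Icc (-1 : ℝ) 1, |∑ n ∈ S, c n * sinFun n y| ≤ R := by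
    intro y hy
    rcases le_total 0 y with h0 | h0
    · exact h y ⟨h0, hy.2⟩
    · have h2 := h (-y) ⟨by linarith, by linarith [hy.1]⟩
      simp_rw [sinFun_neg, mul_neg, Finset.sum_neg_distrib, abs_neg] at h2
      exact h2
  have h2 := h1 (x + 2 * (-⌊(x + 1) / 2⌋ : ℤ)) (by
    have h3 := Int.floor_le ((x + 1) / 2)
    have h4 := Int.lt_floor_add_one ((x + 1) / 2)
    push_cast
    constructor <;> linarith)
  simp_rw [sinFun_add_two_mul] at h2
  exact h2

/-- Multiplying the coefficients by `cos (freq n * τ)` is averaging the translates by `τ` and `-τ`,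
which cannot increase the sup-norm on `ℝ`. After `m` averages this is a simple random walk. -/
theorem abs_sum_cos_pow_mul_sinFun_le {c : ℕ → ℝ} {S : Finset ℕ} {R : ℝ}
    (h : ∀ x, |∑ n ∈ S, c n * sinFun n x| ≤ R) (τ : ℝ) (m : ℕ) (x : ℝ) :
    |∑ n ∈ S, Real.cos (freq n * τ) ^ m * c n * sinFun n x| ≤ R := by
  induction m generalizing x with
  | zero => simpa using h x
  | succ m ih =>
    have e : ∑ n ∈ S, Real.cos (freq n * τ) ^ (m + 1) * c n * sinFun n x =
        (∑ n ∈ S, Real.cos (freq n * τ) ^ m * c n * sinFun n (x + τ) +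
          ∑ n ∈ S, Real.cos (freq n * τ) ^ m * c n * sinFun n (x - τ)) / 2 := by
      rw [← Finset.sum_add_distrib, Finset.sum_div]
      refine Finset.sum_congr rfl fun n _ => ?_
      rw [← mul_add, sinFun_add_add_sinFun_sub]
      ring
    rw [e, abs_div, abs_two]
    have h1 := abs_add_le (∑ n ∈ S, Real.cos (freq n * τ) ^ m * c n * sinFun n (x + τ))
      (∑ n ∈ S, Real.cos (freq n * τ) ^ m * c n * sinFun n (x - τ))
    have h2 := ih (x + τ)
    have h3 := ih (x - τ)
    linarith

/-- The central limit theorem on the Fourier side: `m` steps of length `√(2 y / m)` have total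
variance `2 y`, that of the heat kernel at time `y`. The Taylor error of the cosine is of order
`m⁻²`, so it disappears after multiplication by `m`. -/
theorem tendsto_cos_pow {y : ℝ} (hy : 0 ≤ y) (a : ℝ) :
    Tendsto (fun m : ℕ => Real.cos (a * √(2 * y / m)) ^ m) atTop (𝓝 (Real.exp (-(y * a ^ 2)))) := by
  have hsq : ∀ m : ℕ, (a * √(2 * y / m)) ^ 2 = 2 * y * a ^ 2 / m := fun m => by
    rw [mul_pow, Real.sq_sqrt (by positivity)]; ring
  have h0 : Tendsto (fun m : ℕ => 2 * y * a ^ 2 / (m : ℝ)) atTop (𝓝 0) :=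
    tendsto_const_div_atTop_nhds_zero_nat _
  have hlim : Tendsto (fun m : ℕ => (m : ℝ) * (Real.cos (a * √(2 * y / m)) - 1)) atTop
      (𝓝 (-(y * a ^ 2))) := by
    have h1 : Tendsto (fun m : ℕ => (2 * y * a ^ 2) ^ 2 * (5 / 96) / (m : ℝ)) atTop (𝓝 0) :=
      tendsto_const_div_atTop_nhds_zero_nat _
    rw [tendsto_iff_norm_sub_tendsto_zero]
    refine squeeze_zero' (Eventually.of_forall fun _ => norm_nonneg _) ?_ h1
    filter_upwards [h0.eventually_le_const one_pos, eventually_gt_atTop 0] with m hm hm0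
    have hmR : (0 : ℝ) < m := by exact_mod_cast hm0
    have h2 : |a * √(2 * y / m)| ≤ 1 := by
      rw [← sq_le_one_iff_abs_le_one, hsq]; exact hm
    have h3 := Real.cos_bound h2
    have h4 : |a * √(2 * y / m)| ^ 4 = (2 * y * a ^ 2 / m) ^ 2 := by
      rw [← hsq, ← sq_abs (a * _)]; ring
    rw [h4, hsq] at h3
    rw [Real.norm_eq_abs]
    have e : (m : ℝ) * (Real.cos (a * √(2 * y / m)) - 1) - -(y * a ^ 2) =
        m * (Real.cos (a * √(2 * y / m)) - (1 - 2 * y * a ^ 2 / m / 2)) := by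
      field_simp; ring
    rw [e, abs_mul, abs_of_pos hmR]
    calc (m : ℝ) * |Real.cos (a * √(2 * y / m)) - (1 - 2 * y * a ^ 2 / m / 2)| ≤
          m * ((2 * y * a ^ 2 / m) ^ 2 * (5 / 96)) := by gcongr
      _ = _ := by field_simp
  have := Real.tendsto_one_add_pow_exp_of_tendsto hlim
  simpa using this

theorem norm_sum_exp_smul_sinC_le {y : ℝ} (hy : 0 ≤ y) (c : ℕ → ℝ) (S : Finset ℕ) :
    ‖∑ n ∈ S, (Real.exp (-(y * lam n)) * c n) • sinC n‖ ≤ ‖∑ n ∈ S, c n • sinC n‖ := by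
  have hval : ∀ (a : ℕ → ℝ) (x : Icc (0 : ℝ) 1), (∑ n ∈ S, a n • sinC n) x =
      ∑ n ∈ S, a n * sinFun n x := by
    intro a x
    rw [ContinuousMap.coe_sum, Finset.sum_apply]
    rfl
  have h1 := abs_sum_sinFun_le (c := c) (S := S) (R := ‖∑ n ∈ S, c n • sinC n‖) fun x hx => by
    rw [← hval c ⟨x, hx⟩]
    exact (∑ n ∈ S, c n • sinC n).norm_coe_le_norm ⟨x, hx⟩
  refine (ContinuousMap.norm_le _ (norm_nonneg _)).2 fun x => ?_
  rw [hval, Real.norm_eq_abs]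
  have h2 : Tendsto (fun m : ℕ => |∑ n ∈ S, Real.cos (freq n * √(2 * y / m)) ^ m * c n *
      sinFun n x|) atTop (𝓝 |∑ n ∈ S, Real.exp (-(y * lam n)) * c n * sinFun n x|) :=
    (tendsto_finsetSum _ fun n _ =>
      ((tendsto_cos_pow hy (freq n)).mul_const _).mul_const _).abs
  exact le_of_tendsto h2 (Eventually.of_forall fun m => abs_sum_cos_pow_mul_sinFun_le h1 _ m x)

/-- The Dirichlet heat semigroup is a contraction in the sup-norm. -/
theorem norm_le_of_coef_eq_exp_mul {y : ℝ} (hy : 0 ≤ y) {w v : C01}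
    (hw : Summable fun n => |coef n (toL2 w)|)
    (hv : ∀ n, coef n (toL2 v) = Real.exp (-(y * lam n)) * coef n (toL2 w)) : ‖v‖ ≤ ‖w‖ := by
  have hvs : Summable fun n => |coef n (toL2 v)| := by
    refine hw.of_nonneg_of_le (fun _ => abs_nonneg _) fun n => ?_
    rw [hv, abs_mul, Real.abs_exp]
    refine mul_le_of_le_one_left (abs_nonneg _) (Real.exp_le_one_iff.2 ?_)
    have := mul_nonneg hy (lam_pos n).le
    linarith
  have h1 := (hasSum_coef_smul_sinC hvs).norm
  have h2 := (hasSum_coef_smul_sinC hw).norm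
  refine le_of_tendsto_of_tendsto' h1 h2 fun S => ?_
  simp_rw [hv]
  exact norm_sum_exp_smul_sinC_le hy _ S

/-! ### Growth of mild solutions and blow-up -/

theorem IsMild.restart {p : ℝ} {N : C01 → L2} (hN : LipOnBounded N) {w₀ : C01} {T : ℝ}
    {w : ℝ → C01} (hw : IsMild p N w₀ T w) {τ r : ℝ} (hτ : 0 ≤ τ) (hr : 0 ≤ r) (hT : r + τ ≤ T)
    (n : ℕ) : coef n (toL2 (w (r + τ))) = Real.exp (-(p * lam n) * r) * coef n (toL2 (w τ)) +
      duh p (fun s => N (w (s + τ))) n r := by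
  have hT0 : 0 ≤ T := by linarith
  set v : ℝ → C01 := IccExtend hT0 ((Icc 0 T).domRestrict w) with hv
  have hvc : Continuous v := hw.continuousOn.domRestrict.Icc_extend'
  have hve : ∀ s ∈ Icc 0 T, v s = w s := fun s hs => IccExtend_of_mem _ _ hs
  have hvm := hw.congr hve fun _ _ => rfl
  have hfc : Continuous fun s => N (v s) := hN.continuous.comp hvc
  have h1 : r + τ ∈ Icc 0 T := ⟨by linarith, hT⟩
  have h2 : τ ∈ Icc 0 T := ⟨hτ, by linarith⟩
  have h3 : duh p (fun s => N (w (s + τ))) n r = duh p (fun s => N (v (s + τ))) n r :=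
    duh_congr hr fun s hs => by
      rw [hve _ ⟨by linarith [hs.1], by linarith [hs.2]⟩]
  have e : Real.exp (-(p * lam n) * (r + τ)) =
      Real.exp (-(p * lam n) * r) * Real.exp (-(p * lam n) * τ) := by
    rw [← Real.exp_add]; congr 1; ring
  rw [h3, ← hve _ h1, ← hve _ h2, hvm.coef_eq _ h1, hvm.coef_eq _ h2, duh_add hfc, e]
  ring

theorem IsMild.summable_coef {p : ℝ} (hp : 0 < p) {N : C01 → L2} (hN : LipOnBounded N)
    {w₀ : C01} {q₀ : L2} (h₀ : IsLap w₀ q₀) {T : ℝ} {w : ℝ → C01} (hw : IsMild p N w₀ T w)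
    {t : ℝ} (ht : t ∈ Icc 0 T) : Summable fun n => |coef n (toL2 (w t))| := by
  have hfc : ContinuousOn (fun s => N (w s)) (Icc 0 t) :=
    hN.continuous.comp_continuousOn (hw.continuousOn.mono (Icc_subset_Icc_right ht.2))
  have h1 := summable_abs_of_sum_le (sum_lam_mul_sq_duh_le hp ht.1 hfc)
  refine (h₀.summable.add h1).of_nonneg_of_le (fun _ => abs_nonneg _) fun n => ?_
  rw [hw.coef_eq t ht]
  refine (abs_add_le _ _).trans (add_le_add ?_ le_rfl)
  rw [abs_mul, Real.abs_exp]
  refine mul_le_of_le_one_left (abs_nonneg _) (Real.exp_le_one_iff.2 ?_)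
  have := mul_nonneg (mul_pos hp (lam_pos n)).le ht.1
  linarith

/-- A mild solution grows slowly as long as it stays in a given ball. -/
theorem IsMild.norm_le_add_sqrt {p : ℝ} (hp : 0 < p) {N : C01 → L2} (hN : LipOnBounded N)
    {w₀ : C01} {q₀ : L2} (h₀ : IsLap w₀ q₀) {T : ℝ} {w : ℝ → C01} (hw : IsMild p N w₀ T w)
    {τ r : ℝ} (hτ : 0 ≤ τ) (hr : 0 ≤ r) (hT : r + τ ≤ T) {B : ℝ}
    (hB : ∀ s ∈ Ico τ (r + τ), ‖N (w s)‖ ≤ B) :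
    ‖w (r + τ)‖ ≤ ‖w τ‖ + √(embConst * ((2 * p)⁻¹ * (B ^ 2 * r))) := by
  have hfc : ContinuousOn (fun s => N (w (s + τ))) (Icc 0 r) := by
    refine hN.continuous.comp_continuousOn (hw.continuousOn.comp (by fun_prop) fun s hs => ?_)
    exact ⟨by linarith [hs.1], by linarith [hs.2]⟩
  have hint : ∫ s in (0 : ℝ)..r, ‖N (w (s + τ))‖ ^ 2 ≤ B ^ 2 * r := by
    refine (intervalIntegral.integral_mono_on_of_le_Ioo hr
      ((hfc.norm.pow 2).intervalIntegrable_of_Icc hr)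
      (g := fun _ => B ^ 2) (by simp) fun s hs => ?_).trans (by simp [mul_comm])
    exact pow_le_pow_left₀ (norm_nonneg _)
      (hB _ ⟨by linarith [hs.1], by linarith [hs.2]⟩) 2
  have hsum := fun S => (sum_lam_mul_sq_duh_le hp hr hfc S).trans
    (mul_le_mul_of_nonneg_left hint (by positivity))
  have hs := summable_abs_of_sum_le hsum
  -- `D` is the Duhamel part since time `τ`. The remainder `w (r + τ) - D` is the heat flow of `w
  -- τ`, so its norm is at most `‖w τ‖` with constant exactly one.
  set D : C01 := ∑' n, duh p (fun s => N (w (s + τ))) n r • sinC n with hD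
  have hDc : ∀ n, coef n (toL2 D) = duh p (fun s => N (w (s + τ))) n r := coef_tsum_smul_sinC hs
  have h1 : ‖D‖ ≤ √(embConst * ((2 * p)⁻¹ * (B ^ 2 * r))) := by
    refine Real.le_sqrt_of_sq_le (norm_sq_le_of_sum_le fun S => ?_)
    simp_rw [hDc]
    exact hsum S
  have h2 : ‖w (r + τ) - D‖ ≤ ‖w τ‖ := by
    refine norm_le_of_coef_eq_exp_mul (y := p * r) (by positivity)
      (hw.summable_coef hp hN h₀ ⟨hτ, by linarith⟩) fun n => ?_
    rw [toL2_sub, map_sub, hDc, hw.restart hN hτ hr hT, add_sub_cancel_right]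
    congr 2
    ring
  have h3 := norm_le_norm_add_norm_sub' (w (r + τ)) D
  linarith

/-- A mild solution on a finite interval is bounded unless its norm tends to infinity. -/
theorem exists_bound_of_not_tendsto {p : ℝ} (hp : 0 < p) {N : C01 → L2} (hN : LipOnBounded N)
    {w₀ : C01} {q₀ : L2} (h₀ : IsLap w₀ q₀) {T : ℝ} (hT : 0 < T) {w : ℝ → C01}
    (hw : ∀ T' < T, IsMild p N w₀ T' w) (h : ¬ Tendsto (fun t => ‖w t‖) (𝓝[<] T) atTop) :
    ∃ R, ∀ t, 0 ≤ t → t < T → ‖w t‖ ≤ R := by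
  rw [tendsto_atTop] at h
  push Not at h
  obtain ⟨R₀, hR₀⟩ := h
  obtain ⟨M, hM, hMN⟩ := hN (|R₀| + 1)
  set B : ℝ := ‖N 0‖ + M * (|R₀| + 1) with hB
  have hNB : ∀ u : C01, ‖u‖ ≤ |R₀| + 1 → ‖N u‖ ≤ B := by
    intro u hu
    have h1 := hMN u 0 hu (by rw [norm_zero]; positivity)
    rw [sub_zero] at h1
    have h2 := norm_le_norm_add_norm_sub' (N u) (N 0)
    have h3 := mul_le_mul_of_nonneg_left hu hM
    linarith
  have hE := embConst_nonneg
  set K : ℝ := embConst * ((2 * p)⁻¹ * B ^ 2) with hK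
  have hK0 : 0 ≤ K := by positivity
  have hδ : 0 < 1 / (K + 1) := by positivity
  -- Failure of the limit gives times arbitrarily close to `T` with norm below `R₀`. Within `1 / (K
  -- + 1)` of `T` the possible growth `√(K r)` is less than one.
  obtain ⟨τ, hτR, hτ⟩ := (hR₀.and_eventually
    (Ioo_mem_nhdsLT (max_lt hT (sub_lt_self T hδ)))).exists
  have hτ0 : 0 ≤ τ := (le_max_left _ _).trans hτ.1.le
  have hτδ : T - τ < 1 / (K + 1) := by linarith [(le_max_right _ _).trans_lt hτ.1]
  have hlater : ∀ t, τ ≤ t → t < T → ‖w t‖ ≤ |R₀| + 1 := by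
    by_contra! hcon
    obtain ⟨t₁, ht₁, ht₁T, hbig⟩ := hcon
    have hwt := hw t₁ ht₁T
    have hcont : ContinuousOn (fun t => ‖w t‖) (Icc τ t₁) :=
      (hwt.continuousOn.mono (Icc_subset_Icc_left hτ0)).norm
    set S : Set ℝ := Icc τ t₁ ∩ (fun t => ‖w t‖) ⁻¹' Ici (|R₀| + 1) with hS
    have hScl : IsClosed S := hcont.preimage_isClosed_of_isClosed isClosed_Icc isClosed_Ici
    have hSne : S.Nonempty := ⟨t₁, ⟨ht₁, le_rfl⟩, hbig.le⟩
    have hSbd : BddBelow S := ⟨τ, fun t ht => ht.1.1⟩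
    -- `σ` is the first time at which the norm reaches `|R₀| + 1`. Before it the bound `B` applies,
    -- so the norm at `σ` is less than `R₀ + 1`, a contradiction.
    have hmem := hScl.csInf_mem hSne hSbd
    set σ := sInf S with hσ
    obtain ⟨r, hr⟩ : ∃ r, r = σ - τ := ⟨_, rfl⟩
    have hrσ : r + τ = σ := by rw [hr]; ring
    have hr0 : 0 ≤ r := by linarith [hmem.1.1]
    have h1 := hwt.norm_le_add_sqrt hp hN h₀ hτ0 hr0 (by rw [hrσ]; exact hmem.1.2) (B := B)
      fun s hs => hNB _ (by
        by_contra! hlt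
        rw [hrσ] at hs
        have : σ ≤ s := csInf_le hSbd ⟨⟨hs.1, hs.2.le.trans hmem.1.2⟩, hlt.le⟩
        exact absurd hs.2 (not_lt.2 this))
    rw [hrσ] at h1
    have h2 : √(embConst * ((2 * p)⁻¹ * (B ^ 2 * r))) < 1 := by
      rw [Real.sqrt_lt' one_pos]
      have h3 : r < 1 / (K + 1) := by linarith [hmem.1.2]
      rw [lt_div_iff₀ (by positivity)] at h3
      have h4 : embConst * ((2 * p)⁻¹ * (B ^ 2 * r)) = K * r := by rw [hK]; ring
      rw [h4]
      nlinarith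
    have h5 : |R₀| + 1 ≤ ‖w σ‖ := hmem.2
    have h6 := le_abs_self R₀
    linarith
  obtain ⟨R₁, hR₁⟩ := exists_norm_le_of_continuousOn (hw τ hτ.2).continuousOn
  refine ⟨max R₁ (|R₀| + 1), fun t ht0 htT => ?_⟩
  rcases le_total t τ with h1 | h1
  · exact (hR₁ t ⟨ht0, h1⟩).trans (le_max_left _ _)
  · exact (hlater t h1 htT).trans (le_max_right _ _)

/-! ### The Volterra transformation -/

/-- The integration operator `(J f)(x) = ∫₀ˣ f(s) ds` from `L²(0,1)` to `C⁰([0,1])`. -/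
def intC : L2 →L[ℝ] C01 :=
  LinearMap.mkContinuous
    { toFun := fun f => toC _ (continuousOn_primitive_L2 f)
      map_add' := fun f g => by
        ext x
        change ∫ s in (0 : ℝ)..x, (f + g) s = (∫ s in (0 : ℝ)..x, f s) + ∫ s in (0 : ℝ)..x, g s
        rw [← intervalIntegral.integral_add (intervalIntegrable_L2 f x.2)
          (intervalIntegrable_L2 g x.2)]
        exact intervalIntegral_congr_ae_μ01 (Lp.coeFn_add f g) zero_mem_I x.2
      map_smul' := fun c f => by
        ext x
        change ∫ s in (0 : ℝ)..x, (c • f) s = c • ∫ s in (0 : ℝ)..x, f s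
        rw [← intervalIntegral.integral_smul]
        exact intervalIntegral_congr_ae_μ01 (Lp.coeFn_smul c f) zero_mem_I x.2 }
    1 (fun f => by
      rw [one_mul]
      refine (ContinuousMap.norm_le _ (norm_nonneg _)).2 fun x => ?_
      have hx : (x : ℝ) ∈ closure (Ioo (0 : ℝ) 1) := by
        rw [closure_Ioo zero_ne_one]; exact x.2
      exact ((continuousOn_primitive_L2 f x x.2).mono Ioo_subset_Icc_self).norm.closure_le hx
        continuousWithinAt_const fun y hy => norm_primitive_le f hy)

theorem toFun_intC (f : L2) {x : ℝ} (hx : x ∈ Icc (0 : ℝ) 1) :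
    toFun (intC f) x = ∫ s in (0 : ℝ)..x, f s :=
  toFun_toC (continuousOn_primitive_L2 f) hx

theorem toL2_intC (f : L2) : toL2 (intC f) = intOp f := by
  refine Lp.ext ?_
  filter_upwards [toL2_toC_ae (continuousOn_primitive_L2 f), intOp_ae f] with x h1 h2
  rw [h2, ← h1]
  rfl

theorem toL2_mul_toC {a : ℝ → ℝ} (ha : ContinuousOn a (Icc 0 1)) (u : C01) :
    toL2 (toC a ha * u) = mulOp a ha (toL2 u) := by
  refine Lp.ext ?_
  filter_upwards [toL2_ae (toC a ha * u), mulOp_ae a ha (toL2 u), toL2_ae u,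
    ae_of_forall_mem_I fun x hx => toFun_toC ha hx] with x h1 h2 h3 h4
  rw [h1, h2, h3, ← h4]
  rfl

theorem hasPrim_intOp_mulOp (a : ℝ → ℝ) (ha : ContinuousOn a (Icc 0 1)) (f : L2) :
    HasPrim (fun x => ∫ s in (0 : ℝ)..x, a s * f s) (fun x => a x * f x) :=
  (HasPrim.primitive (memLp_mul ha f) 0).congr (fun x _ => by simp) (ae_of_all _ fun _ => rfl)

section Transform

variable {k : ℝ → ℝ}

theorem hasPrim_of_contDiffOn (hk : ContDiffOn ℝ 2 k (Icc 0 1)) : HasPrim k (D1 k) :=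
  HasPrim.of_hasDerivWithinAt
    (fun x hx => (hk.differentiableOn two_ne_zero x hx).hasDerivWithinAt) (continuousOn_D1 hk)

theorem hasPrim_D1 (hk : ContDiffOn ℝ 2 k (Icc 0 1)) : HasPrim (D1 k) (D2 k) :=
  HasPrim.of_hasDerivWithinAt
    (fun x hx => ((hk.derivWithin (m := 1) (uniqueDiffOn_Icc zero_lt_one)
      (by norm_num)).differentiableOn one_ne_zero x hx).hasDerivWithinAt) (continuousOn_D2 hk)

/-- `x ↦ exp (c ∫₀ˣ k)`. -/
def expPrim (k : ℝ → ℝ) (c : ℝ) (x : ℝ) : ℝ := Real.exp (c * ∫ s in (0 : ℝ)..x, k s)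

theorem hasPrim_expPrim (hk : ContinuousOn k (Icc 0 1)) (c : ℝ) :
    HasPrim (expPrim k c) (fun x => c * k x * expPrim k c x) := by
  have hcont := continuous_toFun (toC k hk)
  have hd : ∀ x, HasDerivAt (expPrim (toFun (toC k hk)) c)
      (c * toFun (toC k hk) x * expPrim (toFun (toC k hk)) c x) x := by
    intro x
    have h := ((hcont.integral_hasStrictDerivAt 0 x).hasDerivAt.const_mul c).exp
    refine h.congr_deriv ?_
    rw [expPrim]; ring
  have hc : Continuous fun x => c * toFun (toC k hk) x * expPrim (toFun (toC k hk)) c x := by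
    have h1 : Continuous (expPrim (toFun (toC k hk)) c) :=
      continuous_iff_continuousAt.2 fun x => (hd x).continuousAt
    fun_prop
  have he : ∀ x ∈ Icc (0 : ℝ) 1, expPrim k c x = expPrim (toFun (toC k hk)) c x := by
    intro x hx
    rw [expPrim, expPrim]
    congr 2
    refine intervalIntegral.integral_congr fun s hs => ?_
    rw [uIcc_of_le hx.1] at hs
    rw [toFun_toC hk ⟨hs.1, hs.2.trans hx.2⟩]
  refine (hasDerivAt_hasPrim hd hc).congr he (ae_of_forall_mem_I fun x hx => ?_)
  rw [he x hx, toFun_toC hk hx]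

theorem expPrim_mul_expPrim (x : ℝ) : expPrim k 1 x * expPrim k (-1) x = 1 := by
  rw [expPrim, expPrim, ← Real.exp_add]; simp

variable (hk : ContDiffOn ℝ 2 k (Icc 0 1))

theorem continuousOn_expPrim (hk : ContDiffOn ℝ 2 k (Icc 0 1)) (c : ℝ) :
    ContinuousOn (expPrim k c) (Icc 0 1) :=
  (hasPrim_expPrim hk.continuousOn c).continuousOn

theorem continuousOn_expPrim_mul (hk : ContDiffOn ℝ 2 k (Icc 0 1)) :
    ContinuousOn (fun x => expPrim k (-1) x * k x) (Icc 0 1) :=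
  (continuousOn_expPrim hk (-1)).mul hk.continuousOn

/-- The inverse of `opK` on `L²(0,1)`. -/
def opKinv : L2 →L[ℝ] L2 :=
  ContinuousLinearMap.id ℝ L2 + (mulOp (expPrim k 1) (continuousOn_expPrim hk 1)).comp
    (intOp.comp (mulOp _ (continuousOn_expPrim_mul hk)))

theorem opKinv_ae (f : L2) : ∀ᵐ x ∂μ01, opKinv hk f x =
    f x + expPrim k 1 x * ∫ s in (0 : ℝ)..x, expPrim k (-1) s * k s * f s := by
  filter_upwards [Lp.coeFn_add f (mulOp (expPrim k 1) (continuousOn_expPrim hk 1)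
    (intOp (mulOp _ (continuousOn_expPrim_mul hk) f))),
    mulOp_ae (expPrim k 1) (continuousOn_expPrim hk 1)
      (intOp (mulOp _ (continuousOn_expPrim_mul hk) f)),
    intOp_mulOp_ae _ (continuousOn_expPrim_mul hk) f] with x h1 h2 h3
  refine h1.trans ?_
  rw [Pi.add_apply, h2, h3]

/-- If `f = K u`, then `y = ∫₀ˣ k u` solves `y' = k y + k f`, `y 0 = 0`. The integrating factor `exp
(-∫ k)` gives `u = f + y` as in `opKinv`. -/
theorem opK_opKinv (f : L2) : opK k hk (opKinv hk f) = f := by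
  refine Lp.ext ?_
  have hY := hasPrim_intOp_mulOp _ (continuousOn_expPrim_mul hk) f
  have hP := (hasPrim_expPrim hk.continuousOn 1).mul hY
  have hint : ∀ x ∈ Icc (0 : ℝ) 1, ∫ s in (0 : ℝ)..x, k s * opKinv hk f s =
      expPrim k 1 x * ∫ s in (0 : ℝ)..x, expPrim k (-1) s * k s * f s := by
    intro x hx
    rw [hP.eq x hx, intervalIntegral.integral_same, mul_zero, zero_add]
    refine intervalIntegral_congr_ae_μ01 ?_ zero_mem_I hx
    filter_upwards [opKinv_ae hk f] with s hs
    rw [hs]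
    linear_combination (-(k s * f s)) * expPrim_mul_expPrim (k := k) s
  filter_upwards [opK_ae k hk (opKinv hk f), opKinv_ae hk f,
    ae_of_forall_mem_I hint] with x h1 h2 h3
  rw [h1, h3, h2]
  ring

theorem opKinv_opK (f : L2) : opKinv hk (opK k hk f) = f := by
  refine Lp.ext ?_
  have hY := hasPrim_intOp_mulOp _ hk.continuousOn f
  have hP := (hasPrim_expPrim hk.continuousOn (-1)).mul hY
  have hint : ∀ x ∈ Icc (0 : ℝ) 1, ∫ s in (0 : ℝ)..x, expPrim k (-1) s * k s * opK k hk f s =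
      expPrim k (-1) x * ∫ s in (0 : ℝ)..x, k s * f s := by
    intro x hx
    rw [hP.eq x hx, intervalIntegral.integral_same, mul_zero, zero_add]
    refine intervalIntegral_congr_ae_μ01 ?_ zero_mem_I hx
    filter_upwards [opK_ae k hk f] with s hs
    rw [hs]
    ring
  filter_upwards [opK_ae k hk f, opKinv_ae hk (opK k hk f),
    ae_of_forall_mem_I hint] with x h1 h2 h3
  rw [h2, h3, h1, ← mul_assoc, expPrim_mul_expPrim]
  ring

/-- The operator `opK` on `C⁰([0,1])`. -/
def opKC : C01 →L[ℝ] C01 :=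
  ContinuousLinearMap.id ℝ C01 - intC.comp ((mulOp k hk.continuousOn).comp toL2CLM)

/-- The inverse of `opKC`. -/
def opKinvC : C01 →L[ℝ] C01 :=
  ContinuousLinearMap.id ℝ C01 +
    (ContinuousLinearMap.mul ℝ C01 (toC (expPrim k 1) (continuousOn_expPrim hk 1))).comp
      (intC.comp ((mulOp _ (continuousOn_expPrim_mul hk)).comp toL2CLM))

theorem toL2_opKC (u : C01) : toL2 (opKC hk u) = opK k hk (toL2 u) := by
  change toL2 (u - intC (mulOp k hk.continuousOn (toL2 u))) = _
  rw [toL2_sub, toL2_intC]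
  rfl

theorem toL2_opKinvC (u : C01) : toL2 (opKinvC hk u) = opKinv hk (toL2 u) := by
  change toL2 (u + toC (expPrim k 1) (continuousOn_expPrim hk 1) *
    intC (mulOp _ (continuousOn_expPrim_mul hk) (toL2 u))) = _
  rw [toL2_add, toL2_mul_toC, toL2_intC]
  rfl

theorem opKC_opKinvC (u : C01) : opKC hk (opKinvC hk u) = u :=
  toL2_injective (by rw [toL2_opKC, toL2_opKinvC, opK_opKinv])

theorem opKinvC_opKC (u : C01) : opKinvC hk (opKC hk u) = u :=
  toL2_injective (by rw [toL2_opKinvC, toL2_opKC, opKinv_opK])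

theorem toFun_opKC (u : C01) {x : ℝ} (hx : x ∈ Icc (0 : ℝ) 1) :
    toFun (opKC hk u) x = toFun u x - ∫ s in (0 : ℝ)..x, k s * toFun u s := by
  have h1 : toFun (opKC hk u) x = toFun u x - toFun (intC (mulOp k hk.continuousOn (toL2 u))) x :=
    rfl
  rw [h1, toFun_intC _ hx]
  congr 1
  refine intervalIntegral_congr_ae_μ01 ?_ zero_mem_I hx
  filter_upwards [mulOp_ae k hk.continuousOn (toL2 u), toL2_ae u] with s h2 h3
  rw [h2, h3]

theorem toFun_opKC_zero (u : C01) : toFun (opKC hk u) 0 = toFun u 0 := by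
  rw [toFun_opKC hk u zero_mem_I]; simp

/-- The nonlocal condition on `u` at `1` is the Dirichlet condition on `K u`. -/
theorem toFun_opKC_one (u : C01) : toFun (opKC hk u) 1 = toFun u 1 - pairing k u :=
  toFun_opKC hk u one_mem_I

theorem hasPrim_primitive_mul (hk : ContDiffOn ℝ 2 k (Icc 0 1)) (u : C01) :
    HasPrim (fun x => ∫ s in (0 : ℝ)..x, k s * toFun u s) (fun x => k x * toFun u x) :=
  (HasPrim.primitive (memLp_of_continuousOn
    (hk.continuousOn.mul (continuous_toFun u).continuousOn)) 0).congr (fun x _ => by simp)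
      (ae_of_all _ fun _ => rfl)

theorem IsH2.flux_ae {u : C01} {u₁ : ℝ → ℝ} {u₂ : L2} (h : IsH2 u u₁ u₂) :
    ∀ᵐ x ∂μ01, flux k hk u x = u₁ x - k x * toFun u x := by
  filter_upwards [Lp.coeFn_sub (weakDeriv 1 (toL2 u)) (mulOp k hk.continuousOn (toL2 u)),
    h.weakDeriv_one_ae, mulOp_ae k hk.continuousOn (toL2 u), toL2_ae u] with x h1 h2 h3 h4
  rw [flux, h1, Pi.sub_apply, h2, h3, h4]

theorem IsH2.fluxDeriv_ae {u : C01} {u₁ : ℝ → ℝ} {u₂ : L2} (h : IsH2 u u₁ u₂) :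
    ∀ᵐ x ∂μ01, fluxDeriv k hk u x = u₂ x - (D1 k x * toFun u x + k x * u₁ x) := by
  filter_upwards [Lp.coeFn_sub (weakDeriv 2 (toL2 u) - mulOp k hk.continuousOn
      (weakDeriv 1 (toL2 u))) (mulOp (D1 k) (continuousOn_D1 hk) (toL2 u)),
    Lp.coeFn_sub (weakDeriv 2 (toL2 u)) (mulOp k hk.continuousOn (weakDeriv 1 (toL2 u))),
    h.weakDeriv_one_ae, mulOp_ae k hk.continuousOn (weakDeriv 1 (toL2 u)), toL2_ae u,
    mulOp_ae (D1 k) (continuousOn_D1 hk) (toL2 u)] with x h1 h2 h3 h4 h5 h6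
  rw [fluxDeriv, h1, Pi.sub_apply, h2, Pi.sub_apply, h4, h3, h6, h5, h.weakDeriv_two]
  ring

theorem IsH2.opKC {u : C01} {u₁ : ℝ → ℝ} {u₂ : L2} (h : IsH2 u u₁ u₂) :
    IsH2 (opKC hk u) (fun x => u₁ x - k x * toFun u x) (fluxDeriv k hk u) where
  fst := (h.fst.sub (hasPrim_primitive_mul hk u)).congr (fun _ hx => toFun_opKC hk u hx)
    (ae_of_all _ fun _ => rfl)
  snd := (h.snd.sub ((hasPrim_of_contDiffOn hk).mul h.fst)).congr (fun _ _ => rfl)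
    (h.fluxDeriv_ae hk)

/-- Bootstrap in `u = w + ∫₀ˣ k u`: continuity of `u` gives `u' = w₁ + k u`, and this in turn has a
square-integrable derivative. -/
theorem exists_isH2_of_opKC {u : C01} {w₁ : ℝ → ℝ} {w₂ : L2} (h : IsH2 (opKC hk u) w₁ w₂) :
    ∃ (u₁ : ℝ → ℝ) (u₂ : L2), IsH2 u u₁ u₂ := by
  have h1 : HasPrim (toFun u) (fun x => w₁ x + k x * toFun u x) :=
    (h.fst.add (hasPrim_primitive_mul hk u)).congr
      (fun x hx => by rw [toFun_opKC hk u hx, sub_add_cancel]) (ae_of_all _ fun _ => rfl)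
  have h2 := h.snd.add ((hasPrim_of_contDiffOn hk).mul h1)
  exact ⟨_, h2.memLp.toLp, h1, h2.congr (fun _ _ => rfl) h2.memLp.coeFn_toLp⟩

/-- Integrating by parts twice, `∫₀ˣ k u₂ = k u₁ - k' u + ∫₀ˣ k'' u`; the boundary terms at `0`
vanish because `k 0 = 0` and `u 0 = 0`. The term `k' u` has the opposite sign in `fluxDeriv`, whence
the factor `2` in `opG`. -/
theorem IsH2.opK_eq {u : C01} {u₁ : ℝ → ℝ} {u₂ : L2} (h : IsH2 u u₁ u₂) (hk0 : k 0 = 0)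
    (hu0 : toFun u 0 = 0) : opK k hk u₂ = fluxDeriv k hk u + opG k hk (toL2 u) := by
  refine Lp.ext ?_
  have hP := ((hasPrim_of_contDiffOn hk).mul h.snd).sub ((hasPrim_D1 hk).mul h.fst)
  have hQ := hasPrim_intOp_mulOp _ (continuousOn_D2 hk) (toL2 u)
  have hint : ∀ x ∈ Icc (0 : ℝ) 1, ∫ s in (0 : ℝ)..x, k s * u₂ s =
      k x * u₁ x - D1 k x * toFun u x + ∫ s in (0 : ℝ)..x, D2 k s * toL2 u s := by
    intro x hx
    have h1 := (hP.add hQ).eq x hx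
    simp only [hk0, hu0, intervalIntegral.integral_same, zero_mul, mul_zero, sub_zero,
      zero_add] at h1
    rw [h1]
    refine intervalIntegral_congr_ae_μ01 ?_ zero_mem_I hx
    filter_upwards [toL2_ae u] with s hs
    rw [hs]
    ring
  filter_upwards [opK_ae k hk u₂, Lp.coeFn_add (fluxDeriv k hk u) (opG k hk (toL2 u)),
    opG_ae k hk (toL2 u), h.fluxDeriv_ae hk, ae_of_forall_mem_I hint, toL2_ae u]
    with x h1 h2 h3 h4 h5 h6
  rw [h1, h2, Pi.add_apply, h3, h4, h5, h6]
  ring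

end Transform

/-! ### The transformed nonlinearity -/

/-- The nonlinearity of the equation for `w = K u`. -/
def transformedRHS (p : ℝ) (F : C01 → C01) {k : ℝ → ℝ} (hk : ContDiffOn ℝ 2 k (Icc 0 1)) (w : C01) :
    L2 :=
  opK k hk (toL2 (F (opKinvC hk w))) + p • opG k hk (toL2 (opKinvC hk w))

theorem lipOnBounded_transformedRHS (p : ℝ) {F : C01 → C01} {L : ℝ → ℝ}
    (hLpos : ∀ r, 0 ≤ r → 0 < L r) (hLmono : MonotoneOn L (Ici 0))
    (hFL : ∀ u v : C01, ‖F u - F v‖ ≤ L (max ‖u‖ ‖v‖) * ‖u - v‖) {k : ℝ → ℝ}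
    (hk : ContDiffOn ℝ 2 k (Icc 0 1)) : LipOnBounded (transformedRHS p F hk) := by
  intro R
  set c : ℝ := ‖opKinvC hk‖ with hc
  -- `L` is monotone only on `[0, ∞)`, and `R` may be negative; the absolute value keeps `ρ` in that
  -- range.
  set ρ : ℝ := c * |R| with hρ
  have hρ0 : 0 ≤ ρ := by positivity
  have hL := (hLpos ρ hρ0).le
  refine ⟨‖opK k hk‖ * (L ρ * c) + |p| * (‖opG k hk‖ * c), by positivity, fun u v hu hv => ?_⟩
  have hb : ∀ u : C01, ‖u‖ ≤ R → ‖opKinvC hk u‖ ≤ ρ := fun u hu =>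
    ((opKinvC hk).le_opNorm u).trans
      (mul_le_mul_of_nonneg_left (hu.trans (le_abs_self R)) (norm_nonneg _))
  have hd : ‖opKinvC hk u - opKinvC hk v‖ ≤ c * ‖u - v‖ := by
    rw [← map_sub]; exact (opKinvC hk).le_opNorm _
  have h1 : ‖F (opKinvC hk u) - F (opKinvC hk v)‖ ≤ L ρ * (c * ‖u - v‖) := by
    refine (hFL _ _).trans (mul_le_mul ?_ hd (norm_nonneg _) hL)
    exact hLmono ((norm_nonneg _).trans (le_max_left _ _)) hρ0 (max_le (hb u hu) (hb v hv))
  have e : transformedRHS p F hk u - transformedRHS p F hk v =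
      opK k hk (toL2 (F (opKinvC hk u) - F (opKinvC hk v))) +
        p • opG k hk (toL2 (opKinvC hk u - opKinvC hk v)) := by
    rw [transformedRHS, transformedRHS, toL2_sub, toL2_sub, map_sub, map_sub, smul_sub]
    abel
  rw [e]
  refine (norm_add_le _ _).trans ?_
  have h2 : ‖opK k hk (toL2 (F (opKinvC hk u) - F (opKinvC hk v)))‖ ≤
      ‖opK k hk‖ * (L ρ * (c * ‖u - v‖)) :=
    (ContinuousLinearMap.le_opNorm _ _).trans
      (mul_le_mul_of_nonneg_left ((norm_toL2_le _).trans h1) (norm_nonneg _))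
  have h3 : ‖p • opG k hk (toL2 (opKinvC hk u - opKinvC hk v))‖ ≤
      |p| * (‖opG k hk‖ * (c * ‖u - v‖)) := by
    rw [norm_smul, Real.norm_eq_abs]
    refine mul_le_mul_of_nonneg_left ?_ (abs_nonneg p)
    exact (ContinuousLinearMap.le_opNorm _ _).trans
      (mul_le_mul_of_nonneg_left ((norm_toL2_le _).trans hd) (norm_nonneg _))
  refine (add_le_add h2 h3).trans (le_of_eq ?_)
  ring

/-! ### Time intervals with extended end point -/

theorem isOpen_timeIoo (T : EReal) : IsOpen (timeIoo T) :=
  isOpen_Ioi.inter (isOpen_Iio.preimage continuous_coe_real_ereal)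

theorem timeIoo_subset_timeIco (T : EReal) : timeIoo T ⊆ timeIco T := fun _ h => ⟨h.1.le, h.2⟩

theorem Icc_subset_timeIco {T : EReal} {T' : ℝ} (h : (T' : EReal) < T) : Icc 0 T' ⊆ timeIco T :=
  fun _ ht => ⟨ht.1, (EReal.coe_le_coe_iff.2 ht.2).trans_lt h⟩

theorem Icc_mem_nhdsWithin_timeIco {T : EReal} {t T' : ℝ} (h : t < T') :
    Icc 0 T' ∈ 𝓝[timeIco T] t := by
  filter_upwards [self_mem_nhdsWithin, mem_nhdsWithin_of_mem_nhds (Iic_mem_nhds h)] with s hs hs'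
  exact ⟨hs.1, hs'⟩

theorem exists_real_btwn_of_mem_timeIco {T : EReal} {t : ℝ} (ht : t ∈ timeIco T) :
    ∃ T' : ℝ, t < T' ∧ (T' : EReal) < T := by
  obtain ⟨x, hx1, hx2⟩ := EReal.lt_iff_exists_real_btwn.1 ht.2
  exact ⟨x, EReal.coe_lt_coe_iff.1 hx1, hx2⟩

theorem uniqueDiffOn_timeIco {T : EReal} (hT : 0 < T) : UniqueDiffOn ℝ (timeIco T) := by
  refine uniqueDiffOn_convex (OrdConnected.convex ⟨fun a ha b hb c hc => ?_⟩) ?_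
  · exact ⟨ha.1.trans hc.1, (EReal.coe_le_coe_iff.2 hc.2).trans_lt hb.2⟩
  · obtain ⟨T', h0, hT'⟩ := exists_real_btwn_of_mem_timeIco (t := 0) ⟨le_rfl, hT⟩
    refine ⟨T' / 2, mem_interior.2 ⟨Ioo 0 T', ?_, isOpen_Ioo, ?_⟩⟩
    · exact Ioo_subset_Icc_self.trans (Icc_subset_timeIco hT')
    · constructor <;> linarith

/-! ### Equivalence of solutions and mild solutions -/

theorem IsH2.isLap {w : C01} {w₁ : ℝ → ℝ} {w₂ : L2} (h : IsH2 w w₁ w₂) (h0 : toFun w 0 = 0)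
    (h1 : toFun w 1 = 0) : IsLap w w₂ :=
  h.coef_eq h0 h1

theorem isLap_opKC {k : ℝ → ℝ} (hk : ContDiffOn ℝ 2 k (Icc 0 1)) {u : C01}
    (hu : MemH 2 (toL2 u)) (h0 : toFun u 0 = 0) (h1 : toFun u 1 = pairing k u) :
    IsLap (opKC hk u) (fluxDeriv k hk u) := by
  obtain ⟨u₁, u₂, h⟩ := hu.exists_isH2
  refine (h.opKC hk).isLap ?_ ?_
  · rw [toFun_opKC_zero, h0]
  · rw [toFun_opKC_one, h1, sub_self]

/-- `opK` maps the linear part of the equation to the Dirichlet Laplacian plus a bounded term. -/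
theorem opK_weakDeriv_two {k : ℝ → ℝ} (hk : ContDiffOn ℝ 2 k (Icc 0 1)) (hk0 : k 0 = 0) {u : C01}
    (hu : MemH 2 (toL2 u)) (h0 : toFun u 0 = 0) :
    opK k hk (weakDeriv 2 (toL2 u)) = fluxDeriv k hk u + opG k hk (toL2 u) := by
  obtain ⟨u₁, u₂, h⟩ := hu.exists_isH2
  rw [h.weakDeriv_two, h.opK_eq hk hk0 h0]

section Equivalence

variable {p : ℝ} {F : C01 → C01} {k : ℝ → ℝ} {u₀ : C01} {T : EReal}

theorem IsSolution.continuousOn_curve {u : ℝ → C01} (h : IsSolution p F k u₀ T u) :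
    ContinuousOn u (timeIco T) :=
  ContinuousMap.continuousOn_of_continuousOn_uncurry u h.continuousOn

/-- Each coefficient of `K u` solves the scalar equation `y' = -p λₙ y + Nₙ` on the open interval.
The integrating factor `exp (p λₙ s)` and continuity up to the end points turn it into the Duhamel
formula. -/
theorem IsSolution.isMild {u : ℝ → C01} (h : IsSolution p F k u₀ T u)
    (hk : ContDiffOn ℝ 2 k (Icc 0 1)) (hk0 : k 0 = 0)
    (hN : LipOnBounded (transformedRHS p F hk)) {T' : ℝ} (hT' : (T' : EReal) < T) :
    IsMild p (transformedRHS p F hk) (opKC hk u₀) T' (fun t => opKC hk (u t)) := by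
  have hwc : ContinuousOn (fun t => opKC hk (u t)) (timeIco T) :=
    (opKC hk).continuous.comp_continuousOn h.continuousOn_curve
  refine ⟨hwc.mono (Icc_subset_timeIco hT'), fun t ht n => ?_⟩
  have hsub : Icc 0 t ⊆ timeIco T :=
    (Icc_subset_Icc_right ht.2).trans (Icc_subset_timeIco hT')
  have hd : ∀ s ∈ Ioo 0 t, HasDerivAt (fun s => coef n (toL2 (opKC hk (u s))))
      (-(p * lam n) * coef n (toL2 (opKC hk (u s))) +
        coef n (transformedRHS p F hk (opKC hk (u s)))) s := by
    intro s hs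
    have hsI : s ∈ timeIco T := hsub (Ioo_subset_Icc_self hs)
    have hs' : s ∈ timeIoo T := ⟨hs.1, hsI.2⟩
    have h1 : HasDerivAt (fun s => toL2 (u s)) (deriv (fun s => toL2 (u s)) s) s :=
      ((h.contDiffOn.differentiableOn one_ne_zero s hs').differentiableAt
        ((isOpen_timeIoo T).mem_nhds hs')).hasDerivAt
    have h2 := (coef n ∘L opK k hk).hasFDerivAt.comp_hasDerivAt s h1
    have h3 : (fun s => coef n (toL2 (opKC hk (u s)))) =
        (coef n ∘L opK k hk) ∘ fun s => toL2 (u s) := funext fun s => by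
      rw [toL2_opKC]; rfl
    rw [h3]
    refine h2.congr_deriv ?_
    have h4 := isLap_opKC hk (h.memH2 s hsI) (h.left s hsI) (h.right s hsI) n
    rw [h.pde s hs', ContinuousLinearMap.comp_apply, map_add, map_smul,
      opK_weakDeriv_two hk hk0 (h.memH2 s hsI) (h.left s hsI), transformedRHS, opKinvC_opKC]
    simp only [map_add, map_smul, smul_eq_mul]
    rw [h4]
    ring
  have hNc : ContinuousOn (fun s => transformedRHS p F hk (opKC hk (u s))) (Icc 0 t) :=
    hN.continuous.comp_continuousOn (hwc.mono hsub)
  have hcc : ContinuousOn (fun s => coef n (toL2 (opKC hk (u s)))) (Icc 0 t) :=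
    (coef n).continuous.comp_continuousOn (continuous_toL2.comp_continuousOn (hwc.mono hsub))
  have hE : Continuous fun s => Real.exp (p * lam n * s) := by fun_prop
  have hint := intervalIntegral.integral_eq_sub_of_hasDerivAt_of_le ht.1
    (f := fun s => Real.exp (p * lam n * s) * coef n (toL2 (opKC hk (u s))))
    (f' := fun s => Real.exp (p * lam n * s) *
      coef n (transformedRHS p F hk (opKC hk (u s))))
    (hE.continuousOn.mul hcc) (fun s hs => by
      have h1 := (((hasDerivAt_id s).const_mul (p * lam n)).exp).mul (hd s hs)
      refine h1.congr_deriv ?_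
      simp only [id]
      ring)
    ((hE.continuousOn.mul (continuousOn_coef hNc)).intervalIntegrable_of_Icc ht.1)
  rw [duh_eq, hint, h.initial, mul_zero, Real.exp_zero, one_mul, mul_sub, ← mul_assoc,
    ← Real.exp_add]
  have : -(p * lam n) * t + p * lam n * t = 0 := by ring
  rw [this, Real.exp_zero]
  ring

/-- The properties of `K u` for a strict solution `u`. -/
theorem strict_of_isMild (hp : 0 < p) (hk : ContDiffOn ℝ 2 k (Icc 0 1))
    (hN : LipOnBounded (transformedRHS p F hk)) {q₀ : L2}
    (h₀ : IsLap (opKC hk u₀) q₀) {u : ℝ → C01}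
    (hw : ∀ T' : ℝ, (T' : EReal) < T →
      IsMild p (transformedRHS p F hk) (opKC hk u₀) T' (fun t => opKC hk (u t))) :
    (∀ t ∈ timeIco T, MemH 2 (toL2 (u t)) ∧ toFun (u t) 0 = 0 ∧ toFun (u t) 1 = pairing k (u t)) ∧
    ContinuousOn (fun t => fluxDeriv k hk (u t)) (timeIco T) ∧
    ∀ t ∈ timeIco T, HasDerivWithinAt (fun s => toL2 (opKC hk (u s)))
      (p • fluxDeriv k hk (u t) + transformedRHS p F hk (opKC hk (u t))) (timeIco T) t := by
  have hreg : ∀ t ∈ timeIco T, ∃ T' : ℝ, t < T' ∧ (T' : EReal) < T ∧ ∃ q : ℝ → L2,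
      ContinuousOn q (Icc 0 T') ∧ (∀ t ∈ Icc 0 T', IsLap (opKC hk (u t)) (q t)) ∧
      ∀ t ∈ Icc 0 T', HasDerivWithinAt (fun s => toL2 (opKC hk (u s)))
        (p • q t + transformedRHS p F hk (opKC hk (u t))) (Icc 0 T') t := by
    intro t ht
    obtain ⟨T', h1, h2⟩ := exists_real_btwn_of_mem_timeIco ht
    exact ⟨T', h1, h2, (hw T' h2).regularity hp hN h₀ (ht.1.trans h1.le)⟩
  have hmem : ∀ t ∈ timeIco T, MemH 2 (toL2 (u t)) ∧ toFun (u t) 0 = 0 ∧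
      toFun (u t) 1 = pairing k (u t) := by
    intro t ht
    obtain ⟨T', h1, h2, q, -, hq, -⟩ := hreg t ht
    obtain ⟨e0, e1, w₁, hH⟩ := isH2_of_coef (hq t ⟨ht.1, h1.le⟩)
    obtain ⟨u₁, u₂, hu⟩ := exists_isH2_of_opKC hk hH
    rw [toFun_opKC_zero] at e0
    rw [toFun_opKC_one] at e1
    exact ⟨hu.memH, e0, sub_eq_zero.1 e1⟩
  -- The curve `q` depends on the choice of `T'`; its values do not, since the Laplacian is
  -- determined by coefficients. This makes the local statements fit together.
  have hqeq : ∀ t ∈ timeIco T, ∀ q : L2, IsLap (opKC hk (u t)) q → q = fluxDeriv k hk (u t) := by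
    intro t ht q hq
    obtain ⟨m1, m2, m3⟩ := hmem t ht
    exact ext_coef fun n => (hq n).trans (isLap_opKC hk m1 m2 m3 n).symm
  refine ⟨hmem, fun t ht => ?_, fun t ht => ?_⟩
  · obtain ⟨T', h1, h2, q, hqc, hq, -⟩ := hreg t ht
    have h3 := (hqc t ⟨ht.1, h1.le⟩).mono_of_mem_nhdsWithin
      (Icc_mem_nhdsWithin_timeIco (T := T) h1)
    refine h3.congr_of_eventuallyEq ?_ (hqeq t ht _ (hq t ⟨ht.1, h1.le⟩)).symm
    filter_upwards [Icc_mem_nhdsWithin_timeIco (T := T) h1] with s hs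
    exact (hqeq s (Icc_subset_timeIco h2 hs) _ (hq s hs)).symm
  · obtain ⟨T', h1, h2, q, -, hq, hd⟩ := hreg t ht
    rw [← hqeq t ht _ (hq t ⟨ht.1, h1.le⟩)]
    exact (hd t ⟨ht.1, h1.le⟩).mono_of_mem_nhdsWithin (Icc_mem_nhdsWithin_timeIco h1)

/-- The strict equation for `K u` is pulled back by `opKinv`: its right-hand side is `K` applied to
that of the original equation. -/
theorem isSolution_of_isMild (hp : 0 < p) (hk : ContDiffOn ℝ 2 k (Icc 0 1)) (hk0 : k 0 = 0)
    (hN : LipOnBounded (transformedRHS p F hk)) {q₀ : L2} (h₀ : IsLap (opKC hk u₀) q₀)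
    (hT : 0 < T) {u : ℝ → C01}
    (hw : ∀ T' : ℝ, (T' : EReal) < T →
      IsMild p (transformedRHS p F hk) (opKC hk u₀) T' (fun t => opKC hk (u t))) :
    IsSolution p F k u₀ T u := by
  obtain ⟨hmem, hqc, hd⟩ := strict_of_isMild hp hk hN h₀ hw
  have hwc : ContinuousOn (fun t => opKC hk (u t)) (timeIco T) := by
    intro t ht
    obtain ⟨T', h1, h2⟩ := exists_real_btwn_of_mem_timeIco ht
    exact ((hw T' h2).continuousOn t ⟨ht.1, h1.le⟩).mono_of_mem_nhdsWithin
      (Icc_mem_nhdsWithin_timeIco h1)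
  have huc : ContinuousOn u (timeIco T) :=
    ((opKinvC hk).continuous.comp_continuousOn hwc).congr fun t _ => (opKinvC_opKC hk (u t)).symm
  have hder : ∀ t ∈ timeIoo T, HasDerivAt (fun s => toL2 (u s))
      (opKinv hk (p • fluxDeriv k hk (u t) + transformedRHS p F hk (opKC hk (u t)))) t := by
    intro t ht
    have h1 := (hd t (timeIoo_subset_timeIco T ht)).hasDerivAt
      (mem_of_superset ((isOpen_timeIoo T).mem_nhds ht) (timeIoo_subset_timeIco T))
    have h2 := (opKinv hk).hasFDerivAt.comp_hasDerivAt t h1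
    have h3 : (fun s => toL2 (u s)) = opKinv hk ∘ fun s => toL2 (opKC hk (u s)) :=
      funext fun s => by rw [Function.comp_apply, toL2_opKC, opKinv_opK]
    rw [h3]
    exact h2
  refine ⟨?_, ?_, ?_, fun t ht => (hmem t ht).1, fun t ht => ?_, fun t ht => (hmem t ht).2.1,
    fun t ht => (hmem t ht).2.2⟩
  · exact (continuous_eval.comp_continuousOn
      ((huc.comp continuousOn_fst fun z hz => hz.1).prodMk continuousOn_snd))
  · have hopen := (isOpen_timeIoo T).uniqueDiffOn (𝕜 := ℝ)
    refine (contDiffOn_one_iff_derivWithin hopen).2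
      ⟨fun t ht => (hder t ht).differentiableAt.differentiableWithinAt, ?_⟩
    have hcont : ContinuousOn (fun t => opKinv hk (p • fluxDeriv k hk (u t) +
        transformedRHS p F hk (opKC hk (u t)))) (timeIoo T) :=
      (opKinv hk).continuous.comp_continuousOn (((hqc.const_smul p).add
        (hN.continuous.comp_continuousOn hwc)).mono (timeIoo_subset_timeIco T))
    exact hcont.congr fun t ht => (hder t ht).hasDerivWithinAt.derivWithin (hopen t ht)
  · obtain ⟨T', h1, h2⟩ := exists_real_btwn_of_mem_timeIco (t := 0) ⟨le_rfl, hT⟩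
    have h3 := (hw T' h2).initial h1.le
    rw [← opKinvC_opKC hk (u 0), h3, opKinvC_opKC]
  · have htI := timeIoo_subset_timeIco T ht
    obtain ⟨m1, m2, -⟩ := hmem t htI
    have h1 := opK_weakDeriv_two hk hk0 m1 m2
    rw [(hder t ht).deriv, transformedRHS, opKinvC_opKC]
    have h2 : p • fluxDeriv k hk (u t) + (opK k hk (toL2 (F (u t))) + p • opG k hk (toL2 (u t))) =
        opK k hk (p • weakDeriv 2 (toL2 (u t)) + toL2 (F (u t))) := by
      rw [map_add, map_smul, h1, smul_add]
      abel
    rw [h2, opKinv_opK]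

/-! ### The energy identity -/

/-- Green's formula for `w = K u`: the flux is `w_x`, `fluxDeriv` is `w_xx`, and `w` vanishes at
both ends. -/
theorem norm_flux_sq {k : ℝ → ℝ} (hk : ContDiffOn ℝ 2 k (Icc 0 1)) {u : C01}
    (hu : MemH 2 (toL2 u)) (h0 : toFun u 0 = 0) (h1 : toFun u 1 = pairing k u) :
    ‖flux k hk u‖ ^ 2 = -inner ℝ (fluxDeriv k hk u) (toL2 (opKC hk u)) := by
  obtain ⟨u₁, u₂, h⟩ := hu.exists_isH2
  have hH := h.opKC hk
  rw [hH.inner_eq hH.fst (by rw [toFun_opKC_zero, h0])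
    (by rw [toFun_opKC_one, h1, sub_self]), neg_neg, ← real_inner_self_eq_norm_sq,
    inner_L2_eq _ _ (h.flux_ae hk) (h.flux_ae hk)]

theorem inner_fluxDeriv_symm {k : ℝ → ℝ} (hk : ContDiffOn ℝ 2 k (Icc 0 1)) {u v : C01}
    (hu : MemH 2 (toL2 u)) (hu0 : toFun u 0 = 0) (hu1 : toFun u 1 = pairing k u)
    (hv : MemH 2 (toL2 v)) (hv0 : toFun v 0 = 0) (hv1 : toFun v 1 = pairing k v) :
    inner ℝ (fluxDeriv k hk u) (toL2 (opKC hk v)) =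
      inner ℝ (fluxDeriv k hk v) (toL2 (opKC hk u)) := by
  obtain ⟨u₁, u₂, h⟩ := hu.exists_isH2
  obtain ⟨v₁, v₂, h'⟩ := hv.exists_isH2
  rw [(h.opKC hk).inner_symm (h'.opKC hk) (by rw [toFun_opKC_zero, hu0])
    (by rw [toFun_opKC_one, hu1, sub_self]) (by rw [toFun_opKC_zero, hv0])
    (by rw [toFun_opKC_one, hv1, sub_self]), real_inner_comm]

/-- If `q` is continuous, `W` is differentiable and `⟨q t, W s⟩` is symmetric in `s, t`, then
`-⟨q, W⟩` has the derivative `-2 ⟨q, W'⟩`. -/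
theorem hasDerivWithinAt_neg_inner {H : Type*} [NormedAddCommGroup H] [InnerProductSpace ℝ H]
    {q W : ℝ → H} {S : Set ℝ} {t : ℝ} {W' : H} (ht : t ∈ S)
    (hsymm : ∀ s ∈ S, ∀ r ∈ S, inner ℝ (q s) (W r) = inner ℝ (q r) (W s))
    (hq : ContinuousWithinAt q S t) (hW : HasDerivWithinAt W W' S t) :
    HasDerivWithinAt (fun s => -inner ℝ (q s) (W s)) (-2 * inner ℝ (q t) W') S t := by
  rw [hasDerivWithinAt_iff_tendsto_slope] at hW ⊢
  have hq' : Tendsto q (𝓝[S \ {t}] t) (𝓝 (q t)) := hq.mono_left (nhdsWithin_mono t sdiff_subset)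
  -- By symmetry the difference quotient of `⟨q, W⟩` equals `⟨q s + q t, slope of W⟩`, so continuity
  -- of `q` suffices.
  have h1 := ((hq'.add_const (q t)).inner (𝕜 := ℝ) hW).neg
  have h2 : -inner ℝ (q t + q t) W' = -2 * inner ℝ (q t) W' := by
    rw [inner_add_left]; ring
  rw [h2] at h1
  refine h1.congr' ?_
  filter_upwards [self_mem_nhdsWithin] with s hs
  have h3 := hsymm s hs.1 t ht
  rw [slope, slope, vsub_eq_sub, vsub_eq_sub, inner_smul_right, smul_eq_mul, inner_sub_right,
    inner_add_left, inner_add_left]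
  linear_combination (s - t)⁻¹ * h3

theorem energy_of_isMild (hp : 0 < p) (hk : ContDiffOn ℝ 2 k (Icc 0 1))
    (hN : LipOnBounded (transformedRHS p F hk)) {q₀ : L2} (h₀ : IsLap (opKC hk u₀) q₀)
    (hT : 0 < T) {u : ℝ → C01}
    (hw : ∀ T' : ℝ, (T' : EReal) < T →
      IsMild p (transformedRHS p F hk) (opKC hk u₀) T' (fun t => opKC hk (u t)))
    (hu : ContinuousOn u (timeIco T)) :
    ContDiffOn ℝ 1 (fun t => ‖flux k hk (u t)‖ ^ 2) (timeIco T) ∧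
      ∀ t ∈ timeIco T, HasDerivWithinAt (fun s => ‖flux k hk (u s)‖ ^ 2)
        (-2 * p * ‖fluxDeriv k hk (u t)‖ ^ 2
          - 2 * inner ℝ (opK k hk (toL2 (F (u t))) + p • opG k hk (toL2 (u t)))
              (fluxDeriv k hk (u t))) (timeIco T) t := by
  obtain ⟨hmem, hqc, hd⟩ := strict_of_isMild hp hk hN h₀ hw
  have hder : ∀ t ∈ timeIco T, HasDerivWithinAt (fun s => ‖flux k hk (u s)‖ ^ 2)
        (-2 * p * ‖fluxDeriv k hk (u t)‖ ^ 2
          - 2 * inner ℝ (opK k hk (toL2 (F (u t))) + p • opG k hk (toL2 (u t)))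
              (fluxDeriv k hk (u t))) (timeIco T) t := by
    intro t ht
    have h1 := hasDerivWithinAt_neg_inner ht (fun s hs r hr =>
      inner_fluxDeriv_symm hk (hmem s hs).1 (hmem s hs).2.1 (hmem s hs).2.2
        (hmem r hr).1 (hmem r hr).2.1 (hmem r hr).2.2) (hqc t ht) (hd t ht)
    have h2 := h1.congr (f₁ := fun s => ‖flux k hk (u s)‖ ^ 2)
      (fun s hs => norm_flux_sq hk (hmem s hs).1 (hmem s hs).2.1 (hmem s hs).2.2)
      (norm_flux_sq hk (hmem t ht).1 (hmem t ht).2.1 (hmem t ht).2.2)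
    refine h2.congr_deriv ?_
    rw [transformedRHS, opKinvC_opKC, inner_add_right, inner_smul_right,
      real_inner_self_eq_norm_sq, real_inner_comm]
    ring
  refine ⟨(contDiffOn_one_iff_derivWithin (uniqueDiffOn_timeIco hT)).2
    ⟨fun t ht => (hder t ht).differentiableWithinAt, ?_⟩, hder⟩
  have hNu : ContinuousOn (fun t => opK k hk (toL2 (F (u t))) + p • opG k hk (toL2 (u t)))
      (timeIco T) := by
    have h1 : ContinuousOn (fun t => transformedRHS p F hk (opKC hk (u t))) (timeIco T) :=
      hN.continuous.comp_continuousOn ((opKC hk).continuous.comp_continuousOn hu)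
    simpa only [transformedRHS, opKinvC_opKC] using h1
  have hcont : ContinuousOn (fun t => -2 * p * ‖fluxDeriv k hk (u t)‖ ^ 2
      - 2 * inner ℝ (opK k hk (toL2 (F (u t))) + p • opG k hk (toL2 (u t)))
        (fluxDeriv k hk (u t))) (timeIco T) :=
    ((hqc.norm.pow 2).const_mul _).sub ((hNu.inner (𝕜 := ℝ) hqc).const_mul _)
  exact hcont.congr fun t ht => (hder t ht).derivWithin (uniqueDiffOn_timeIco hT t ht)

end Equivalence

/-! ### The maximal solution and the theorem -/

/-- The maximal mild solution. -/
theorem exists_maximal_isMild {p : ℝ} (hp : 0 < p) {N : C01 → L2} (hN : LipOnBounded N)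
    {w₀ : C01} {q₀ : L2} (h₀ : IsLap w₀ q₀) :
    ∃ (tmax : EReal) (w : ℝ → C01), 0 < tmax ∧
      (∀ T : ℝ, (T : EReal) < tmax → IsMild p N w₀ T w) ∧
      (∀ (T : ℝ) (v : ℝ → C01), 0 ≤ T → IsMild p N w₀ T v → (T : EReal) ≤ tmax) ∧
      ∀ T : ℝ, tmax = (T : EReal) → Tendsto (fun t => ‖w t‖) (𝓝[<] T) atTop := by
  classical
  set A : Set ℝ := {T | 0 ≤ T ∧ ∃ v, IsMild p N w₀ T v} with hA
  set tmax : EReal := sSup ((fun T : ℝ => (T : EReal)) '' A) with htmax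
  have hle : ∀ T ∈ A, (T : EReal) ≤ tmax := fun T hT => le_sSup ⟨T, hT, rfl⟩
  have hlt : ∀ t : ℝ, (t : EReal) < tmax → ∃ T ∈ A, t < T := by
    intro t ht
    obtain ⟨_, ⟨T, hT, rfl⟩, h⟩ := lt_sSup_iff.1 ht
    exact ⟨T, hT, EReal.coe_lt_coe_iff.1 h⟩
  -- At each `t` some mild solution living beyond `t` is chosen; by uniqueness the choice is
  -- immaterial. The value `0` is taken only outside the existence interval.
  set w : ℝ → C01 := fun t => if h : ∃ T, T ∈ A ∧ t < T then h.choose_spec.1.2.choose t else 0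
    with hwdef
  have hwv : ∀ t : ℝ, 0 ≤ t → (t : EReal) < tmax → ∀ T v, IsMild p N w₀ T v → t ≤ T → w t = v t := by
    intro t ht0 ht T v hv htT
    have h : ∃ T, T ∈ A ∧ t < T := hlt t ht
    have h1 : w t = h.choose_spec.1.2.choose t := dif_pos h
    rw [h1]
    exact (h.choose_spec.1.2.choose_spec.mono h.choose_spec.2.le).eq hp hN (hv.mono htT) t
      ⟨ht0, le_rfl⟩
  have hwm : ∀ T : ℝ, (T : EReal) < tmax → IsMild p N w₀ T w := by
    intro T hT
    obtain ⟨T₁, ⟨-, v, hv⟩, hT₁⟩ := hlt T hT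
    refine (hv.mono hT₁.le).congr (fun t ht => ?_) fun _ _ => rfl
    exact hwv t ht.1 ((EReal.coe_le_coe_iff.2 ht.2).trans_lt hT) T₁ v hv (ht.2.trans hT₁.le)
  have hpos : 0 < tmax := by
    obtain ⟨T, hT, v, hv⟩ := exists_isMild hp hN h₀
    exact (EReal.coe_pos.2 hT).trans_le (hle T ⟨hT.le, v, hv⟩)
  refine ⟨tmax, w, hpos, hwm, fun T v hT hv => hle T ⟨hT, v, hv⟩, fun T hT => ?_⟩
  -- Without blow-up the solution would be bounded on `[0,T)` and extend past the supremum of the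
  -- existence times.
  by_contra hcon
  have hT0 : 0 < T := by rw [hT] at hpos; exact EReal.coe_pos.1 hpos
  have hwT : ∀ T' < T, IsMild p N w₀ T' w := fun T' h =>
    hwm T' (by rw [hT]; exact EReal.coe_lt_coe_iff.2 h)
  obtain ⟨R, hR⟩ := exists_bound_of_not_tendsto hp hN h₀ hT0 hwT hcon
  obtain ⟨T₁, hT₁, v, hv⟩ := exists_isMild_extension hp hN h₀ hT0 hwT hR
  have h1 := hle T₁ ⟨hT0.le.trans hT₁.le, v, hv⟩
  rw [hT] at h1
  exact absurd (EReal.coe_le_coe_iff.1 h1) (not_le.2 hT₁)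

end ReactionDiffusion

end

theorem theorem3p1 (p : ℝ) (hp : 0 < p) (F : C01 → C01) (hFc : Continuous F) (hF0 : F 0 = 0)
    (L : ℝ → ℝ) (hLpos : ∀ r, 0 ≤ r → 0 < L r) (hLmono : MonotoneOn L (Set.Ici 0))
    (hFL : ∀ u v : C01, ‖F u - F v‖ ≤ L (max ‖u‖ ‖v‖) * ‖u - v‖)
    (k : ℝ → ℝ) (hk : ContDiffOn ℝ 2 k (Set.Icc 0 1)) (hk0 : k 0 = 0)
    (u₀ : C01) (hu₀ : MemH 2 (toL2 u₀)) (hu₀0 : toFun u₀ 0 = 0)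
    (hu₀1 : toFun u₀ 1 = pairing k u₀) :
    ∃ (tmax : EReal) (u : ℝ → C01), 0 < tmax ∧
      IsSolution p F k u₀ tmax u ∧
      -- uniqueness and maximality
      (∀ (T : EReal) (v : ℝ → C01), 0 < T → IsSolution p F k u₀ T v →
        T ≤ tmax ∧ ∀ t ∈ timeIco T, v t = u t) ∧
      -- regularity and evolution of the squared norm of `u_x - k u`
      ContDiffOn ℝ 1 (fun t => ‖flux k hk (u t)‖ ^ 2) (timeIco tmax) ∧
      (∀ t ∈ timeIco tmax,
        HasDerivWithinAt (fun s => ‖flux k hk (u s)‖ ^ 2)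
          (-2 * p * ‖fluxDeriv k hk (u t)‖ ^ 2
            - 2 * inner ℝ (opK k hk (toL2 (F (u t))) + p • opG k hk (toL2 (u t)))
                (fluxDeriv k hk (u t)))
          (timeIco tmax) t) ∧
      -- blow-up of the sup-norm if the maximal time is finite
      (∀ T : ℝ, tmax = (T : EReal) →
        Filter.Tendsto (fun t => ‖u t‖) (nhdsWithin T (Set.Iio T)) Filter.atTop) := by
  have hN := lipOnBounded_transformedRHS p hLpos hLmono hFL hk
  have h₀ := isLap_opKC hk hu₀ hu₀0 hu₀1
  obtain ⟨tmax, w, hpos, hw, hmax, hblow⟩ := exists_maximal_isMild hp hN h₀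
  have hKu : (fun t => opKC hk (opKinvC hk (w t))) = w := funext fun t => opKC_opKinvC hk (w t)
  have hw' : ∀ T' : ℝ, (T' : EReal) < tmax → IsMild p (transformedRHS p F hk) (opKC hk u₀) T'
      (fun t => opKC hk (opKinvC hk (w t))) := by rw [hKu]; exact hw
  have hsol := isSolution_of_isMild hp hk hk0 hN h₀ hpos hw'
  obtain ⟨hE1, hE2⟩ := energy_of_isMild hp hk hN h₀ hpos hw' hsol.continuousOn_curve
  refine ⟨tmax, fun t => opKinvC hk (w t), hpos, hsol, fun T v hT hv => ?_, hE1, hE2,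
    fun T hT => ?_⟩
  · have hvm : ∀ T' : ℝ, (T' : EReal) < T → IsMild p (transformedRHS p F hk) (opKC hk u₀) T'
        (fun t => opKC hk (v t)) := fun T' h => hv.isMild hk hk0 hN h
    have hle : T ≤ tmax := by
      by_contra! hlt
      -- A real time strictly between `tmax` and `T` would be an existence time of a mild solution
      -- exceeding the supremum.
      obtain ⟨c, hc1, hc2⟩ := EReal.lt_iff_exists_real_btwn.1 hlt
      have hc0 : 0 ≤ c := EReal.coe_nonneg.1 (hpos.trans hc1).le
      exact absurd hc1 (not_lt.2 (hmax c _ hc0 (hvm c hc2)))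
    refine ⟨hle, fun t ht => ?_⟩
    have h1 := (hvm t ht.2).eq hp hN (hw t (ht.2.trans_le hle)) t ⟨ht.1, le_rfl⟩
    change v t = opKinvC hk (w t)
    rw [← h1, opKinvC_opKC]
  -- Blow-up passes from `w` to `u` through `‖w‖ ≤ ‖K‖ ‖u‖`; adding one to the operator norm makes
  -- the divisor positive.
  · have h1 := (hblow T hT).atTop_div_const (r := ‖opKC hk‖ + 1) (by positivity)
    refine Filter.tendsto_atTop_mono (fun t => ?_) h1
    rw [div_le_iff₀ (by positivity)]
    have h2 := (opKC hk).le_opNorm (opKinvC hk (w t))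
    rw [opKC_opKinvC] at h2
    have := norm_nonneg (opKinvC hk (w t))
    linarith
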